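/- Let $K$ be a field, $n\ge 3$ and $C=(c_{ij})_{2\le i,j\le n-1}\in \mathrm{GL}_{n-2}(K)$, with inverse $C^{-1}=(d_{ij})_{2\le i,j\le n-1}$. For a matrix $B=(b_{ij})_{2\le i,j\le n-1}$ let $A_n(B)$ be the $K$-algebra given by the quiver with vertices $1,\dots,n$ and arrows $1\to j$, $j\to 1$, $j\to n$, $n\to j$ $(2\le j\le n-1)$ and the relations $$(1\,i\,n)=(1\,j\,n),\quad (n\,i\,1)=(n\,j\,1),\quad (i\,1\,j)=b_{ij}\,(i\,n\,j),\quad (n\,j\,n)=0\qquad(2\le i,j\le n-1),$$ where $(i_1 i_2\dots i_r)$ denotes the path $i_1\to i_2\to\dots\to i_r$, $e_i$ is the trivial path at $i$, and the product of arrows is $(i\to j)\cdot(k\to i)=(k\to i\to j)$. The vertices are ordered by $1<j<n$ for $2\le j\le n-1$, and $2,\dots,n-1$ are pairwise incomparable. Modules are finite dimensional left modules. Write $A=A_n(C)$, $P(i)=Ae_i$, $I(i)=\mathrm{Hom}_K(e_iA,K)$, $S(i)$ for the simple top of $P(i)$, and $[M:S(i)]=\dim_K e_iM$. Let $\Delta(i)$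 be the largest factor module of $P(i)$, and $\nabla(i)$ the largest submodule of $I(i)$, having no composition factor $S(k)$ with $k\not\le i$. A module $M$ is called a tilting module $T(i)$ if it is indecomposable, has a filtration with all subquotients of the form $\Delta(j)$ and a filtration with all subquotients of the form $\nabla(j)$, and if $(M:\Delta(i))=(M:\nabla(i))=[M:S(i)]=1$ and $(M:\Delta(j))=(M:\nabla(j))=[M:S(j)]=0$ for all $j\not\le i$; here $(M:\Delta(j))$ and $(M:\nabla(j))$ are the numbers of subquotients isomorphic to $\Delta(j)$ and $\nabla(j)$ in such filtrations. Then: (1) Put $\mathbf t(1)=(1\,2\,n\,2\,1)$, $\mathbf t(i)=\sum_{j=2}^{n-1}d_{ij}\,(1\,j\,1)$ for $2\le i\le n-1$, and $\mathbf t(n)=e_1$. For every vertex $i$ the module $A\cdot\mathbf t(i)$ generated by $\mathbf t(i)$ is the indecomposable tilting module $T(i)$: it has the properties above, and every module with these properties is isomorphic to it. (2) Let $T=\bigoplus_{i}T(i)$ be the characteristic tilting module, for any choice of the modules $T(i)$, and let $R(A)$ be the Ringel dual of $A$, that is, the algebra of $A$-endomorphisms of $T$ with composition of maps as product (so that $T$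 is a left $R(A)$-module; this is $\mathrm{End}_A(T)^{op}$ when endomorphisms of left modules are written on the right). Then $R(A_n(C))\cong A_n(C^{-1})$ as $K$-algebras, by an isomorphism that sends the projections of $T$ onto $T(1)$, $T(j)$ $(2\le j\le n-1)$, $T(n)$ to $e_n$, $e_j$, $e_1$ respectively. Equivalently, the opposite of this algebra is isomorphic to $A_n((C^{-1})^{\mathrm{tr}})$, with the same correspondence of idempotents. -/

import Mathlib

open scoped DirectSum Matrix

universe u w

noncomputable section

/-! ### Path algebras of finite quivers -/

section PathAlgebra

variable (K : Type u) [Field K] (V : Type) [Quiver.{0} V] [Fintype V]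

/-- Generators of the path algebra: the trivial paths (vertices) and the arrows. -/
abbrev PathGen : Type := V ⊕ (Σ s t : V, s ⟶ t)

/-- The relations presenting the path algebra `KQ` of a finite quiver: the trivial paths are
orthogonal idempotents with sum `1`, and `e_t * a = a = a * e_s` for an arrow `a : s ⟶ t`.
So the product of arrows `(i → j) * (k → i)` is the path `k → i → j`, and
`(i → j) * (k → l) = 0` when `l ≠ i`. -/
inductive PathRel : FreeAlgebra K (PathGen V) → FreeAlgebra K (PathGen V) → Prop
  | idem (v : V) : PathRel
      (FreeAlgebra.ι K (Sum.inl v) * FreeAlgebra.ι K (Sum.inl v)) (FreeAlgebra.ι K (Sum.inl v))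
  | orth (v v' : V) (h : v ≠ v') : PathRel
      (FreeAlgebra.ι K (Sum.inl v) * FreeAlgebra.ι K (Sum.inl v')) 0
  | sum_one : PathRel (∑ v : V, FreeAlgebra.ι K (Sum.inl v)) 1
  | target (s t : V) (a : s ⟶ t) : PathRel
      (FreeAlgebra.ι K (Sum.inl t) * FreeAlgebra.ι K (Sum.inr ⟨s, t, a⟩))
      (FreeAlgebra.ι K (Sum.inr ⟨s, t, a⟩))
  | source (s t : V) (a : s ⟶ t) : PathRel
      (FreeAlgebra.ι K (Sum.inr ⟨s, t, a⟩) * FreeAlgebra.ι K (Sum.inl s))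
      (FreeAlgebra.ι K (Sum.inr ⟨s, t, a⟩))

/-- The path algebra `KQ` of a finite quiver. -/
def PathAlgebra : Type u := RingQuot (PathRel K V)

instance : Ring (PathAlgebra K V) := inferInstanceAs (Ring (RingQuot (PathRel K V)))

instance : Algebra K (PathAlgebra K V) :=
  inferInstanceAs (Algebra K (RingQuot (PathRel K V)))

variable {V}

/-- The trivial path at a vertex, as an element of the path algebra. -/
def PathAlgebra.vertex (v : V) : PathAlgebra K V :=
  RingQuot.mkAlgHom K (PathRel K V) (FreeAlgebra.ι K (Sum.inl v))

/-- An arrow, as an element of the path algebra. -/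
def PathAlgebra.arrow {s t : V} (a : s ⟶ t) : PathAlgebra K V :=
  RingQuot.mkAlgHom K (PathRel K V) (FreeAlgebra.ι K (Sum.inr ⟨s, t, a⟩))

end PathAlgebra

/-! ### Standard, costandard and tilting modules

Here `A` is a `K`-algebra with a family of idempotents `e i` indexed by a partially ordered set
of vertices. Modules are left modules. -/

section Modules

variable (K : Type u) [Field K] {A : Type u} [Ring A] [Algebra K A]
variable {V : Type} [PartialOrder V] (e : V → A)

/-- The Jordan–Hölder multiplicity `[M : S(k)] = dim_K M_k`, where `M_k = e_k M`. -/
def jhMult (k : V) (M : Type w) [AddCommGroup M] [Module K M] [Module A M]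
    [IsScalarTower K A M] : ℕ :=
  Module.finrank K (LinearMap.range (Algebra.lsmul K K M (e k)))

/-- The projective module `P(i) = A e_i`. -/
def projModule (i : V) : Submodule A A := Submodule.span A {e i}

/-- The standard module `Δ(i)`: the largest factor module of `P(i)` without composition factor
`S(k)`, `k ≰ i` (the quotient by the smallest submodule for which `e_k` kills the quotient). -/
abbrev StdModule (i : V) : Type u :=
  projModule e i ⧸
    sInf {N : Submodule A (projModule e i) | ∀ k, ¬ k ≤ i → ∀ x, e k • x ∈ N}

variable (A) in
/-- The dual `D A = Hom_K(A, K)`, a left `A`-module by `(a • f) x = f (x * a)`. -/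
def DualModule : Type u := A →ₗ[K] K

instance : AddCommGroup (DualModule K A) := inferInstanceAs (AddCommGroup (A →ₗ[K] K))

instance : FunLike (DualModule K A) A K := inferInstanceAs (FunLike (A →ₗ[K] K) A K)

instance : Module A (DualModule K A) where
  smul a f := LinearMap.comp (f : A →ₗ[K] K) (LinearMap.mulRight K a)
  one_smul f := LinearMap.ext fun x => congrArg f (mul_one x)
  mul_smul a b f := LinearMap.ext fun x => congrArg f (mul_assoc x a b).symm
  smul_zero _ := rfl
  smul_add _ _ _ := rfl
  add_smul a b f := LinearMap.ext fun x =>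
    (congrArg f (mul_add x a b)).trans (LinearMap.map_add (f : A →ₗ[K] K) _ _)
  zero_smul f := LinearMap.ext fun x =>
    (congrArg f (mul_zero x)).trans (LinearMap.map_zero (f : A →ₗ[K] K))

theorem DualModule.smul_apply (a : A) (f : DualModule K A) (x : A) : (a • f) x = f (x * a) := rfl

/-- The injective module `I(i) = Hom_K(e_i A, K)`, realised as the direct summand of `D A`
consisting of the functionals that vanish on `(1 - e_i) A`. -/
def injModule (i : V) : Submodule A (DualModule K A) where
  carrier := {f | ∀ x, f (e i * x) = f x}
  zero_mem' := fun _ => rfl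
  add_mem' := fun {f g} hf hg x => congrArg₂ (· + ·) (hf x) (hg x)
  smul_mem' := fun a f hf x => by
    rw [DualModule.smul_apply, DualModule.smul_apply, mul_assoc]
    exact hf (x * a)

/-- The costandard module `∇(i)`: the largest submodule of `I(i)` without composition factor
`S(k)`, `k ≰ i`. -/
def costdModule (i : V) : Submodule A (DualModule K A) :=
  sSup {N | N ≤ injModule K e i ∧ ∀ k, ¬ k ≤ i → ∀ x ∈ N, e k • x = 0}

variable (A) in
/-- `M` has a filtration `0 = F 0 ≤ F 1 ≤ ⋯ ≤ F t = M` all of whose subquotients are isomorphic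
to modules of the family `X`, with `X j` occurring exactly `c j` times. -/
def HasFiltration (X : V → Type u) [∀ i, AddCommGroup (X i)] [∀ i, Module A (X i)]
    (M : Type w) [AddCommGroup M] [Module A M] (c : V → ℕ) : Prop :=
  ∃ (t : ℕ) (F : Fin (t + 1) → Submodule A M) (label : Fin t → V),
    F 0 = ⊥ ∧ F (Fin.last t) = ⊤ ∧ Monotone F ∧
    (∀ s : Fin t, Nonempty
      ((F s.succ ⧸ (F s.castSucc).submoduleOf (F s.succ)) ≃ₗ[A] X (label s))) ∧
    ∀ j, c j = Nat.card {s : Fin t // label s = j}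

variable (A) in
/-- A module is indecomposable if it is nonzero and not a direct sum of two nonzero submodules. -/
def IsIndecomposableModule (M : Type w) [AddCommGroup M] [Module A M] : Prop :=
  Nontrivial M ∧ ∀ N N' : Submodule A M, IsCompl N N' → N = ⊥ ∨ N' = ⊥

/-- `M` is (a model of) the indecomposable tilting module `T(i)`: a finite dimensional
indecomposable module with a `Δ`-good and a `∇`-good filtration such that
`(M : Δ(i)) = (M : ∇(i)) = [M : S(i)] = 1` and
`(M : Δ(j)) = (M : ∇(j)) = [M : S(j)] = 0` for all `j ≰ i`. -/
structure IsTiltingModule (i : V) (M : Type w) [AddCommGroup M] [Module K M] [Module A M]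
    [IsScalarTower K A M] : Prop where
  finite : Module.Finite K M
  indecomposable : IsIndecomposableModule A M
  std : ∃ c : V → ℕ, HasFiltration A (StdModule e) M c ∧ c i = 1 ∧ ∀ j, ¬ j ≤ i → c j = 0
  costd : ∃ c : V → ℕ,
    HasFiltration A (fun j => costdModule K e j) M c ∧ c i = 1 ∧ ∀ j, ¬ j ≤ i → c j = 0
  mult_self : jhMult K e i M = 1
  mult_eq_zero : ∀ j, ¬ j ≤ i → jhMult K e j M = 0

end Modules

/-! ### The algebras `A_n(C)`, with `m = n - 2` -/

/-- The vertices `1` (`bot`), `2, …, n - 1` (`mid j` is the vertex `j + 2`) and `n` (`top`). -/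
inductive Vtx (m : ℕ) : Type
  | bot : Vtx m
  | mid (j : Fin m) : Vtx m
  | top : Vtx m
  deriving DecidableEq, Fintype

namespace Vtx

variable {m : ℕ}

/-- The order on the vertices: `1 < j < n` for `1 < j < n`, and `2, …, n - 1` are pairwise
incomparable. -/
protected def Le : Vtx m → Vtx m → Prop
  | bot, _ => True
  | _, top => True
  | mid i, mid j => i = j
  | mid _, bot => False
  | top, bot => False
  | top, mid _ => False

instance : PartialOrder (Vtx m) where
  le := Vtx.Le
  le_refl a := by cases a <;> simp [Vtx.Le]
  le_trans a b c := by cases a <;> cases b <;> cases c <;> simp +contextual [Vtx.Le]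
  le_antisymm a b := by cases a <;> cases b <;> simp +contextual [Vtx.Le]

/-- The arrows: `1 → j`, `j → 1`, `j → n` and `n → j` for `1 < j < n`. -/
inductive Arrow : Vtx m → Vtx m → Type
  | botMid (j : Fin m) : Arrow bot (mid j)
  | midBot (j : Fin m) : Arrow (mid j) bot
  | midTop (j : Fin m) : Arrow (mid j) top
  | topMid (j : Fin m) : Arrow top (mid j)

instance : Quiver.{0} (Vtx m) := ⟨Arrow⟩

/-- The interchange of the vertices `1` and `n`. -/
def swap : Vtx m → Vtx m
  | bot => top
  | mid j => mid j
  | top => bot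

end Vtx

section QHAlg

variable {K : Type u} [Field K] {m : ℕ}

variable (K m) in
/-- The path algebra of the quiver of `A_n(C)`. -/
abbrev QHPath : Type u := PathAlgebra K (Vtx m)

/-- The arrow `1 → j`. -/
abbrev pBM (j : Fin m) : QHPath K m := PathAlgebra.arrow K (Vtx.Arrow.botMid j)
/-- The arrow `j → 1`. -/
abbrev pMB (j : Fin m) : QHPath K m := PathAlgebra.arrow K (Vtx.Arrow.midBot j)
/-- The arrow `j → n`. -/
abbrev pMT (j : Fin m) : QHPath K m := PathAlgebra.arrow K (Vtx.Arrow.midTop j)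
/-- The arrow `n → j`. -/
abbrev pTM (j : Fin m) : QHPath K m := PathAlgebra.arrow K (Vtx.Arrow.topMid j)

/-- The relations of `A_n(C)`, for `1 < i, j < n`: `(1 i n) = (1 j n)`, `(n i 1) = (n j 1)`,
`(i 1 j) = c_{ij} (i n j)` and `(n j n) = 0`. -/
inductive QHRel (C : Matrix (Fin m) (Fin m) K) : QHPath K m → QHPath K m → Prop
  | botTop (i j : Fin m) : QHRel C (pMT i * pBM i) (pMT j * pBM j)
  | topBot (i j : Fin m) : QHRel C (pMB i * pTM i) (pMB j * pTM j)
  | mid (i j : Fin m) : QHRel C (pBM j * pMB i) (C i j • (pTM j * pMT i))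
  | topTop (j : Fin m) : QHRel C (pMT j * pTM j) 0

/-- The algebra `A_n(C)`, where `C` is an `(n - 2) × (n - 2)` matrix. -/
def QHAlg (C : Matrix (Fin m) (Fin m) K) : Type u := RingQuot (QHRel C)

namespace QHAlg

variable (C : Matrix (Fin m) (Fin m) K)

instance : Ring (QHAlg C) := inferInstanceAs (Ring (RingQuot (QHRel C)))

instance : Algebra K (QHAlg C) := inferInstanceAs (Algebra K (RingQuot (QHRel C)))

/-- The projection of the path algebra onto `A_n(C)`. -/
def proj : QHPath K m →ₐ[K] QHAlg C := RingQuot.mkAlgHom K (QHRel C)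

/-- The trivial path `e_v` in `A_n(C)`. -/
def e (v : Vtx m) : QHAlg C := proj C (PathAlgebra.vertex K v)

/-- The path `(1 j 1)`. -/
def loop (j : Fin m) : QHAlg C := proj C (pMB j * pBM j)

/-- The path `(1 j n j 1)`. -/
def longLoop (j : Fin m) : QHAlg C := proj C (pMB j * pTM j * pMT j * pBM j)

end QHAlg

/-- The elements `t(1) = (1 2 n 2 1)`, `t(i) = ∑_j d_{ij} (1 j 1)` for `1 < i < n`, where
`(d_{ij}) = C⁻¹`, and `t(n) = e_1` of `A_n(C)`. The hypothesis `0 < m` says `3 ≤ n`. -/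
def tiltGen (hm : 0 < m) (C : GL (Fin m) K) : Vtx m → QHAlg C.val
  | .bot => QHAlg.longLoop _ ⟨0, hm⟩
  | .mid i => ∑ j, C⁻¹.val i j • QHAlg.loop _ j
  | .top => QHAlg.e _ .bot

end QHAlg

/-- The Ringel dual for a choice of tilting modules `T i`: the algebra `End_A(T)^op` of
endomorphisms of `T = ⨁ i, T i`, where endomorphisms of left modules are written on the right
before passing to the opposite algebra. So its product is composition of maps, and `T` is a left
module over it by evaluation. -/
abbrev RingelDual (A : Type u) [Ring A] {V : Type} (T : V → Type w)
    [∀ i, AddCommGroup (T i)] [∀ i, Module A (T i)] : Type w :=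
  Module.End A (⨁ i, T i)

/-- The idempotent endomorphism of `⨁ i, T i` which projects onto the summand `T i`. -/
def summandProj (A : Type u) [Ring A] {V : Type} [DecidableEq V] (T : V → Type w)
    [∀ i, AddCommGroup (T i)] [∀ i, Module A (T i)] (i : V) : RingelDual A T :=
  DirectSum.lof A V T i ∘ₗ DirectSum.component A V T i

end

/-! Everything takes place in the left ideal `A e_1`. It has the basis `e_1`, `(1 j)`, `(1 j 1)`,
`(1 j n)`, `(1 i n j)`, `(1 j n j 1)`: the multiplication table shows that these paths span, and an
explicit representation on coordinate vectors shows that they are independent (`ofCoord_coord`,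
`coord_ofCoord`). Write `ll` for the longest path `(1 j n j 1)`, which does not depend on `j`. Since
`C` is invertible, every nonzero submodule of `A e_1` contains `ll` (`exists_mul_eq_ll`); moreover
`A e_1` is faithful (`eq_zero_of_forall_mul_e_bot`). Hence nonzero cyclic submodules of `A e_1` are
indecomposable, and an algebra map out of `A` is injective as soon as it does not kill `ll`.

The loops satisfy `(1 k 1 j) = c_{kj} (1 i n j)`. The rows of `C⁻¹` therefore give combinations
`t(i)` of loops which the arrow `1 → j` kills for `j ≠ i` and sends to `(1 k n i)` for `j = i`. So
`A t(i)` is uniserial with basis `t(i)`, `(1 k n i)`, `ll`, and `t(i) t(j) = d_{ij} ll`. This last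
identity is the source of `C⁻¹` in the Ringel dual.

Existence: explicit chains of submodules of `A e_1` have subquotients that are recognised as `Δ(k)`
or `∇(k)` from a generator, its relations and one nonvanishing path (`nonempty_equiv_stdModule`,
`nonempty_equiv_costdModule`).

Uniqueness: a `Δ`-good filtration allows only `S(1)` in the socle, and a `∇`-good filtration forces
generation by `e_1 M`. For the vertices other than `1` this yields `u ∈ e_1 M` with the annihilator
of `t(i)`, and a functional that is nonzero on the socle of `A u` splits `A u` off;
indecomposability gives `M = A u`. The tilting module at `1` is simple.

Ringel dual: in `T(1) ⊂ T(j) ⊂ T(n)` the inclusions together with the maps `e_1 ↦ t(j)` and `t(j) ↦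
ll` satisfy the relations of `A_n(C⁻¹)`. They generate all maps between the summands
(`summandMap_mem_range`), and the resulting algebra map does not kill the longest path of
`A_n(C⁻¹)`, so it is bijective. Reversal of paths gives the statement on the opposite algebra. -/

theorem Vtx.sum_eq {m : ℕ} {M : Type*} [AddCommMonoid M] (f : Vtx m → M) :
    ∑ v, f v = f .bot + (∑ j, f (.mid j)) + f .top := by
  let eqv : Vtx m ≃ (Unit ⊕ Fin m) ⊕ Unit :=
    { toFun := fun v => match v with
        | .bot => .inl (.inl ())
        | .mid j => .inl (.inr j)
        | .top => .inr ()
      invFun := fun v => match v with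
        | .inl (.inl _) => .bot
        | .inl (.inr j) => .mid j
        | .inr _ => .top
      left_inv := by rintro (_ | _ | _) <;> rfl
      right_inv := by rintro ((_ | _) | _) <;> rfl }
  rw [← eqv.symm.sum_comp f]
  simp [eqv]

/-! ### Generators, relations and the universal property of `A_n(C)`. -/

namespace QHAlg

variable {K : Type u} [Field K] {m : ℕ}

section Basic

variable (C : Matrix (Fin m) (Fin m) K)

/-- An arrow, as an element of `A_n(C)`. -/
noncomputable def arr {s t : Vtx m} (f : Vtx.Arrow s t) : QHAlg C :=
  proj C (PathAlgebra.arrow K (V := Vtx m) (s := s) (t := t) f)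

/-- The arrow `1 → j`. -/
noncomputable def bm (j : Fin m) : QHAlg C := arr C (.botMid j)
/-- The arrow `j → 1`. -/
noncomputable def mb (j : Fin m) : QHAlg C := arr C (.midBot j)
/-- The arrow `j → n`. -/
noncomputable def mt (j : Fin m) : QHAlg C := arr C (.midTop j)
/-- The arrow `n → j`. -/
noncomputable def tm (j : Fin m) : QHAlg C := arr C (.topMid j)

/-- The projection of the free algebra onto `A_n(C)`. -/
noncomputable def mk : FreeAlgebra K (PathGen (Vtx m)) →ₐ[K] QHAlg C :=
  (proj C).comp (RingQuot.mkAlgHom K (PathRel K (Vtx m)) : _ →ₐ[K] QHPath K m)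

theorem mk_vertex (v : Vtx m) : mk C (FreeAlgebra.ι K (.inl v)) = e C v := rfl

theorem mk_arrow {s t : Vtx m} (f : Vtx.Arrow s t) :
    mk C (FreeAlgebra.ι K (.inr ⟨s, t, f⟩)) = arr C f := rfl

theorem mk_surjective : Function.Surjective (mk C) := by
  intro x
  obtain ⟨x, rfl⟩ := RingQuot.mkAlgHom_surjective K (QHRel C) x
  obtain ⟨x, rfl⟩ := RingQuot.mkAlgHom_surjective K (PathRel K (Vtx m)) x
  exact ⟨x, rfl⟩

theorem mk_rel {x y : FreeAlgebra K (PathGen (Vtx m))} (h : PathRel K (Vtx m) x y) :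
    mk C x = mk C y :=
  congrArg (proj C) (RingQuot.mkAlgHom_rel K h)

theorem qhRel {x y : QHPath K m} (h : QHRel C x y) : proj C x = proj C y :=
  RingQuot.mkAlgHom_rel K h

theorem e_mul_self (v : Vtx m) : e C v * e C v = e C v := by
  simpa only [map_mul, mk_vertex, mk_arrow] using mk_rel C (.idem v)

theorem e_mul_ne {v v' : Vtx m} (h : v ≠ v') : e C v * e C v' = 0 := by
  simpa only [map_mul, map_zero, mk_vertex, mk_arrow] using mk_rel C (.orth v v' h)

theorem sum_e : ∑ v, e C v = 1 := by
  simpa only [map_sum, map_one, mk_vertex] using mk_rel C .sum_one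

theorem e_mul_arr {s t : Vtx m} (f : Vtx.Arrow s t) : e C t * arr C f = arr C f := by
  simpa only [map_mul, mk_vertex, mk_arrow] using mk_rel C (.target s t f)

theorem arr_mul_e {s t : Vtx m} (f : Vtx.Arrow s t) : arr C f * e C s = arr C f := by
  simpa only [map_mul, mk_vertex, mk_arrow] using mk_rel C (.source s t f)

theorem e_mul_arr_ne {s t v : Vtx m} (f : Vtx.Arrow s t) (h : v ≠ t) : e C v * arr C f = 0 := by
  rw [← e_mul_arr, ← mul_assoc, e_mul_ne C h, zero_mul]

theorem arr_mul_e_ne {s t v : Vtx m} (f : Vtx.Arrow s t) (h : s ≠ v) : arr C f * e C v = 0 := by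
  rw [← arr_mul_e, mul_assoc, e_mul_ne C h, mul_zero]

theorem arr_mul_arr_ne {s t s' t' : Vtx m} (f : Vtx.Arrow s t) (g : Vtx.Arrow s' t')
    (h : s ≠ t') : arr C f * arr C g = 0 := by
  rw [← arr_mul_e, mul_assoc, e_mul_arr_ne C g h, mul_zero]

/-- The algebra is a quotient of the free algebra on vertices and arrows, so the induction principle
of the free algebra descends. -/
theorem induction_on {p : QHAlg C → Prop} (x : QHAlg C)
    (algebraMap : ∀ r, p (algebraMap K _ r)) (vertex : ∀ v, p (e C v))
    (arrow : ∀ {s t : Vtx m} (f : Vtx.Arrow s t), p (arr C f))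
    (add : ∀ x y, p x → p y → p (x + y)) (mul : ∀ x y, p x → p y → p (x * y)) : p x := by
  obtain ⟨x, rfl⟩ := mk_surjective C x
  refine FreeAlgebra.induction (motive := fun x => p (mk C x))
    K _ (fun r => ?_) (fun g => ?_) (fun x y hx hy => ?_) (fun x y hx hy => ?_) x
  · simpa only [AlgHom.commutes] using algebraMap r
  · rcases g with v | ⟨s, t, f⟩
    · exact vertex v
    · exact arrow f
  · simpa only [map_mul] using mul _ _ hx hy
  · simpa only [map_add] using add _ _ hx hy

end Basic

/-- Elements of an algebra that satisfy the defining relations of `A_n(C)`. -/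
structure Realization (C : Matrix (Fin m) (Fin m) K) (B : Type w) [Ring B] [Algebra K B] where
  vertex : Vtx m → B
  arrow : ∀ {s t : Vtx m}, Vtx.Arrow s t → B
  idem : ∀ v, vertex v * vertex v = vertex v
  orth : ∀ v v', v ≠ v' → vertex v * vertex v' = 0
  sum_one : ∑ v, vertex v = 1
  target : ∀ {s t} (f : Vtx.Arrow s t), vertex t * arrow f = arrow f
  source : ∀ {s t} (f : Vtx.Arrow s t), arrow f * vertex s = arrow f
  botTop : ∀ i j, arrow (.midTop i) * arrow (.botMid i) = arrow (.midTop j) * arrow (.botMid j)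
  topBot : ∀ i j, arrow (.midBot i) * arrow (.topMid i) = arrow (.midBot j) * arrow (.topMid j)
  mid : ∀ i j, arrow (.botMid j) * arrow (.midBot i) =
    C i j • (arrow (.topMid j) * arrow (.midTop i))
  topTop : ∀ j, arrow (.midTop j) * arrow (.topMid j) = 0

namespace Realization

variable {C : Matrix (Fin m) (Fin m) K} {B : Type w} [Ring B] [Algebra K B]
  (R : Realization C B)

/-- The algebra map from the free algebra that a realization of the relations gives. -/
noncomputable def freeLift : FreeAlgebra K (PathGen (Vtx m)) →ₐ[K] B :=
  FreeAlgebra.lift K fun g => match g with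
    | .inl v => R.vertex v
    | .inr ⟨_, _, f⟩ => R.arrow f

@[simp] theorem freeLift_vertex (v : Vtx m) :
    R.freeLift (FreeAlgebra.ι K (.inl v)) = R.vertex v := by
  simp [freeLift]

@[simp] theorem freeLift_arrow {s t : Vtx m} (f : s ⟶ t) :
    R.freeLift (FreeAlgebra.ι K (.inr ⟨s, t, f⟩)) = R.arrow f := by
  simp [freeLift]

/-- The algebra map from the path algebra that a realization of the relations gives. -/
noncomputable def pathLift : QHPath K m →ₐ[K] B :=
  RingQuot.liftAlgHom K ⟨R.freeLift, by
      intro x y h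
      cases h with
      | idem v => simp [R.idem]
      | orth v v' h => simp [R.orth v v' h]
      | sum_one => simp [R.sum_one]
      | target s t f => simp [R.target]
      | source s t f => simp [R.source]⟩

@[simp] theorem pathLift_vertex (v : Vtx m) : R.pathLift (PathAlgebra.vertex K v) = R.vertex v :=
  (RingQuot.liftAlgHom_mkAlgHom_apply K _ _ _).trans (R.freeLift_vertex v)

@[simp] theorem pathLift_arrow {s t : Vtx m} (f : s ⟶ t) :
    R.pathLift (PathAlgebra.arrow K f) = R.arrow f :=
  (RingQuot.liftAlgHom_mkAlgHom_apply K _ _ _).trans (R.freeLift_arrow f)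

/-- The algebra map from `A_n(C)` that a realization of the relations gives. -/
noncomputable def lift : QHAlg C →ₐ[K] B :=
  RingQuot.liftAlgHom K ⟨R.pathLift, by
      intro x y h
      cases h with
      | botTop i j => simpa using R.botTop i j
      | topBot i j => simpa using R.topBot i j
      | mid i j => simpa using R.mid i j
      | topTop j => simpa using R.topTop j⟩

@[simp] theorem lift_e (v : Vtx m) : R.lift (e C v) = R.vertex v :=
  (RingQuot.liftAlgHom_mkAlgHom_apply K _ _ _).trans (R.pathLift_vertex v)

@[simp] theorem lift_arr {s t : Vtx m} (f : Vtx.Arrow s t) : R.lift (arr C f) = R.arrow f :=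
  (RingQuot.liftAlgHom_mkAlgHom_apply K _ _ _).trans (R.pathLift_arrow f)

end Realization

/-! ### The multiplication table. -/

section Table

variable (C : Matrix (Fin m) (Fin m) K)

theorem mt_mul_bm_congr (i j : Fin m) : mt C i * bm C i = mt C j * bm C j := by
  simpa only [map_mul] using! qhRel C (.botTop i j)

theorem mb_mul_tm_congr (i j : Fin m) : mb C i * tm C i = mb C j * tm C j := by
  simpa only [map_mul] using! qhRel C (.topBot i j)

theorem bm_mul_mb (i j : Fin m) : bm C j * mb C i = C i j • (tm C j * mt C i) := by
  simpa only [map_mul, map_smul] using! qhRel C (.mid i j)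

theorem mt_mul_tm_self (j : Fin m) : mt C j * tm C j = 0 := by
  simpa only [map_mul, map_zero] using! qhRel C (.topTop j)

@[simp] theorem mt_mul_tm (i j : Fin m) : mt C i * tm C j = 0 := by
  by_cases h : i = j
  · rw [h, mt_mul_tm_self]
  · exact arr_mul_arr_ne C _ _ (by simpa using h)

theorem loop_eq (j : Fin m) : loop C j = mb C j * bm C j := map_mul _ _ _

variable [NeZero m]

/-- The path `(1 j n)`. -/
noncomputable def bt : QHAlg C := mt C 0 * bm C 0
/-- The path `(n j 1)`. -/
noncomputable def tb : QHAlg C := mb C 0 * tm C 0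
/-- The path `(1 j n j 1)`. -/
noncomputable def ll : QHAlg C := tb C * bt C

theorem mt_mul_bm (i j : Fin m) : mt C i * bm C j = if i = j then bt C else 0 := by
  split_ifs with h
  · rw [h, bt, mt_mul_bm_congr]
  · exact arr_mul_arr_ne C _ _ (by simpa using h)

theorem mb_mul_tm (i j : Fin m) : mb C i * tm C j = if i = j then tb C else 0 := by
  split_ifs with h
  · rw [h, tb, mb_mul_tm_congr]
  · exact arr_mul_arr_ne C _ _ (by simpa using h)

/-- Both halves `(1 j n)` and `(n j 1)` are independent of `j`, so the vertex `2` in the definition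
of `t(1)` is no real choice. -/
theorem longLoop_eq (j : Fin m) : longLoop C j = ll C := by
  have : longLoop C j = mb C j * tm C j * (mt C j * bm C j) := by
    simp only [longLoop, map_mul, mul_assoc]; rfl
  rw [this, mt_mul_bm, mb_mul_tm, if_pos rfl, if_pos rfl, ll]

end Table

end QHAlg

namespace QHAlg

variable {K : Type u} [Field K] {m : ℕ}

section Table

variable (C : Matrix (Fin m) (Fin m) K)

@[simp] theorem e_mul_e (v v' : Vtx m) : e C v * e C v' = if v = v' then e C v else 0 := by
  split_ifs with h
  · rw [← h, e_mul_self]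
  · exact e_mul_ne C h

@[simp] theorem e_mul_bm (v : Vtx m) (j : Fin m) :
    e C v * bm C j = if v = .mid j then bm C j else 0 := by
  split_ifs with h
  · rw [h]; exact e_mul_arr C _
  · exact e_mul_arr_ne C _ h

@[simp] theorem bm_mul_e (v : Vtx m) (j : Fin m) :
    bm C j * e C v = if v = .bot then bm C j else 0 := by
  split_ifs with h
  · rw [h]; exact arr_mul_e C _
  · exact arr_mul_e_ne C _ (Ne.symm h)

@[simp] theorem e_mul_mb (v : Vtx m) (j : Fin m) :
    e C v * mb C j = if v = .bot then mb C j else 0 := by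
  split_ifs with h
  · rw [h]; exact e_mul_arr C _
  · exact e_mul_arr_ne C _ h

@[simp] theorem mb_mul_e (v : Vtx m) (j : Fin m) :
    mb C j * e C v = if v = .mid j then mb C j else 0 := by
  split_ifs with h
  · rw [h]; exact arr_mul_e C _
  · exact arr_mul_e_ne C _ (Ne.symm h)

@[simp] theorem e_mul_mt (v : Vtx m) (j : Fin m) :
    e C v * mt C j = if v = .top then mt C j else 0 := by
  split_ifs with h
  · rw [h]; exact e_mul_arr C _
  · exact e_mul_arr_ne C _ h

@[simp] theorem mt_mul_e (v : Vtx m) (j : Fin m) :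
    mt C j * e C v = if v = .mid j then mt C j else 0 := by
  split_ifs with h
  · rw [h]; exact arr_mul_e C _
  · exact arr_mul_e_ne C _ (Ne.symm h)

@[simp] theorem e_mul_tm (v : Vtx m) (j : Fin m) :
    e C v * tm C j = if v = .mid j then tm C j else 0 := by
  split_ifs with h
  · rw [h]; exact e_mul_arr C _
  · exact e_mul_arr_ne C _ h

@[simp] theorem tm_mul_e (v : Vtx m) (j : Fin m) :
    tm C j * e C v = if v = .top then tm C j else 0 := by
  split_ifs with h
  · rw [h]; exact arr_mul_e C _
  · exact arr_mul_e_ne C _ (Ne.symm h)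

@[simp] theorem bm_mul_bm (i j : Fin m) :
    bm C i * bm C j = 0 := arr_mul_arr_ne C _ _ (by simp)

@[simp] theorem bm_mul_mt (i j : Fin m) :
    bm C i * mt C j = 0 := arr_mul_arr_ne C _ _ (by simp)

@[simp] theorem bm_mul_tm (i j : Fin m) :
    bm C i * tm C j = 0 := arr_mul_arr_ne C _ _ (by simp)

@[simp] theorem mb_mul_mb (i j : Fin m) :
    mb C i * mb C j = 0 := arr_mul_arr_ne C _ _ (by simp)

@[simp] theorem mb_mul_mt (i j : Fin m) :
    mb C i * mt C j = 0 := arr_mul_arr_ne C _ _ (by simp)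

@[simp] theorem mt_mul_mb (i j : Fin m) :
    mt C i * mb C j = 0 := arr_mul_arr_ne C _ _ (by simp)

@[simp] theorem mt_mul_mt (i j : Fin m) :
    mt C i * mt C j = 0 := arr_mul_arr_ne C _ _ (by simp)

@[simp] theorem tm_mul_bm (i j : Fin m) :
    tm C i * bm C j = 0 := arr_mul_arr_ne C _ _ (by simp)

@[simp] theorem tm_mul_mb (i j : Fin m) :
    tm C i * mb C j = 0 := arr_mul_arr_ne C _ _ (by simp)

@[simp] theorem tm_mul_tm (i j : Fin m) :
    tm C i * tm C j = 0 := arr_mul_arr_ne C _ _ (by simp)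

@[simp] theorem mb_mul_bm (i j : Fin m) :
    mb C i * bm C j = if i = j then loop C j else 0 := by
  split_ifs with h
  · rw [h, loop_eq]
  · exact arr_mul_arr_ne C _ _ (by simpa using h)

/-- The path `(i n j)`. -/
noncomputable def mm (j i : Fin m) : QHAlg C := tm C j * mt C i

@[simp] theorem tm_mul_mt (j i : Fin m) : tm C j * mt C i = mm C j i := rfl

@[simp] theorem bm_mul_mb' (i j : Fin m) : bm C j * mb C i = C i j • mm C j i := bm_mul_mb C i j

variable [NeZero m]

attribute [simp] mt_mul_bm mb_mul_tm

/-- The path `(1 i n j)`. -/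
noncomputable def wm (j : Fin m) : QHAlg C := tm C j * bt C
/-- The path `(i n j 1)`. -/
noncomputable def tbm (i : Fin m) : QHAlg C := tb C * mt C i

@[simp] theorem tm_mul_bt (j : Fin m) : tm C j * bt C = wm C j := rfl
@[simp] theorem tb_mul_mt (j : Fin m) : tb C * mt C j = tbm C j := rfl
@[simp] theorem tb_mul_bt : tb C * bt C = ll C := rfl

theorem bt_eq (j : Fin m) : bt C = mt C j * bm C j := by simp
theorem tb_eq (j : Fin m) : tb C = mb C j * tm C j := by simp

@[simp] theorem e_mul_bt (v : Vtx m) : e C v * bt C = if v = .top then bt C else 0 := by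
  rw [bt, ← mul_assoc, e_mul_mt]; split_ifs <;> simp
@[simp] theorem bt_mul_e (v : Vtx m) : bt C * e C v = if v = .bot then bt C else 0 := by
  rw [bt, mul_assoc, bm_mul_e]; split_ifs <;> simp
@[simp] theorem e_mul_tb (v : Vtx m) : e C v * tb C = if v = .bot then tb C else 0 := by
  rw [tb, ← mul_assoc, e_mul_mb]; split_ifs <;> simp
@[simp] theorem tb_mul_e (v : Vtx m) : tb C * e C v = if v = .top then tb C else 0 := by
  rw [tb, mul_assoc, tm_mul_e]; split_ifs <;> simp

@[simp] theorem bm_mul_bt (j : Fin m) : bm C j * bt C = 0 := by simp [bt, ← mul_assoc, -mt_mul_bm]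
@[simp] theorem mb_mul_bt (j : Fin m) : mb C j * bt C = 0 := by simp [bt, ← mul_assoc, -mt_mul_bm]
@[simp] theorem mt_mul_bt (j : Fin m) : mt C j * bt C = 0 := by simp [bt, ← mul_assoc, -mt_mul_bm]
@[simp] theorem mb_mul_tb (j : Fin m) : mb C j * tb C = 0 := by simp [tb, ← mul_assoc, -mb_mul_tm]
@[simp] theorem mt_mul_tb (j : Fin m) : mt C j * tb C = 0 := by simp [tb, ← mul_assoc, -mb_mul_tm]
@[simp] theorem tm_mul_tb (j : Fin m) : tm C j * tb C = 0 := by simp [tb, ← mul_assoc, -mb_mul_tm]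
-- The middle vertex of `(n k 1)` may be taken to be `j`; then `(j 1 j) = c_{jj} (j n j)` exhibits
-- the factor `(n j n) = 0`.
@[simp] theorem bm_mul_tb (j : Fin m) : bm C j * tb C = 0 := by
  rw [tb_eq C j, ← mul_assoc, bm_mul_mb, smul_mul_assoc, mul_assoc, mt_mul_tm, mul_zero, smul_zero]

@[simp] theorem bt_mul_bm (j : Fin m) : bt C * bm C j = 0 := by simp [bt, mul_assoc, -mt_mul_bm]
@[simp] theorem bt_mul_mt (j : Fin m) : bt C * mt C j = 0 := by simp [bt, mul_assoc, -mt_mul_bm]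
@[simp] theorem bt_mul_tm (j : Fin m) : bt C * tm C j = 0 := by simp [bt, mul_assoc, -mt_mul_bm]
@[simp] theorem bt_mul_mb (j : Fin m) : bt C * mb C j = 0 := by
  rw [bt_eq C j, mul_assoc, bm_mul_mb, mul_smul_comm, ← mul_assoc, mt_mul_tm, zero_mul, smul_zero]
@[simp] theorem bt_mul_bt : bt C * bt C = 0 := by
  rw [bt_eq C 0, ← mul_assoc, ← bt_eq C 0, bt_mul_mt, zero_mul]
@[simp] theorem bt_mul_tb : bt C * tb C = 0 := by
  rw [tb_eq C 0, ← mul_assoc, bt_mul_mb, zero_mul]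
@[simp] theorem tb_mul_tb : tb C * tb C = 0 := by
  calc tb C * tb C = mb C 0 * (tm C 0 * tb C) := by rw [← mul_assoc, ← tb_eq]
    _ = 0 := by rw [tm_mul_tb, mul_zero]
@[simp] theorem tb_mul_bm (j : Fin m) : tb C * bm C j = 0 := by simp [tb, mul_assoc, -mb_mul_tm]
@[simp] theorem tb_mul_mb (j : Fin m) : tb C * mb C j = 0 := by simp [tb, mul_assoc, -mb_mul_tm]
@[simp] theorem tb_mul_tm (j : Fin m) : tb C * tm C j = 0 := by simp [tb, mul_assoc, -mb_mul_tm]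

omit [NeZero m] in
@[simp] theorem e_mul_loop (v : Vtx m) (i : Fin m) :
    e C v * loop C i = if v = .bot then loop C i else 0 := by
  rw [loop_eq, ← mul_assoc, e_mul_mb]; split_ifs <;> simp
omit [NeZero m] in
@[simp] theorem loop_mul_e (v : Vtx m) (i : Fin m) :
    loop C i * e C v = if v = .bot then loop C i else 0 := by
  rw [loop_eq, mul_assoc, bm_mul_e]; split_ifs <;> simp
-- The relation `(i 1 j) = c_{ij} (i n j)` applied after `1 → i`. This is the only way in which `C`
-- enters the structure of `A e_1`.
@[simp] theorem bm_mul_loop (i j : Fin m) : bm C j * loop C i = C i j • wm C j := by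
  rw [loop_eq, ← mul_assoc, bm_mul_mb, smul_mul_assoc, mul_assoc, ← bt_eq, wm]
omit [NeZero m] in
@[simp] theorem mb_mul_loop (i j : Fin m) : mb C j * loop C i = 0 := by
  simp [loop_eq, ← mul_assoc, -mb_mul_bm]
omit [NeZero m] in
@[simp] theorem mt_mul_loop (i j : Fin m) : mt C j * loop C i = 0 := by
  simp [loop_eq, ← mul_assoc, -mb_mul_bm]
omit [NeZero m] in
@[simp] theorem tm_mul_loop (i j : Fin m) : tm C j * loop C i = 0 := by
  simp [loop_eq, ← mul_assoc, -mb_mul_bm]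
@[simp] theorem bt_mul_loop (i : Fin m) : bt C * loop C i = 0 := by
  simp [loop_eq, ← mul_assoc, -mb_mul_bm]

@[simp] theorem e_mul_wm (v : Vtx m) (i : Fin m) :
    e C v * wm C i = if v = .mid i then wm C i else 0 := by
  rw [wm, ← mul_assoc, e_mul_tm]; split_ifs <;> simp
@[simp] theorem wm_mul_e (v : Vtx m) (i : Fin m) :
    wm C i * e C v = if v = .bot then wm C i else 0 := by
  rw [wm, mul_assoc, bt_mul_e]; split_ifs <;> simp
@[simp] theorem bm_mul_wm (i j : Fin m) : bm C j * wm C i = 0 := by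
  simp [wm, ← mul_assoc, -tm_mul_bt]
@[simp] theorem mb_mul_wm (i j : Fin m) : mb C j * wm C i = if j = i then ll C else 0 := by
  rw [wm, ← mul_assoc, mb_mul_tm]; split_ifs <;> simp
@[simp] theorem mt_mul_wm (i j : Fin m) : mt C j * wm C i = 0 := by
  simp [wm, ← mul_assoc, -tm_mul_bt]
@[simp] theorem tm_mul_wm (i j : Fin m) : tm C j * wm C i = 0 := by
  simp [wm, ← mul_assoc, -tm_mul_bt]
@[simp] theorem bt_mul_wm (i : Fin m) : bt C * wm C i = 0 := by
  simp [wm, ← mul_assoc, -tm_mul_bt]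

@[simp] theorem e_mul_ll (v : Vtx m) : e C v * ll C = if v = .bot then ll C else 0 := by
  rw [ll, ← mul_assoc, e_mul_tb]; split_ifs <;> simp
@[simp] theorem ll_mul_e (v : Vtx m) : ll C * e C v = if v = .bot then ll C else 0 := by
  rw [ll, mul_assoc, bt_mul_e]; split_ifs <;> simp
@[simp] theorem bm_mul_ll (j : Fin m) : bm C j * ll C = 0 := by simp [ll, ← mul_assoc, -tb_mul_bt]
@[simp] theorem mb_mul_ll (j : Fin m) : mb C j * ll C = 0 := by simp [ll, ← mul_assoc, -tb_mul_bt]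
@[simp] theorem mt_mul_ll (j : Fin m) : mt C j * ll C = 0 := by simp [ll, ← mul_assoc, -tb_mul_bt]
@[simp] theorem tm_mul_ll (j : Fin m) : tm C j * ll C = 0 := by simp [ll, ← mul_assoc, -tb_mul_bt]
@[simp] theorem bt_mul_ll : bt C * ll C = 0 := by simp [ll, ← mul_assoc, -tb_mul_bt]
@[simp] theorem ll_mul_bm (j : Fin m) : ll C * bm C j = 0 := by simp [ll, mul_assoc, -tb_mul_bt]
@[simp] theorem ll_mul_mb (j : Fin m) : ll C * mb C j = 0 := by simp [ll, mul_assoc, -tb_mul_bt]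
@[simp] theorem ll_mul_loop (j : Fin m) : ll C * loop C j = 0 := by
  simp [loop_eq, ← mul_assoc, -mb_mul_bm]
@[simp] theorem ll_mul_ll : ll C * ll C = 0 := by
  calc ll C * ll C = tb C * (bt C * ll C) := by rw [← mul_assoc, tb_mul_bt]
    _ = 0 := by rw [bt_mul_ll, mul_zero]

omit [NeZero m] in
@[simp] theorem e_mul_mm (v : Vtx m) (j i : Fin m) :
    e C v * mm C j i = if v = .mid j then mm C j i else 0 := by
  rw [mm, ← mul_assoc, e_mul_tm]; split_ifs <;> simp
omit [NeZero m] in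
@[simp] theorem bm_mul_mm (k j i : Fin m) : bm C k * mm C j i = 0 := by
  simp [mm, ← mul_assoc, -tm_mul_mt]
@[simp] theorem mb_mul_mm (k j i : Fin m) : mb C k * mm C j i = if k = j then tbm C i else 0 := by
  rw [mm, ← mul_assoc, mb_mul_tm]; split_ifs <;> simp
omit [NeZero m] in
@[simp] theorem mt_mul_mm (k j i : Fin m) : mt C k * mm C j i = 0 := by
  simp [mm, ← mul_assoc, -tm_mul_mt]
omit [NeZero m] in
@[simp] theorem tm_mul_mm (k j i : Fin m) : tm C k * mm C j i = 0 := by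
  simp [mm, ← mul_assoc, -tm_mul_mt]
@[simp] theorem mm_mul_bm (j i k : Fin m) : mm C j i * bm C k = if i = k then wm C j else 0 := by
  rw [mm, mul_assoc, mt_mul_bm]; split_ifs <;> simp

@[simp] theorem e_mul_tbm (v : Vtx m) (i : Fin m) :
    e C v * tbm C i = if v = .bot then tbm C i else 0 := by
  rw [tbm, ← mul_assoc, e_mul_tb]; split_ifs <;> simp
@[simp] theorem bm_mul_tbm (k i : Fin m) : bm C k * tbm C i = 0 := by
  simp [tbm, ← mul_assoc, -tb_mul_mt]
@[simp] theorem mb_mul_tbm (k i : Fin m) : mb C k * tbm C i = 0 := by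
  simp [tbm, ← mul_assoc, -tb_mul_mt]
@[simp] theorem mt_mul_tbm (k i : Fin m) : mt C k * tbm C i = 0 := by
  simp [tbm, ← mul_assoc, -tb_mul_mt]
@[simp] theorem tm_mul_tbm (k i : Fin m) : tm C k * tbm C i = 0 := by
  simp [tbm, ← mul_assoc, -tb_mul_mt]
@[simp] theorem tbm_mul_bm (i k : Fin m) : tbm C i * bm C k = if i = k then ll C else 0 := by
  rw [tbm, mul_assoc, mt_mul_bm]; split_ifs <;> simp

-- The loops at `1` multiply through the bilinear form given by `C`, with values in the line of
-- `ll`. A change of basis by `C⁻¹` turns this form into the one given by `C⁻¹`.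
@[simp] theorem loop_mul_loop (j k : Fin m) : loop C j * loop C k = C k j • ll C := by
  rw [loop_eq C j, mul_assoc, bm_mul_loop, mul_smul_comm, mb_mul_wm, if_pos rfl]
@[simp] theorem loop_mul_ll (j : Fin m) : loop C j * ll C = 0 := by
  rw [loop_eq C j, mul_assoc, bm_mul_ll, mul_zero]

end Table

/-! ### A model of `A e_1` on coordinate vectors. -/

section Rep

/-- The coordinate space of `A e_1`, for the basis `e_1`, `(1 j)`, `(1 j 1)`, `(1 j n)`,
`(1 i n j)`, `(1 j n j 1)`. -/
abbrev Coord (K : Type u) (m : ℕ) : Type u :=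
  K × (Fin m → K) × (Fin m → K) × K × (Fin m → K) × K

variable (C : Matrix (Fin m) (Fin m) K)

/-- The action of the vertices on `A e_1`. -/
def repVertex : Vtx m → Module.End K (Coord K m)
  | .bot =>
    { toFun := fun p => (p.1, 0, p.2.2.1, 0, 0, p.2.2.2.2.2)
      map_add' := fun p q => by simp
      map_smul' := fun r p => by simp }
  | .mid j =>
    { toFun := fun p => (0, Pi.single j (p.2.1 j), 0, 0, Pi.single j (p.2.2.2.2.1 j), 0)
      map_add' := fun p q => by simp [Pi.single_add]
      map_smul' := fun r p => by simp [← Pi.single_smul] }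
  | .top =>
    { toFun := fun p => (0, 0, 0, p.2.2.2.1, 0, 0)
      map_add' := fun p q => by simp
      map_smul' := fun r p => by simp }

/-- The action of the arrows on `A e_1`. -/
def repArrow : ∀ {s t : Vtx m}, Vtx.Arrow s t → Module.End K (Coord K m)
  | _, _, .botMid j =>
    -- The second single entry encodes `(1 k 1 j) = c_{kj} (1 i n j)`: the loop coordinates pass
    -- through `C`.
    { toFun := fun p => (0, Pi.single j p.1, 0, 0, Pi.single j (∑ k, p.2.2.1 k * C k j), 0)
      map_add' := fun p q => by simp [Pi.single_add, add_mul, Finset.sum_add_distrib]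
      map_smul' := fun r p => by simp [← Pi.single_smul, Finset.mul_sum, mul_assoc] }
  | _, _, .midBot j =>
    { toFun := fun p => (0, 0, Pi.single j (p.2.1 j), 0, 0, p.2.2.2.2.1 j)
      map_add' := fun p q => by simp [Pi.single_add]
      map_smul' := fun r p => by simp [← Pi.single_smul] }
  | _, _, .midTop j =>
    { toFun := fun p => (0, 0, 0, p.2.1 j, 0, 0)
      map_add' := fun p q => by simp
      map_smul' := fun r p => by simp }
  | _, _, .topMid j =>
    { toFun := fun p => (0, 0, 0, 0, Pi.single j p.2.2.2.1, 0)
      map_add' := fun p q => by simp [Pi.single_add]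
      map_smul' := fun r p => by simp [← Pi.single_smul] }

/-- `A e_1` in coordinates is a representation of `A_n(C)`. -/
def repRealization : Realization C (Module.End K (Coord K m)) where
  vertex := repVertex
  arrow := repArrow C
  idem v := by cases v <;> ext <;> simp [repVertex]
  orth v v' h := by
    cases v <;> cases v' <;> first
      | exact absurd rfl h
      | (refine LinearMap.ext fun p => ?_
         simp_all [repVertex, Pi.single_eq_of_ne])
  sum_one := by
    rw [Vtx.sum_eq]
    refine LinearMap.ext fun p => ?_
    obtain ⟨x, u, v, y, w, z⟩ := p
    simp [repVertex, LinearMap.sum_apply, Prod.ext_iff, Prod.fst_sum, Prod.snd_sum,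
      Finset.univ_sum_single]
  target f := by cases f <;> refine LinearMap.ext fun p => ?_ <;> simp [repVertex, repArrow]
  source f := by cases f <;> refine LinearMap.ext fun p => ?_ <;> simp [repVertex, repArrow]
  botTop i j := by refine LinearMap.ext fun p => ?_; simp [repArrow]
  topBot i j := by refine LinearMap.ext fun p => ?_; simp [repArrow]
  mid i j := by
    refine LinearMap.ext fun p => ?_
    simp [repArrow, Pi.single_apply, ← Pi.single_smul, mul_comm]
  topTop j := by refine LinearMap.ext fun p => ?_; simp [repArrow]

end Rep
end QHAlg

/-! ### The basis of `A e_1`, and spanning sets of the other ideals `A e_i`. -/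

namespace QHAlg

variable {K : Type u} [Field K] {m : ℕ} (C : Matrix (Fin m) (Fin m) K)

/-- The representation of `A_n(C)` on `A e_1` in coordinates. -/
noncomputable def rep : QHAlg C →ₐ[K] Module.End K (Coord K m) := (repRealization C).lift

/-- A `K`-subspace of a module that is stable under the vertices and arrows is stable under
the algebra. -/
theorem smul_mem_of_gen {M : Type w} [AddCommGroup M] [Module K M] [Module (QHAlg C) M]
    [IsScalarTower K (QHAlg C) M] (W : Submodule K M) (hv : ∀ v, ∀ x ∈ W, e C v • x ∈ W)
    (ha : ∀ {s t} (f : Vtx.Arrow s t), ∀ x ∈ W, arr C f • x ∈ W) (a : QHAlg C) :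
    ∀ x ∈ W, a • x ∈ W := by
  induction a using induction_on C with
  | algebraMap r => intro x hx; rw [algebraMap_smul]; exact W.smul_mem r hx
  | vertex v => exact hv v
  | arrow f => exact ha f
  | add a b iha ihb => intro x hx; rw [add_smul]; exact W.add_mem (iha x hx) (ihb x hx)
  | mul a b iha ihb => intro x hx; rw [mul_smul]; exact iha _ (ihb x hx)

theorem mul_mem_of_gen (W : Submodule K (QHAlg C)) (hv : ∀ v, ∀ x ∈ W, e C v * x ∈ W)
    (ha1 : ∀ j, ∀ x ∈ W, bm C j * x ∈ W) (ha2 : ∀ j, ∀ x ∈ W, mb C j * x ∈ W)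
    (ha3 : ∀ j, ∀ x ∈ W, mt C j * x ∈ W) (ha4 : ∀ j, ∀ x ∈ W, tm C j * x ∈ W) (a : QHAlg C) :
    ∀ x ∈ W, a * x ∈ W :=
  smul_mem_of_gen C W hv (fun f => by cases f; exacts [ha1 _, ha2 _, ha3 _, ha4 _]) a

section
variable [NeZero m]

/-- The element of `A e_1` with given coordinates. -/
noncomputable def ofCoord : Coord K m →ₗ[K] QHAlg C where
  toFun p := p.1 • e C .bot + ∑ j, p.2.1 j • bm C j + ∑ j, p.2.2.1 j • loop C j +
    p.2.2.2.1 • bt C + ∑ j, p.2.2.2.2.1 j • wm C j + p.2.2.2.2.2 • ll C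
  map_add' p q := by simp only [Prod.fst_add, Prod.snd_add, Pi.add_apply, add_smul,
      Finset.sum_add_distrib]; abel
  map_smul' r p := by simp only [Prod.smul_fst, Prod.smul_snd, Pi.smul_apply, smul_eq_mul,
      mul_smul, smul_add, Finset.smul_sum, RingHom.id_apply]

theorem ofCoord_apply (p : Coord K m) : ofCoord C p = p.1 • e C .bot + ∑ j, p.2.1 j • bm C j +
    ∑ j, p.2.2.1 j • loop C j + p.2.2.2.1 • bt C + ∑ j, p.2.2.2.2.1 j • wm C j +
    p.2.2.2.2.2 • ll C := rfl

/-- The coordinate action was read off from the multiplication table, so it suffices to compare both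
sides on vertices and arrows. The identity transfers computations in coordinates to `A e_1`. -/
theorem ofCoord_rep (a : QHAlg C) : ∀ p, ofCoord C (rep C a p) = a * ofCoord C p := by
  induction a using induction_on C with
  | algebraMap r => intro p; simp [Algebra.algebraMap_eq_smul_one]
  | vertex v =>
    intro p
    simp only [rep, Realization.lift_e]
    cases v <;> simp [repRealization, repVertex, ofCoord_apply, mul_add, Finset.mul_sum,
      Pi.single_apply]
  | arrow f =>
    intro p
    simp only [rep, Realization.lift_arr]
    cases f
    · rw [← bm]
      simp [repRealization, repArrow, ofCoord_apply, mul_add, Finset.mul_sum,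
        Pi.single_apply, Finset.sum_smul, mul_smul]
    · rw [← mb]
      simp [repRealization, repArrow, ofCoord_apply, mul_add, Finset.mul_sum,
        Pi.single_apply]
    · rw [← mt]
      simp [repRealization, repArrow, ofCoord_apply, mul_add, Finset.mul_sum]
    · rw [← tm]
      simp [repRealization, repArrow, ofCoord_apply, mul_add, Finset.mul_sum,
        Pi.single_apply]
  | add a b iha ihb => intro p; simp [add_mul, iha, ihb]
  | mul a b iha ihb => intro p; simp [mul_assoc, iha, ihb]

/-- The coordinates of `a e_1`. -/
noncomputable def coord : QHAlg C →ₗ[K] Coord K m :=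
  (LinearMap.applyₗ ((1, 0, 0, 0, 0, 0) : Coord K m)).comp (rep C).toLinearMap

omit [NeZero m] in
theorem coord_mul (a b : QHAlg C) : coord C (a * b) = rep C a (coord C b) := by
  simp [coord]

/-- The intertwining property `ofCoord_rep`, evaluated at the coordinate vector of `e_1`; this is
the spanning half of the basis statement. -/
theorem ofCoord_coord (a : QHAlg C) : ofCoord C (coord C a) = a * e C .bot := by
  have := ofCoord_rep C a (1, 0, 0, 0, 0, 0)
  simpa [ofCoord_apply, coord] using! this

omit [NeZero m] in
theorem rep_bm (j : Fin m) (p : Coord K m) : rep C (bm C j) p =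
    (0, Pi.single j p.1, 0, 0, Pi.single j (∑ k, p.2.2.1 k * C k j), 0) := by
  simp only [rep, bm, Realization.lift_arr]; rfl

omit [NeZero m] in
theorem rep_mb (j : Fin m) (p : Coord K m) : rep C (mb C j) p =
    (0, 0, Pi.single j (p.2.1 j), 0, 0, p.2.2.2.2.1 j) := by
  simp only [rep, mb, Realization.lift_arr]; rfl

omit [NeZero m] in
theorem rep_mt (j : Fin m) (p : Coord K m) : rep C (mt C j) p = (0, 0, 0, p.2.1 j, 0, 0) := by
  simp only [rep, mt, Realization.lift_arr]; rfl

omit [NeZero m] in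
theorem rep_tm (j : Fin m) (p : Coord K m) :
    rep C (tm C j) p = (0, 0, 0, 0, Pi.single j p.2.2.2.1, 0) := by
  simp only [rep, tm, Realization.lift_arr]; rfl

omit [NeZero m] in
theorem rep_e_bot (p : Coord K m) : rep C (e C .bot) p = (p.1, 0, p.2.2.1, 0, 0, p.2.2.2.2.2) := by
  simp only [rep, Realization.lift_e]; rfl

omit [NeZero m] in
theorem rep_e_mid (j : Fin m) (p : Coord K m) : rep C (e C (.mid j)) p =
    (0, Pi.single j (p.2.1 j), 0, 0, Pi.single j (p.2.2.2.2.1 j), 0) := by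
  simp only [rep, Realization.lift_e]; rfl

omit [NeZero m] in
theorem rep_e_top (p : Coord K m) : rep C (e C .top) p = (0, 0, 0, p.2.2.2.1, 0, 0) := by
  simp only [rep, Realization.lift_e]; rfl

omit [NeZero m] in
@[simp] theorem coord_e_bot : coord C (e C .bot) = (1, 0, 0, 0, 0, 0) := by
  simp [coord, rep_e_bot]

omit [NeZero m] in
@[simp] theorem coord_bm (j : Fin m) : coord C (bm C j) = (0, Pi.single j 1, 0, 0, 0, 0) := by
  simp [coord, rep_bm]

omit [NeZero m] in
@[simp] theorem coord_loop (j : Fin m) : coord C (loop C j) = (0, 0, Pi.single j 1, 0, 0, 0) := by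
  simp [loop_eq, -mb_mul_bm, coord_mul, rep_mb]

@[simp] theorem coord_bt : coord C (bt C) = (0, 0, 0, 1, 0, 0) := by
  simp [bt, -mt_mul_bm, coord_mul, rep_mt]

@[simp] theorem coord_wm (j : Fin m) : coord C (wm C j) = (0, 0, 0, 0, Pi.single j 1, 0) := by
  simp [wm, -tm_mul_bt, coord_mul, rep_tm]

@[simp] theorem coord_ll : coord C (ll C) = (0, 0, 0, 0, 0, 1) := by
  rw [ll, tb_eq C 0, mul_assoc, coord_mul, tm_mul_bt, coord_wm, rep_mb]; simp

/-- The independence half of the basis statement: each basis path has the expected unit vector as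
its coordinates. -/
theorem coord_ofCoord (p : Coord K m) : coord C (ofCoord C p) = p := by
  obtain ⟨x, u, v, y, w, z⟩ := p
  simp [ofCoord_apply, Prod.ext_iff, Prod.fst_sum, Prod.snd_sum, ← Pi.single_smul,
    Finset.univ_sum_single]

/-- The basic nonvanishing statement: other paths such as `wm` and `bt` are later seen to be nonzero
because they can be continued to `ll`. -/
theorem ll_ne_zero : ll C ≠ 0 := fun h => by
  have := coord_ll C
  simp [h, Prod.ext_iff] at this

/-- The elements of `A e_1` in coordinates. -/
theorem eq_ofCoord {a : QHAlg C} (ha : a * e C .bot = a) : a = ofCoord C (coord C a) := by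
  rw [ofCoord_coord, ha]

theorem exists_mul_e_bot (a : QHAlg C) : ∃ p : Coord K m, a * e C .bot = ofCoord C p :=
  ⟨_, (ofCoord_coord C a).symm⟩

/-- The listed elements span a `K`-subspace that contains `e_i` and is stable under vertices and
arrows, hence all of `A e_i`. Only spanning is asserted; uniqueness of the coefficients comes later,
from the passage to `A e_1` in `mul_bm_eq_zero`. -/
theorem exists_mul_e_mid (a : QHAlg C) (i : Fin m) : ∃ (r s t : K) (w : Fin m → K) (z : K),
    a * e C (.mid i) = r • e C (.mid i) + s • mb C i + t • mt C i + ∑ j, w j • mm C j i +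
      z • tbm C i := by
  let f : K × K × K × (Fin m → K) × K →ₗ[K] QHAlg C :=
    { toFun := fun p => p.1 • e C (.mid i) + p.2.1 • mb C i + p.2.2.1 • mt C i +
        ∑ j, p.2.2.2.1 j • mm C j i + p.2.2.2.2 • tbm C i
      map_add' := fun p q => by
        simp only [Prod.fst_add, Prod.snd_add, Pi.add_apply, add_smul, Finset.sum_add_distrib]; abel
      map_smul' := fun r p => by
        simp only [Prod.smul_fst, Prod.smul_snd, Pi.smul_apply, smul_eq_mul,
          mul_smul, smul_add, Finset.smul_sum, RingHom.id_apply] }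
  have key : ∀ x ∈ LinearMap.range f, a * x ∈ LinearMap.range f := by
    refine mul_mem_of_gen C (LinearMap.range f) ?_ ?_ ?_ ?_ ?_ a
    · rintro v _ ⟨⟨r, s, t, w, z⟩, rfl⟩
      rcases v with _ | j | _
      · exact ⟨(0, s, 0, 0, z), by simp [f, mul_add, Finset.mul_sum]⟩
      · exact ⟨(if j = i then r else 0, 0, 0, Pi.single j (w j), 0), by
          simp [f, mul_add, Finset.mul_sum, Pi.single_apply]
          by_cases h : j = i <;> simp [h]⟩
      · exact ⟨(0, 0, t, 0, 0), by simp [f, mul_add, Finset.mul_sum]⟩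
    · rintro j _ ⟨⟨r, s, t, w, z⟩, rfl⟩
      exact ⟨(0, 0, 0, Pi.single j (s * C i j), 0), by
        simp [f, mul_add, Finset.mul_sum, Pi.single_apply, mul_smul]⟩
    · rintro j _ ⟨⟨r, s, t, w, z⟩, rfl⟩
      exact ⟨(0, if i = j then r else 0, 0, 0, w j), by
        simp [f, mul_add, Finset.mul_sum]
        by_cases h : i = j <;> simp [h]⟩
    · rintro j _ ⟨⟨r, s, t, w, z⟩, rfl⟩
      exact ⟨(0, 0, if i = j then r else 0, 0, 0), by
        simp [f, mul_add, Finset.mul_sum]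
        by_cases h : i = j <;> simp [h]⟩
    · rintro j _ ⟨⟨r, s, t, w, z⟩, rfl⟩
      exact ⟨(0, 0, 0, Pi.single j t, 0), by
        simp [f, mul_add, Finset.mul_sum, Pi.single_apply]⟩
  obtain ⟨⟨r, s, t, w, z⟩, h⟩ := key (e C (.mid i)) ⟨(1, 0, 0, 0, 0), by simp [f]⟩
  exact ⟨r, s, t, w, z, h.symm⟩

theorem exists_mul_e_top (a : QHAlg C) : ∃ (r : K) (s : Fin m → K) (t : K),
    a * e C .top = r • e C .top + ∑ j, s j • tm C j + t • tb C := by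
  let f : K × (Fin m → K) × K →ₗ[K] QHAlg C :=
    { toFun := fun p => p.1 • e C .top + ∑ j, p.2.1 j • tm C j + p.2.2 • tb C
      map_add' := fun p q => by
        simp only [Prod.fst_add, Prod.snd_add, Pi.add_apply, add_smul, Finset.sum_add_distrib]; abel
      map_smul' := fun r p => by
        simp only [Prod.smul_fst, Prod.smul_snd, Pi.smul_apply, smul_eq_mul,
          mul_smul, smul_add, Finset.smul_sum, RingHom.id_apply] }
  have key : ∀ x ∈ LinearMap.range f, a * x ∈ LinearMap.range f := by
    refine mul_mem_of_gen C (LinearMap.range f) ?_ ?_ ?_ ?_ ?_ a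
    · rintro v _ ⟨⟨r, s, t⟩, rfl⟩
      rcases v with _ | j | _
      · exact ⟨(0, 0, t), by simp [f, mul_add, Finset.mul_sum]⟩
      · exact ⟨(0, Pi.single j (s j), 0), by
          simp [f, mul_add, Finset.mul_sum, Pi.single_apply]⟩
      · exact ⟨(r, 0, 0), by simp [f, mul_add, Finset.mul_sum]⟩
    · rintro j _ ⟨⟨r, s, t⟩, rfl⟩
      exact ⟨0, by simp [f, mul_add, Finset.mul_sum]⟩
    · rintro j _ ⟨⟨r, s, t⟩, rfl⟩
      exact ⟨(0, 0, s j), by simp [f, mul_add, Finset.mul_sum]⟩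
    · rintro j _ ⟨⟨r, s, t⟩, rfl⟩
      exact ⟨0, by simp [f, mul_add, Finset.mul_sum]⟩
    · rintro j _ ⟨⟨r, s, t⟩, rfl⟩
      exact ⟨(0, Pi.single j r, 0), by
        simp [f, mul_add, Finset.mul_sum, Pi.single_apply]⟩
  obtain ⟨⟨r, s, t⟩, h⟩ := key (e C .top) ⟨(1, 0, 0), by simp [f]⟩
  exact ⟨r, s, t, h.symm⟩

omit [NeZero m] in
theorem eq_sum_mul_e (a : QHAlg C) :
    a = a * e C .bot + (∑ j, a * e C (.mid j)) + a * e C .top := by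
  rw [← Finset.mul_sum, ← mul_add, ← mul_add, ← Vtx.sum_eq (e C), sum_e, mul_one]

end
end QHAlg

namespace QHAlg

variable {K : Type u} [Field K] {m : ℕ} (C : Matrix (Fin m) (Fin m) K)

/-! ### Reversal of paths and the opposite algebra. -/

section Opposite

/-- The arrows of `A_n(C)` reversed satisfy the relations of `A_n(Cᵀ)`. -/
noncomputable def revRealization (D : Matrix (Fin m) (Fin m) K) (h : ∀ i j, D j i = C i j) :
    Realization D (QHAlg C)ᵐᵒᵖ where
  vertex v := .op (e C v)
  arrow f := match f with
    | .botMid j => .op (mb C j)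
    | .midBot j => .op (bm C j)
    | .midTop j => .op (tm C j)
    | .topMid j => .op (mt C j)
  idem v := by rw [← MulOpposite.op_mul, e_mul_self]
  orth v v' h := by rw [← MulOpposite.op_mul, e_mul_ne C h.symm, MulOpposite.op_zero]
  sum_one := by
    rw [← MulOpposite.op_one, ← sum_e C]
    exact (map_sum (MulOpposite.opAddEquiv (α := QHAlg C)) (e C) Finset.univ).symm
  target f := by cases f <;> simp [← MulOpposite.op_mul]
  source f := by cases f <;> simp [← MulOpposite.op_mul]
  botTop i j := by simp only [← MulOpposite.op_mul, mb_mul_tm_congr C i j]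
  topBot i j := by simp only [← MulOpposite.op_mul, mt_mul_bm_congr C i j]
  mid i j := by simp [← MulOpposite.op_mul, ← MulOpposite.op_smul, h]
  topTop j := by simp [← MulOpposite.op_mul]

variable {C} {D : Matrix (Fin m) (Fin m) K} (h : ∀ i j, D j i = C i j)

/-- The reversal of paths, as an algebra map. -/
noncomputable def revHom : QHAlg D →ₐ[K] (QHAlg C)ᵐᵒᵖ := (revRealization C D h).lift

/-- The reversal of paths. -/
noncomputable def rev (x : QHAlg D) : QHAlg C := (revHom h x).unop

@[simp] theorem rev_e (v : Vtx m) : rev h (e D v) = e C v := by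
  simp only [rev, revHom, Realization.lift_e]; rfl
@[simp] theorem rev_bm (j : Fin m) : rev h (bm D j) = mb C j := by
  simp only [rev, revHom, bm, Realization.lift_arr]; rfl
@[simp] theorem rev_mb (j : Fin m) : rev h (mb D j) = bm C j := by
  simp only [rev, revHom, mb, Realization.lift_arr]; rfl
@[simp] theorem rev_mt (j : Fin m) : rev h (mt D j) = tm C j := by
  simp only [rev, revHom, mt, Realization.lift_arr]; rfl
@[simp] theorem rev_tm (j : Fin m) : rev h (tm D j) = mt C j := by
  simp only [rev, revHom, tm, Realization.lift_arr]; rfl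
@[simp] theorem rev_add (x y : QHAlg D) : rev h (x + y) = rev h x + rev h y := by simp [rev]
@[simp] theorem rev_smul (r : K) (x : QHAlg D) : rev h (r • x) = r • rev h x := by simp [rev]
@[simp] theorem rev_mul (x y : QHAlg D) : rev h (x * y) = rev h y * rev h x := by simp [rev]
@[simp] theorem rev_sum {ι : Type*} (s : Finset ι) (f : ι → QHAlg D) :
    rev h (∑ i ∈ s, f i) = ∑ i ∈ s, rev h (f i) := by simp [rev]
@[simp] theorem rev_algebraMap (r : K) :
    rev h (algebraMap K _ r) = algebraMap K _ r := by simp [rev]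

theorem rev_rev (x : QHAlg C) : rev h (rev (fun i j => (h j i).symm) x) = x := by
  induction x using induction_on C with
  | algebraMap r => simp
  | vertex v => simp
  | arrow f =>
    cases f
    · rw [← bm]; simp
    · rw [← mb]; simp
    · rw [← mt]; simp
    · rw [← tm]; simp
  | add a b iha ihb => simp [iha, ihb]
  | mul a b iha ihb => simp [iha, ihb]

/-- `A_n(Cᵀ)` is the opposite algebra of `A_n(C)`. -/
noncomputable def revEquiv : QHAlg D ≃ₐ[K] (QHAlg C)ᵐᵒᵖ :=
  AlgEquiv.ofBijective (revHom h) <| by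
    constructor
    · refine Function.LeftInverse.injective (g := fun y => rev (fun i j => (h j i).symm) y.unop) ?_
      exact fun x => rev_rev (fun i j => (h j i).symm) x
    · refine Function.RightInverse.surjective
        (g := fun y => rev (fun i j => (h j i).symm) y.unop) fun x => ?_
      exact MulOpposite.unop_injective (rev_rev h x.unop)

theorem revEquiv_e (v : Vtx m) : revEquiv h (e D v) = .op (e C v) :=
  MulOpposite.unop_injective (rev_e h v)

variable [NeZero m]

@[simp] theorem rev_bt : rev h (bt D) = tb C := by rw [bt, rev_mul, rev_bm, rev_mt, tb]
@[simp] theorem rev_tb : rev h (tb D) = bt C := by rw [tb, rev_mul, rev_mb, rev_tm, bt]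
@[simp] theorem rev_ll : rev h (ll D) = ll C := by rw [ll, rev_mul, rev_bt, rev_tb, ll]
@[simp] theorem rev_wm (j : Fin m) : rev h (wm D j) = tbm C j := by
  rw [wm, rev_mul, rev_bt, rev_tm, tbm]
@[simp] theorem rev_tbm (j : Fin m) : rev h (tbm D j) = wm C j := by
  rw [tbm, rev_mul, rev_tb, rev_mt, wm]
omit [NeZero m] in
@[simp] theorem rev_mm (i j : Fin m) : rev h (mm D i j) = mm C j i := by
  rw [mm, rev_mul, rev_tm, rev_mt, mm]
omit [NeZero m] in
@[simp] theorem rev_loop (j : Fin m) : rev h (loop D j) = loop C j := by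
  rw [loop_eq, rev_mul, rev_mb, rev_bm, loop_eq]

/-- Reversal carries the right ideal `e_i A` to a left ideal of the algebra for `Cᵀ`, where the
spanning set is known. Right ideals are needed because `∇(i)` consists of functionals on `e_i A`. -/
theorem exists_e_mid_mul (a : QHAlg C) (i : Fin m) : ∃ (r s t : K) (w : Fin m → K) (z : K),
    e C (.mid i) * a = r • e C (.mid i) + s • bm C i + t • tm C i + ∑ j, w j • mm C i j +
      z • wm C i := by
  have h : ∀ i j, Cᵀ j i = C i j := fun i j => rfl
  obtain ⟨r, s, t, w, z, H⟩ := exists_mul_e_mid Cᵀ (rev (fun i j => (h j i).symm) a) i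
  exact ⟨r, s, t, w, z, by simpa [rev_rev] using congrArg (rev h) H⟩

theorem exists_e_top_mul (a : QHAlg C) : ∃ (r : K) (s : Fin m → K) (t : K),
    e C .top * a = r • e C .top + ∑ j, s j • mt C j + t • bt C := by
  have h : ∀ i j, Cᵀ j i = C i j := fun i j => rfl
  obtain ⟨r, s, t, H⟩ := exists_mul_e_top Cᵀ (rev (fun i j => (h j i).symm) a)
  exact ⟨r, s, t, by simpa [rev_rev] using congrArg (rev h) H⟩

variable (C) in
/-- The element of `e_1 A` with given coordinates. -/
noncomputable def revCoord : Coord K m →ₗ[K] QHAlg C where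
  toFun p := p.1 • e C .bot + ∑ j, p.2.1 j • mb C j + ∑ j, p.2.2.1 j • loop C j +
    p.2.2.2.1 • tb C + ∑ j, p.2.2.2.2.1 j • tbm C j + p.2.2.2.2.2 • ll C
  map_add' p q := by simp only [Prod.fst_add, Prod.snd_add, Pi.add_apply, add_smul,
      Finset.sum_add_distrib]; abel
  map_smul' r p := by simp only [Prod.smul_fst, Prod.smul_snd, Pi.smul_apply, smul_eq_mul,
      mul_smul, smul_add, Finset.smul_sum, RingHom.id_apply]

theorem exists_e_bot_mul (a : QHAlg C) : ∃ p : Coord K m, e C .bot * a = revCoord C p := by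
  have h : ∀ i j, Cᵀ j i = C i j := fun i j => rfl
  obtain ⟨p, H⟩ := exists_mul_e_bot Cᵀ (rev (fun i j => (h j i).symm) a)
  exact ⟨p, by simpa [rev_rev, ofCoord_apply] using! congrArg (rev h) H⟩

end Opposite

/-! ### The simple socle and the faithfulness of `A e_1`. -/

section Socle

variable [NeZero m]

@[simp] theorem ll_mul_wm (j : Fin m) : ll C * wm C j = 0 := by
  rw [wm, ← mul_assoc, ll, mul_assoc (tb C), bt_mul_tm, mul_zero, zero_mul]
@[simp] theorem ll_mul_bt : ll C * bt C = 0 := by rw [ll, mul_assoc, bt_mul_bt, mul_zero]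
@[simp] theorem tb_mul_loop (j : Fin m) : tb C * loop C j = 0 := by
  rw [loop_eq, ← mul_assoc, tb_mul_mb, zero_mul]
@[simp] theorem tb_mul_wm (j : Fin m) : tb C * wm C j = 0 := by
  rw [wm, ← mul_assoc, tb_mul_tm, zero_mul]
@[simp] theorem tb_mul_ll : tb C * ll C = 0 := by rw [ll, ← mul_assoc, tb_mul_tb, zero_mul]

theorem ll_mul_ofCoord (p : Coord K m) : ll C * ofCoord C p = p.1 • ll C := by
  simp [ofCoord_apply, mul_add, Finset.mul_sum]

theorem mt_mul_ofCoord (j : Fin m) (p : Coord K m) : mt C j * ofCoord C p = p.2.1 j • bt C := by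
  simp [ofCoord_apply, mul_add, Finset.mul_sum]

theorem tb_mul_ofCoord (p : Coord K m) : tb C * ofCoord C p = p.2.2.2.1 • ll C := by
  simp [ofCoord_apply, mul_add, Finset.mul_sum]

theorem bm_mul_ofCoord (j : Fin m) (p : Coord K m) :
    bm C j * ofCoord C p = p.1 • bm C j + (∑ k, p.2.2.1 k * C k j) • wm C j := by
  simp [ofCoord_apply, mul_add, Finset.mul_sum, Finset.sum_smul, mul_smul]

theorem mb_mul_ofCoord (j : Fin m) (p : Coord K m) :
    mb C j * ofCoord C p = p.2.1 j • loop C j + p.2.2.2.2.1 j • ll C := by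
  simp [ofCoord_apply, mul_add, Finset.mul_sum]

theorem e_bot_mul_ofCoord (p : Coord K m) : e C .bot * ofCoord C p =
    p.1 • e C .bot + ∑ j, p.2.2.1 j • loop C j + p.2.2.2.2.2 • ll C := by
  simp [ofCoord_apply, mul_add, Finset.mul_sum]

/-- Each basis path can be continued to `ll`. The coordinates are inspected in the order of `Coord`,
and at the first nonzero one a suitable path isolates it. Only the loop coordinates require that `C`
be invertible. -/
theorem exists_mul_ofCoord_eq_ll (hC : IsUnit C) {p : Coord K m} (hp : p ≠ 0) :
    ∃ b, b * ofCoord C p = ll C := by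
  obtain ⟨x, u, v, y, w, z⟩ := p
  by_cases hx : x = 0
  swap
  · exact ⟨x⁻¹ • ll C, by rw [smul_mul_assoc, ll_mul_ofCoord, smul_smul, inv_mul_cancel₀ hx, one_smul]⟩
  by_cases hu : u = 0
  swap
  · obtain ⟨j, hj⟩ := Function.ne_iff.1 hu
    exact ⟨(u j)⁻¹ • (tb C * mt C j), by
      rw [smul_mul_assoc, mul_assoc, mt_mul_ofCoord, mul_smul_comm, smul_smul, tb_mul_bt,
        inv_mul_cancel₀ hj, one_smul]⟩
  by_cases hv : v = 0
  swap
  -- The arrow `1 → j` sends `∑ v_k (1 k 1)` to the `j`-th entry of `v C` times `(1 i n j)`, so some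
  -- `j` detects `v`.
  · have : v ᵥ* C ≠ 0 := fun h => hv <| by
      apply (Matrix.vecMul_injective_iff_isUnit.2 hC)
      simpa using h
    obtain ⟨j, hj⟩ := Function.ne_iff.1 this
    simp only [Matrix.vecMul, dotProduct, Pi.zero_apply] at hj
    exact ⟨(∑ k, v k * C k j)⁻¹ • (mb C j * bm C j), by
      rw [smul_mul_assoc, mul_assoc, bm_mul_ofCoord]
      simp only [hx, zero_smul, zero_add, mul_smul_comm, smul_smul, mb_mul_wm, if_true]
      rw [inv_mul_cancel₀ hj, one_smul]⟩
  by_cases hy : y = 0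
  swap
  · exact ⟨y⁻¹ • tb C, by rw [smul_mul_assoc, tb_mul_ofCoord, smul_smul, inv_mul_cancel₀ hy, one_smul]⟩
  by_cases hw : w = 0
  swap
  · obtain ⟨j, hj⟩ := Function.ne_iff.1 hw
    exact ⟨(w j)⁻¹ • mb C j, by
      rw [smul_mul_assoc, mb_mul_ofCoord]
      simp only [hu, Pi.zero_apply, zero_smul, zero_add, smul_smul]
      rw [inv_mul_cancel₀ hj, one_smul]⟩
  have hz : z ≠ 0 := fun hz => hp (by simp [hx, hu, hv, hy, hw, hz])
  exact ⟨z⁻¹ • e C .bot, by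
    rw [smul_mul_assoc, e_bot_mul_ofCoord]
    simp [hx, hv, smul_smul, hz]⟩

/-- Every nonzero submodule of `A e_1` contains the path `(1 j n j 1)`. -/
theorem exists_mul_eq_ll (hC : IsUnit C) {a : QHAlg C} (ha : a * e C .bot = a) (h0 : a ≠ 0) :
    ∃ b, b * a = ll C := by
  rw [eq_ofCoord C ha] at h0 ⊢
  exact exists_mul_ofCoord_eq_ll C hC fun h => h0 (by rw [h, map_zero])

/-- Right multiplication by `1 → i` embeds `A e_i` into `A e_1`: it takes the spanning set of `A
e_i` to distinct basis elements of `A e_1`. -/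
theorem mul_bm_eq_zero {a : QHAlg C} {i : Fin m} (h : a * bm C i = 0) : a * e C (.mid i) = 0 := by
  obtain ⟨r, s, t, w, z, H⟩ := exists_mul_e_mid C a i
  have h1 : a * e C (.mid i) * bm C i = ofCoord C (0, Pi.single i r, Pi.single i s, t, w, z) := by
    rw [H]
    simp [add_mul, Finset.sum_mul, ofCoord_apply, Pi.single_apply]
  rw [mul_assoc, e_mul_bm, if_pos rfl, h] at h1
  have h2 := congrArg (coord C) h1
  simp only [map_zero, coord_ofCoord, Prod.ext_iff, Prod.fst_zero, Prod.snd_zero] at h2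
  obtain ⟨-, hr, hs, rfl, rfl, rfl⟩ := h2
  have hr := congrFun hr i
  have hs := congrFun hs i
  simp only [Pi.zero_apply, Pi.single_eq_same] at hr hs
  rw [H, ← hr, ← hs]
  simp

theorem mul_bt_eq_zero {a : QHAlg C} (h : a * bt C = 0) : a * e C .top = 0 := by
  obtain ⟨r, s, t, H⟩ := exists_mul_e_top C a
  have h1 : a * e C .top * bt C = ofCoord C (0, 0, 0, r, s, t) := by
    rw [H]
    simp [add_mul, Finset.sum_mul, ofCoord_apply]
  rw [mul_assoc, e_mul_bt, if_pos rfl, h] at h1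
  have h2 := congrArg (coord C) h1
  simp only [map_zero, coord_ofCoord, Prod.ext_iff, Prod.fst_zero, Prod.snd_zero] at h2
  obtain ⟨-, -, -, rfl, rfl, rfl⟩ := h2
  rw [H]
  simp

/-- `A e_1` is a faithful module. -/
theorem eq_zero_of_forall_mul_e_bot {a : QHAlg C} (h : ∀ b, a * (b * e C .bot) = 0) : a = 0 := by
  rw [eq_sum_mul_e C a]
  have h1 : a * e C .bot = 0 := by simpa using h 1
  have h2 : a * e C .top = 0 := mul_bt_eq_zero C (by simpa using h (bt C))
  have h3 : ∀ i, a * e C (.mid i) = 0 := fun i => mul_bm_eq_zero C (by simpa using h (bm C i))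
  simp [h1, h2, h3]

/-- A nonzero element of the kernel acts nontrivially on the faithful module `A e_1`, and a nonzero
value there can be multiplied up to `ll`. So every nonzero two-sided ideal contains `ll`. -/
theorem injective_of_map_ll_ne_zero (hC : IsUnit C) {B : Type w} [Ring B] [Algebra K B]
    (F : QHAlg C →ₐ[K] B) (hF : F (ll C) ≠ 0) : Function.Injective F := by
  rw [injective_iff_map_eq_zero]
  intro a ha
  refine eq_zero_of_forall_mul_e_bot C fun b => ?_
  by_contra h0
  obtain ⟨c, hc⟩ := exists_mul_eq_ll C hC (by rw [mul_assoc, mul_assoc, e_mul_self]) h0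
  exact hF (by rw [← hc, map_mul, map_mul, ha, zero_mul, mul_zero])

instance finite : Module.Finite K (QHAlg C) := by
  refine Module.Finite.of_injective (rep C).toLinearMap ?_
  rw [injective_iff_map_eq_zero]
  intro a ha
  refine eq_zero_of_forall_mul_e_bot C fun b => ?_
  have ha : rep C a = 0 := ha
  rw [← ofCoord_coord, ← ofCoord_rep, ha, LinearMap.zero_apply, map_zero]

end Socle

end QHAlg

/-! ### Comparison of vertices. -/

namespace Vtx

variable {m : ℕ}

@[simp] theorem bot_le' (v : Vtx m) : Vtx.bot ≤ v := by cases v <;> trivial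
@[simp] theorem le_top' (v : Vtx m) : v ≤ Vtx.top := by cases v <;> trivial
@[simp] theorem mid_le_mid {i j : Fin m} : Vtx.mid i ≤ Vtx.mid j ↔ i = j := Iff.rfl
@[simp] theorem not_mid_le_bot {i : Fin m} : ¬ Vtx.mid i ≤ Vtx.bot := id
@[simp] theorem not_top_le_bot : ¬ (Vtx.top : Vtx m) ≤ Vtx.bot := id
@[simp] theorem not_top_le_mid {i : Fin m} : ¬ Vtx.top ≤ Vtx.mid i := id

end Vtx

/-! ### Recognition and socle of the standard modules. -/

namespace QHAlg

variable {K : Type u} [Field K] {m : ℕ} (C : Matrix (Fin m) (Fin m) K) [NeZero m]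

section Module

variable {Q : Type w} [AddCommGroup Q] [Module (QHAlg C) Q]

/-- The defining relations of `Δ(k)` on a generator. -/
def StdRel (x : Q) : Vtx m → Prop
  | .bot => ∀ j, bm C j • x = 0
  | .mid i => mt C i • x = 0
  | .top => True

/-- A path whose image in `Δ(k)` generates the socle. -/
noncomputable def stdSocle : Vtx m → QHAlg C
  | .bot => e C .bot
  | .mid i => mb C i
  | .top => tb C

/-- The relations of `∇(k)` on a generator that make it a module over the vertices `≤ k`. -/
def CostdRel (x : Q) (k : Vtx m) : Prop :=
  (k ≠ .top → bt C • x = 0) ∧ ∀ j, ¬ Vtx.mid j ≤ k → bm C j • x = 0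

/-- A path from the top of `∇(k)` to its socle. -/
noncomputable def costdTop : Vtx m → QHAlg C
  | .bot => e C .bot
  | .mid i => bm C i
  | .top => bt C

variable {C}

omit [NeZero m] in
theorem mm_smul (j i : Fin m) (x : Q) : mm C j i • x = tm C j • mt C i • x := by
  rw [← tm_mul_mt, mul_smul]
theorem tbm_smul (i : Fin m) (x : Q) : tbm C i • x = tb C • mt C i • x := by
  rw [← tb_mul_mt, mul_smul]
omit [NeZero m] in
theorem loop_smul (i : Fin m) (x : Q) : loop C i • x = mb C i • bm C i • x := by
  rw [loop_eq, mul_smul]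
theorem wm_smul (i : Fin m) (x : Q) : wm C i • x = tm C i • bt C • x := by
  rw [← tm_mul_bt, mul_smul]
theorem bt_smul (i : Fin m) (x : Q) : bt C • x = mt C i • bm C i • x := by
  rw [bt_eq C i, mul_smul]
theorem ll_smul (x : Q) : ll C • x = tb C • bt C • x := by rw [← tb_mul_bt, mul_smul]

variable [Module K Q] [IsScalarTower K (QHAlg C) Q]

theorem exists_mul_e_mid_smul {x : Q} {i : Fin m} (hx : e C (.mid i) • x = x) (a : QHAlg C) :
    ∃ (r s t : K) (w : Fin m → K) (z : K), a • x = r • x + s • mb C i • x + t • mt C i • x +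
      ∑ j, w j • mm C j i • x + z • tbm C i • x := by
  obtain ⟨r, s, t, w, z, H⟩ := exists_mul_e_mid C a i
  refine ⟨r, s, t, w, z, ?_⟩
  have : a • x = (a * e C (.mid i)) • x := by rw [mul_smul, hx]
  rw [this, H]
  simp only [add_smul, Finset.sum_smul, smul_assoc, hx]

theorem exists_mul_e_top_smul {x : Q} (hx : e C .top • x = x) (a : QHAlg C) :
    ∃ (r : K) (s : Fin m → K) (t : K),
      a • x = r • x + ∑ j, s j • tm C j • x + t • tb C • x := by
  obtain ⟨r, s, t, H⟩ := exists_mul_e_top C a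
  refine ⟨r, s, t, ?_⟩
  have : a • x = (a * e C .top) • x := by rw [mul_smul, hx]
  rw [this, H]
  simp only [add_smul, Finset.sum_smul, smul_assoc, hx]

theorem exists_mul_e_bot_smul {x : Q} (hx : e C .bot • x = x) (a : QHAlg C) :
    ∃ p : Coord K m, a • x = p.1 • x + ∑ j, p.2.1 j • bm C j • x + ∑ j, p.2.2.1 j • loop C j • x +
      p.2.2.2.1 • bt C • x + ∑ j, p.2.2.2.2.1 j • wm C j • x + p.2.2.2.2.2 • ll C • x := by
  obtain ⟨p, H⟩ := exists_mul_e_bot C a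
  refine ⟨p, ?_⟩
  have : a • x = (a * e C .bot) • x := by rw [mul_smul, hx]
  rw [this, H, ofCoord_apply]
  simp only [add_smul, Finset.sum_smul, smul_assoc, hx]

/-- Under the relations of `Δ(k)` the spanning set of `A e_k` applied to `x` loses every path
through a vertex `≰ k`; the paths that remain end at vertices `≤ k`. -/
theorem e_smul_eq_zero_of_stdRel {k : Vtx m} {x : Q} (hx : e C k • x = x) (h : StdRel C x k)
    {l : Vtx m} (hl : ¬ l ≤ k) (a : QHAlg C) : e C l • a • x = 0 := by
  rcases k with _ | i | _
  · obtain ⟨p, H⟩ := exists_mul_e_bot_smul hx a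
    have h : ∀ j, bm C j • x = 0 := h
    have hb : bt C • x = 0 := by rw [bt_smul 0, h, smul_zero]
    simp only [loop_smul, wm_smul, ll_smul, h, hb, smul_zero, Finset.sum_const_zero,
      add_zero] at H
    rw [H, smul_comm, ← hx, ← mul_smul, e_mul_e]
    rcases l with _ | j | _ <;> simp at hl ⊢
  · obtain ⟨r, s, t, w, z, H⟩ := exists_mul_e_mid_smul hx a
    have h : mt C i • x = 0 := h
    simp only [mm_smul, tbm_smul, h, smul_zero, Finset.sum_const_zero, add_zero] at H
    rw [H, smul_add, smul_comm, smul_comm _ s, ← mul_smul (e C l)]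
    nth_rw 1 [← hx]
    rw [← mul_smul (e C l)]
    rcases l with _ | j | _ <;> simp at hl ⊢
    simp [hl]
  · simp at hl

/-- The annihilator of `x` is no larger than the relations of `Δ(k)` demand. The surviving
coefficients of `a e_k` are eliminated one at a time by pushing them to the nonzero element
`stdSocle C k • x`; all other terms pass through a vertex `≰ k` and so lie in `N`. -/
theorem mem_of_smul_eq_zero {k : Vtx m} {x : Q} (hx : e C k • x = x) (h : StdRel C x k)
    (hs : stdSocle C k • x ≠ 0) {a : QHAlg C} (ha : a • x = 0) (N : Submodule (QHAlg C) (QHAlg C))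
    (hN : ∀ l, ¬ l ≤ k → ∀ b, e C l * (b * e C k) ∈ N) : a * e C k ∈ N := by
  rcases k with _ | i | _
  · obtain ⟨p, H⟩ := exists_mul_e_bot C a
    have h : ∀ j, bm C j • x = 0 := h
    have hb : bt C • x = 0 := by rw [bt_smul 0, h, smul_zero]
    have h1 : p.1 = 0 := by
      have : (a * e C .bot) • x = 0 := by rw [mul_smul, hx, ha]
      rw [H, ofCoord_apply] at this
      simp only [add_smul, Finset.sum_smul, smul_assoc, hx, loop_smul, wm_smul, ll_smul, h, hb,
        smul_zero, Finset.sum_const_zero, add_zero] at this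
      have hs : e C .bot • x ≠ 0 := hs
      rw [hx] at hs
      exact (smul_eq_zero.1 this).resolve_right hs
    have hbm : ∀ j, bm C j ∈ N := fun j => by simpa using hN (.mid j) (by simp) (bm C j)
    have hbt : bt C ∈ N := by simpa using hN .top (by simp) (bt C)
    have hN' : ∀ (c : QHAlg C) {d}, d ∈ N → c * d ∈ N := fun c d hd => N.smul_mem c hd
    have hK : ∀ (r : K) {d}, d ∈ N → r • d ∈ N := fun r d hd => by
      rw [← algebraMap_smul (QHAlg C) r]; exact N.smul_mem _ hd
    rw [H, ofCoord_apply, h1, zero_smul, zero_add]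
    refine N.add_mem (N.add_mem (N.add_mem (N.add_mem ?_ ?_) ?_) ?_) ?_
    · exact N.sum_mem fun j _ => hK _ (hbm j)
    · exact N.sum_mem fun j _ => hK _ (by rw [loop_eq]; exact hN' _ (hbm j))
    · exact hK _ hbt
    · exact N.sum_mem fun j _ => hK _ (by rw [← tm_mul_bt]; exact hN' _ hbt)
    · exact hK _ (by rw [← tb_mul_bt]; exact hN' _ hbt)
  · obtain ⟨r, s, t, w, z, H⟩ := exists_mul_e_mid C a i
    have h : mt C i • x = 0 := h
    have hs : mb C i • x ≠ 0 := hs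
    have this : (a * e C (.mid i)) • x = 0 := by rw [mul_smul, hx, ha]
    rw [H] at this
    simp only [add_smul, Finset.sum_smul, smul_assoc, hx, mm_smul, tbm_smul, h,
        smul_zero, Finset.sum_const_zero, add_zero] at this
    have hr : r = 0 := by
      have h2 := congrArg (mb C i • ·) this
      simp only [smul_add, smul_comm (mb C i), ← mul_smul (mb C i), mb_mul_mb, zero_smul,
        smul_zero, add_zero] at h2
      exact (smul_eq_zero.1 h2).resolve_right hs
    have hs' : s = 0 := by
      rw [hr, zero_smul, zero_add] at this
      exact (smul_eq_zero.1 this).resolve_right hs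
    have hmt : mt C i ∈ N := by simpa using hN .top (by simp) (mt C i)
    have hN' : ∀ (c : QHAlg C) {d}, d ∈ N → c * d ∈ N := fun c d hd => N.smul_mem c hd
    have hK : ∀ (r : K) {d}, d ∈ N → r • d ∈ N := fun r d hd => by
      rw [← algebraMap_smul (QHAlg C) r]; exact N.smul_mem _ hd
    rw [H, hr, hs', zero_smul, zero_smul, zero_add, zero_add]
    refine N.add_mem (N.add_mem ?_ ?_) ?_
    · exact hK _ hmt
    · exact N.sum_mem fun j _ => hK _ (by rw [← tm_mul_mt]; exact hN' _ hmt)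
    · exact hK _ (by rw [← tb_mul_mt]; exact hN' _ hmt)
  · obtain ⟨r, s, t, H⟩ := exists_mul_e_top C a
    have hs : tb C • x ≠ 0 := hs
    have this : (a * e C .top) • x = 0 := by rw [mul_smul, hx, ha]
    rw [H] at this
    have hr : r = 0 := by
      have h2 := congrArg (tb C • ·) this
      simp only [smul_zero, ← mul_smul (tb C)] at h2
      simp [mul_add, Finset.mul_sum] at h2
      exact h2.resolve_right hs
    have hs' : ∀ j, s j = 0 := fun j => by
      have h2 := congrArg (mb C j • ·) this
      simp only [smul_zero, ← mul_smul (mb C j)] at h2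
      simp [mul_add, Finset.mul_sum] at h2
      exact h2.resolve_right hs
    have ht : t = 0 := by
      simp [hr, hs'] at this
      exact this.resolve_right hs
    rw [H, hr, ht]
    simp [hs']

/-- Recognition of the standard module `Δ(k)`. -/
theorem nonempty_equiv_stdModule {k : Vtx m} {x : Q} (hx : e C k • x = x) (h : StdRel C x k)
    (hs : stdSocle C k • x ≠ 0) (hspan : Submodule.span (QHAlg C) {x} = ⊤) :
    Nonempty (Q ≃ₗ[QHAlg C] StdModule (e C) k) := by
  let f : projModule (e C) k →ₗ[QHAlg C] Q :=
    (LinearMap.toSpanSingleton (QHAlg C) Q x).domRestrict (projModule (e C) k)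
  have hf : ∀ y, f y = (y : QHAlg C) • x := fun y => rfl
  have hsurj : Function.Surjective f := fun q => by
    have hq : q ∈ Submodule.span (QHAlg C) {x} := hspan ▸ Submodule.mem_top
    obtain ⟨a, rfl⟩ := Submodule.mem_span_singleton.1 hq
    refine ⟨⟨a * e C k, Submodule.mem_span_singleton.2 ⟨a, rfl⟩⟩, ?_⟩
    rw [hf, mul_smul, hx]
  have hker : LinearMap.ker f =
      sInf {N | ∀ l, ¬ l ≤ k → ∀ y : projModule (e C) k, e C l • y ∈ N} := by
    apply le_antisymm
    · refine le_sInf fun N hN => ?_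
      rintro ⟨y, hy⟩ hy0
      obtain ⟨a, rfl⟩ := Submodule.mem_span_singleton.1 hy
      have hy0 : (a * e C k) • x = 0 := hy0
      rw [mul_smul, hx] at hy0
      have := mem_of_smul_eq_zero hx h hs hy0 (N.map (projModule (e C) k).subtype) ?_
      · obtain ⟨z, hz, hz'⟩ := this
        rwa [← Subtype.ext (a1 := z) (a2 := ⟨a • e C k, hy⟩) hz']
      · intro l hl b
        exact ⟨_, hN l hl ⟨b * e C k, Submodule.mem_span_singleton.2 ⟨b, rfl⟩⟩, rfl⟩
    · refine sInf_le fun l hl y => ?_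
      rw [LinearMap.mem_ker, map_smul, hf]
      exact e_smul_eq_zero_of_stdRel hx h hl _
  exact ⟨((Submodule.quotEquivOfEq _ _ hker.symm).trans
    (f.quotKerEquivOfSurjective hsurj)).symm⟩

end Module

section Std

/-- The generator of `Δ(k)`. -/
noncomputable def stdGen (k : Vtx m) : StdModule (e C) k :=
  Submodule.Quotient.mk ⟨e C k, Submodule.mem_span_singleton_self _⟩

omit [NeZero m] in
theorem smul_stdGen_eq_zero {k l : Vtx m} (hl : ¬ l ≤ k) {a : QHAlg C} (ha : e C l * a = a) :
    a • stdGen C k = 0 := by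
  rw [stdGen, ← Submodule.Quotient.mk_smul, Submodule.Quotient.mk_eq_zero, ← ha, mul_smul]
  exact Submodule.mem_sInf.2 fun N hN => hN l hl _

omit [NeZero m] in
theorem e_smul_stdGen (k : Vtx m) : e C k • stdGen C k = stdGen C k := by
  rw [stdGen, ← Submodule.Quotient.mk_smul]
  congr 1
  exact Subtype.ext (e_mul_self C k)

omit [NeZero m] in
theorem stdRel_stdGen (k : Vtx m) : StdRel C (stdGen C k) k := by
  rcases k with _ | i | _
  · exact fun j => smul_stdGen_eq_zero C (l := .mid j) (by simp) (by simp)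
  · exact smul_stdGen_eq_zero C (l := .top) (by simp) (by simp)
  · trivial

/-- Inside `A e_1` the elements `ll`, `(1 k n i)` and `(1 j n)` generate copies of the standard
modules. These witnesses show that the abstract quotients `Δ(k)` are large enough. -/
theorem exists_stdRel (k : Vtx m) :
    ∃ x : QHAlg C, e C k • x = x ∧ StdRel C x k ∧ stdSocle C k • x ≠ 0 := by
  rcases k with _ | i | _
  · exact ⟨ll C, by simp, fun j => by simp, by simpa [stdSocle] using ll_ne_zero C⟩
  · exact ⟨wm C i, by simp, by simp [StdRel], by simpa [stdSocle] using ll_ne_zero C⟩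
  · exact ⟨bt C, by simp, trivial, by simpa [stdSocle] using ll_ne_zero C⟩

/-- The map `A e_k → A` determined by a witness from `exists_stdRel` kills the submodule that
defines `Δ(k)`, but not the socle path. -/
theorem stdSocle_smul_stdGen (k : Vtx m) : stdSocle C k • stdGen C k ≠ 0 := by
  obtain ⟨x, hx, h, hs⟩ := exists_stdRel C k
  rw [stdGen, ← Submodule.Quotient.mk_smul, Ne, Submodule.Quotient.mk_eq_zero]
  intro h0
  have h1 : _ ∈ LinearMap.ker
      ((LinearMap.toSpanSingleton (QHAlg C) (QHAlg C) x).domRestrict (projModule (e C) k)) :=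
    Submodule.mem_sInf.1 h0 _ fun l hl y => by
      rw [LinearMap.mem_ker, map_smul]
      exact e_smul_eq_zero_of_stdRel hx h hl _
  apply hs
  have h2 : (stdSocle C k * e C k) • x = 0 := h1
  rwa [mul_smul, hx] at h2

/-- The socle of a standard module is a sum of copies of `S(1)`. -/
theorem e_bot_smul_of_stdModule (k : Vtx m) (x : StdModule (e C) k) (h1 : ∀ j, mb C j • x = 0)
    (h3 : ∀ j, tm C j • x = 0) : e C .bot • x = x := by
  obtain ⟨⟨y, hy⟩, rfl⟩ := Submodule.Quotient.mk_surjective _ x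
  obtain ⟨a, rfl⟩ := Submodule.mem_span_singleton.1 hy
  have hx : (Submodule.Quotient.mk ⟨a • e C k, hy⟩ : StdModule (e C) k) = a • stdGen C k := rfl
  rw [hx] at h1 h3 ⊢
  have hg := e_smul_stdGen C k
  have hr := stdRel_stdGen C k
  have hs := stdSocle_smul_stdGen C k
  generalize stdGen C k = g at *
  clear hx hy
  rcases k with _ | i | _
  · have := fun l hl => e_smul_eq_zero_of_stdRel (l := l) hg hr hl a
    have h2 : (∑ v, e C v) • a • g = a • g := by rw [sum_e, one_smul]
    rw [Vtx.sum_eq, add_smul, add_smul, Finset.sum_smul] at h2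
    simpa [this] using h2
  · obtain ⟨r, s, t, w, z, H⟩ := exists_mul_e_mid_smul hg a
    have h : mt C i • g = 0 := hr
    have hs : mb C i • g ≠ 0 := hs
    simp only [mm_smul, tbm_smul, h, smul_zero, Finset.sum_const_zero, add_zero] at H
    have h2 := h1 i
    rw [H] at h2 ⊢
    have hr : r = 0 := by
      simp only [smul_add, smul_comm (mb C i), ← mul_smul (mb C i), mb_mul_mb, zero_smul,
        smul_zero, add_zero] at h2
      exact (smul_eq_zero.1 h2).resolve_right hs
    rw [hr, zero_smul, zero_add, smul_comm, ← mul_smul (e C .bot)]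
    simp
  · obtain ⟨r, s, t, H⟩ := exists_mul_e_top_smul hg a
    have hs : tb C • g ≠ 0 := hs
    -- All arrows `j → 1` kill the generator of `Δ(n)`, so its coefficient must first be moved by `n
    -- → j`, here with `j = 0`.
    have h3 : tm C 0 • a • g = 0 := h3 0
    have hr : r = 0 := by
      rw [H] at h3
      have h4 := congrArg (mb C 0 • ·) h3
      simp only [smul_add, Finset.smul_sum, smul_comm (tm C 0), ← mul_smul (tm C 0),
        smul_comm (mb C 0), ← mul_smul (mb C 0), ← mul_assoc] at h4
      simp at h4
      exact h4.resolve_right hs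
    have hs' : ∀ j, s j = 0 := fun j => by
      have h2 := h1 j
      rw [H] at h2
      simp only [smul_add, Finset.smul_sum, smul_comm (mb C j), ← mul_smul (mb C j)] at h2
      simp [hr] at h2
      exact h2.resolve_right hs
    rw [H]
    simp only [hr, hs', zero_smul, Finset.sum_const_zero, zero_add]
    rw [smul_comm, ← mul_smul (e C .bot)]
    simp

end Std

end QHAlg

/-! ### Recognition and generation of the costandard modules. -/

namespace QHAlg

variable {K : Type u} [Field K] {m : ℕ} {C : Matrix (Fin m) (Fin m) K} [NeZero m]

omit [NeZero m] in
-- The functionals on `e_k A` that vanish on the ideals `A e_l A`, `l ≰ k`, themselves form a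
-- submodule without the excluded composition factors, so they are the largest one. This replaces
-- the supremum by a pointwise condition.
theorem mem_costdModule_iff {k : Vtx m} {f : DualModule K (QHAlg C)} :
    f ∈ costdModule K (e C) k ↔
      (∀ x, f (e C k * x) = f x) ∧ ∀ l, ¬ l ≤ k → ∀ x y, f (x * e C l * y) = 0 := by
  constructor
  · intro hf
    let N : Submodule (QHAlg C) (DualModule K (QHAlg C)) :=
      { carrier := {f | f ∈ injModule K (e C) k ∧
          ∀ l, ¬ l ≤ k → ∀ y : QHAlg C, e C l • y • f = 0}
        zero_mem' := ⟨Submodule.zero_mem _, fun l hl y => by rw [smul_zero, smul_zero]⟩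
        add_mem' := fun {f g} hf hg => ⟨Submodule.add_mem _ hf.1 hg.1, fun l hl y => by
          rw [smul_add, smul_add, hf.2 l hl, hg.2 l hl, add_zero]⟩
        smul_mem' := fun c f hf => ⟨Submodule.smul_mem _ c hf.1, fun l hl y => by
          rw [← mul_smul y, hf.2 l hl]⟩ }
    have hN : costdModule K (e C) k ≤ N := sSup_le fun M hM f hf =>
      ⟨hM.1 hf, fun l hl y => hM.2 l hl _ (M.smul_mem y hf)⟩
    refine ⟨(hN hf).1, fun l hl x y => ?_⟩
    have h := DFunLike.congr_fun ((hN hf).2 l hl y) x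
    rwa [DualModule.smul_apply, DualModule.smul_apply] at h
  · rintro ⟨h1, h2⟩
    refine Submodule.mem_sSup.2 fun M hM => ?_
    refine hM (Submodule.span (QHAlg C) {f}) ⟨?_, ?_⟩ (Submodule.mem_span_singleton_self f)
    · exact (Submodule.span_singleton_le_iff_mem _ _).2 h1
    · intro l hl x hx
      obtain ⟨a, rfl⟩ := Submodule.mem_span_singleton.1 hx
      refine DFunLike.ext _ _ fun z => ?_
      rw [DualModule.smul_apply, DualModule.smul_apply]
      exact h2 l hl z a

omit [NeZero m] in
theorem dual_add (f : DualModule K (QHAlg C)) (x y : QHAlg C) : f (x + y) = f x + f y :=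
  LinearMap.map_add (f : QHAlg C →ₗ[K] K) x y
omit [NeZero m] in
theorem dual_smul (f : DualModule K (QHAlg C)) (r : K) (x : QHAlg C) : f (r • x) = r * f x :=
  LinearMap.map_smul (f : QHAlg C →ₗ[K] K) r x
omit [NeZero m] in
theorem dual_sum (f : DualModule K (QHAlg C)) {ι : Type*} (s : Finset ι) (x : ι → QHAlg C) :
    f (∑ i ∈ s, x i) = ∑ i ∈ s, f (x i) :=
  _root_.map_sum (show QHAlg C →ₗ[K] K from f) x s
omit [NeZero m] in
theorem dual_sub (f g : DualModule K (QHAlg C)) (x : QHAlg C) : (f - g) x = f x - g x := rfl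

/-- The values that determine an element of `∇(k)`. -/
def CostdVanish (f : DualModule K (QHAlg C)) : Vtx m → Prop
  | .bot => f (e C .bot) = 0
  | .mid i => f (e C (.mid i)) = 0 ∧ f (bm C i) = 0
  | .top => f (e C .top) = 0 ∧ (∀ j, f (mt C j) = 0) ∧ f (bt C) = 0

/-- Of the paths spanning `e_k A`, those through a vertex `≰ k` are already killed by `f`; the
remaining ones are the test values in `CostdVanish`. -/
theorem eq_zero_of_costdVanish {k : Vtx m} {f : DualModule K (QHAlg C)}
    (hf : f ∈ costdModule K (e C) k) (h : CostdVanish f k) : f = 0 := by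
  obtain ⟨h1, h2⟩ := mem_costdModule_iff.1 hf
  refine DFunLike.ext _ _ fun a => ?_
  change f a = 0
  rcases k with _ | i | _
  · have hbot : f (e C .bot * a) = f (e C .bot * a * e C .bot) := by
      conv_lhs => rw [eq_sum_mul_e C (e C .bot * a)]
      rw [dual_add, dual_add, dual_sum]
      have h3 : ∀ i, f (e C .bot * a * e C (.mid i)) = 0 := fun i => by
        simpa using h2 (.mid i) (by simp) (e C .bot * a) 1
      have h4 : f (e C .bot * a * e C .top) = 0 := by
        simpa using h2 .top (by simp) (e C .bot * a) 1
      simp [h3, h4]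
    rw [← h1, hbot, mul_assoc]
    obtain ⟨p, H⟩ := exists_mul_e_bot C a
    have hl : ∀ j, f (loop C j) = 0 := fun j => by
      have := h2 (.mid j) (by simp) (mb C j) (bm C j)
      simpa using this
    have hll : f (ll C) = 0 := by
      have := h2 .top (by simp) (tb C) (bt C)
      simpa using this
    rw [H, e_bot_mul_ofCoord, dual_add, dual_add, dual_sum]
    simp only [dual_smul, hl, hll, mul_zero, Finset.sum_const_zero, add_zero]
    rw [show f (e C .bot) = 0 from h, mul_zero]
  · obtain ⟨r, s, t, w, z, H⟩ := exists_e_mid_mul (C := C) a i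
    have hm : ∀ j, f (mm C i j) = 0 := fun j => by
      have := h2 .top (by simp) (tm C i) (mt C j)
      simpa using this
    have ht : f (tm C i) = 0 := by
      have := h2 .top (by simp) (tm C i) 1
      simpa using this
    have hw : f (wm C i) = 0 := by
      have := h2 .top (by simp) (tm C i) (bt C)
      simpa using this
    rw [← h1, H]
    simp only [dual_add, dual_sum, dual_smul, hm, ht, hw, h.1, h.2, mul_zero,
      Finset.sum_const_zero, add_zero]
  · obtain ⟨r, s, t, H⟩ := exists_e_top_mul (C := C) a
    rw [← h1, H]
    simp only [dual_add, dual_sum, dual_smul, h.1, h.2.1, h.2.2, mul_zero,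
      Finset.sum_const_zero, add_zero]

/-- `∇(k)` is generated by any element that does not vanish on a path from its top to its socle. -/
theorem exists_smul_eq_of_mem_costdModule {k : Vtx m} {f g : DualModule K (QHAlg C)}
    (hf : f ∈ costdModule K (e C) k) (hg : g ∈ costdModule K (e C) k)
    (h : g (costdTop C k) ≠ 0) : ∃ a, f = (a * e C .bot) • g := by
  rcases k with _ | i | _
  · have h : g (e C .bot) ≠ 0 := h
    refine ⟨(f (e C .bot) * (g (e C .bot))⁻¹) • e C .bot, ?_⟩
    rw [← sub_eq_zero]
    refine eq_zero_of_costdVanish (Submodule.sub_mem _ hf (Submodule.smul_mem _ _ hg)) ?_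
    simp only [CostdVanish, dual_sub, DualModule.smul_apply]
    simp [dual_smul, h]
  · have h : g (bm C i) ≠ 0 := h
    refine ⟨(f (bm C i) * (g (bm C i))⁻¹) • e C .bot +
      (f (e C (.mid i)) * (g (bm C i))⁻¹) • bm C i, ?_⟩
    rw [← sub_eq_zero]
    refine eq_zero_of_costdVanish (Submodule.sub_mem _ hf (Submodule.smul_mem _ _ hg)) ?_
    simp only [CostdVanish, dual_sub, DualModule.smul_apply]
    simp [dual_smul, add_mul, mul_add, h]
  · have h : g (bt C) ≠ 0 := h
    -- Since `(a • g) x = g (x a)`, the elements `e_1 g`, `(1 j) g`, `(1 j n) g` are, up to the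
    -- factor `g (bt C)`, dual to the top paths `(1 j n)`, `(j n)`, `e_n`, apart from triangular
    -- corrections that vanish because `g` is tested at composable paths only.
    refine ⟨(f (bt C) * (g (bt C))⁻¹) • e C .bot +
      ∑ j, (f (mt C j) * (g (bt C))⁻¹) • bm C j + (f (e C .top) * (g (bt C))⁻¹) • bt C, ?_⟩
    rw [← sub_eq_zero]
    refine eq_zero_of_costdVanish (Submodule.sub_mem _ hf (Submodule.smul_mem _ _ hg)) ?_
    simp only [CostdVanish, dual_sub, DualModule.smul_apply]
    simp [dual_smul, add_mul, mul_add, h, Finset.sum_mul, Finset.mul_sum]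

section Module

variable {Q : Type w} [AddCommGroup Q] [Module (QHAlg C) Q] [Module K Q]
  [IsScalarTower K (QHAlg C) Q]

theorem e_smul_eq_zero_of_costdRel {k : Vtx m} {x : Q} (hx : e C .bot • x = x)
    (h : CostdRel C x k) {l : Vtx m} (hl : ¬ l ≤ k) (a : QHAlg C) : e C l • a • x = 0 := by
  obtain ⟨p, H⟩ := exists_mul_e_bot_smul hx a
  have hk : k ≠ .top := by rintro rfl; simp at hl
  have hb := h.1 hk
  simp only [loop_smul, wm_smul, ll_smul, hb, smul_zero, Finset.sum_const_zero, add_zero] at H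
  rw [H]
  rcases l with _ | j | _
  · simp at hl
  · have hj := h.2 j hl
    simp only [smul_add, Finset.smul_sum, smul_comm (e C (.mid j)), ← mul_smul (e C (.mid j))]
    rw [← hx, ← mul_smul (e C (.mid j))]
    simp
    exact Or.inr (by rw [← mul_smul, bm_mul_e, if_pos rfl, hj])
  · simp only [smul_add, Finset.smul_sum, smul_comm (e C .top), ← mul_smul (e C .top)]
    rw [← hx, ← mul_smul (e C .top)]
    simp

variable (C) in
/-- The map `Q → D A`, `q ↦ (a ↦ φ (e_k a q))`. -/
def dualMap (φ : Q →ₗ[K] K) (k : Vtx m) : Q →ₗ[QHAlg C] DualModule K (QHAlg C) where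
  toFun q := (φ.comp ((LinearMap.toSpanSingleton (QHAlg C) Q q).restrictScalars K)).comp
    (LinearMap.mulLeft K (e C k))
  map_add' q q' := DFunLike.ext _ _ fun a => by
    change φ ((e C k * a) • (q + q')) = φ ((e C k * a) • q) + φ ((e C k * a) • q')
    rw [smul_add, map_add]
  map_smul' b q := DFunLike.ext _ _ fun a => by
    change φ ((e C k * a) • b • q) = φ ((e C k * (a * b)) • q)
    rw [← mul_smul, mul_assoc]

omit [NeZero m] in
theorem dualMap_apply (φ : Q →ₗ[K] K) (k : Vtx m) (q : Q) (a : QHAlg C) :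
    dualMap C φ k q a = φ ((e C k * a) • q) := rfl

omit [NeZero m] in
theorem dualMap_mem (φ : Q →ₗ[K] K) {k : Vtx m} (h : ∀ l, ¬ l ≤ k → ∀ q : Q, e C l • q = 0)
    (q : Q) : dualMap C φ k q ∈ costdModule K (e C) k := by
  refine mem_costdModule_iff.2 ⟨fun x => ?_, fun l hl x y => ?_⟩
  · rw [dualMap_apply, dualMap_apply, ← mul_assoc, e_mul_self]
  · rw [dualMap_apply, mul_assoc, mul_smul, mul_smul, mul_smul, h l hl, smul_zero, smul_zero,
      map_zero]

omit [NeZero m] in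
theorem exists_dual_ne_zero {q : Q} (hq : q ≠ 0) : ∃ φ : Q →ₗ[K] K, φ q ≠ 0 := by
  by_contra! h
  exact hq ((Module.forall_dual_apply_eq_zero_iff K q).1 h)

theorem e_mul_costdTop (k : Vtx m) : e C k * costdTop C k = costdTop C k := by
  rcases k with _ | i | _ <;> simp [costdTop]

theorem forall_e_smul_eq_zero {k : Vtx m} {x : Q} (hx : e C .bot • x = x) (h : CostdRel C x k)
    (hspan : Submodule.span (QHAlg C) {x} = ⊤) (l : Vtx m) (hl : ¬ l ≤ k) (q : Q) :
    e C l • q = 0 := by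
  have hq : q ∈ Submodule.span (QHAlg C) {x} := hspan ▸ Submodule.mem_top
  obtain ⟨a, rfl⟩ := Submodule.mem_span_singleton.1 hq
  exact e_smul_eq_zero_of_costdRel hx h hl a

/-- Recognition of the costandard module `∇(k)`. -/
theorem nonempty_equiv_costdModule {k : Vtx m} {x : Q} (hx : e C .bot • x = x)
    (h : CostdRel C x k) (hl : ∀ j, loop C j • x = 0) (hw : ∀ j, wm C j • x = 0)
    (hs : costdTop C k • x ≠ 0) (hspan : Submodule.span (QHAlg C) {x} = ⊤) :
    Nonempty (Q ≃ₗ[QHAlg C] costdModule K (e C) k) := by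
  -- A functional that is nonzero on the prospective socle embeds `Q` into the dual of `e_k A`.
  obtain ⟨φ, hφ⟩ := exists_dual_ne_zero (K := K) hs
  have hmem := dualMap_mem (C := C) φ (forall_e_smul_eq_zero hx h hspan)
  let f : Q →ₗ[QHAlg C] costdModule K (e C) k := (dualMap C φ k).codRestrict _ hmem
  refine ⟨LinearEquiv.ofBijective f ⟨?_, ?_⟩⟩
  · rw [← LinearMap.ker_eq_bot, LinearMap.ker_eq_bot']
    intro q hq
    have hq' : ∀ a, φ ((e C k * a) • q) = 0 := fun a => by
      have : dualMap C φ k q = 0 := congrArg Subtype.val hq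
      rw [← dualMap_apply, this]; rfl
    have hmem : q ∈ Submodule.span (QHAlg C) {x} := hspan ▸ Submodule.mem_top
    obtain ⟨a, rfl⟩ := Submodule.mem_span_singleton.1 hmem
    obtain ⟨p, H⟩ := exists_mul_e_bot_smul hx a
    have hll : ll C • x = 0 := by
      have := congrArg (mb C 0 • ·) (hw 0)
      simpa [← mul_smul] using this
    simp only [hl, hw, hll, smul_zero, Finset.sum_const_zero, add_zero] at H
    have act : ∀ b : QHAlg C, b • a • x = p.1 • b • x + ∑ j, p.2.1 j • (b * bm C j) • x +
        p.2.2.2.1 • (b * bt C) • x := fun b => by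
      rw [H]
      simp only [smul_add, Finset.smul_sum, smul_comm b, mul_smul]
    clear hq
    rcases k with _ | i | _
    · have hb := h.1 (by simp)
      have hm := fun j => h.2 j (by simp)
      have hφ : φ (e C .bot • x) ≠ 0 := hφ
      have h1 := hq' (e C .bot)
      simp only [hb, hm, smul_zero, Finset.sum_const_zero, add_zero] at H
      rw [e_mul_self, H, smul_comm, map_smul, smul_eq_mul] at h1
      rw [H, (mul_eq_zero.1 h1).resolve_right hφ, zero_smul]
    · have hb := h.1 (by simp)
      have hm : ∀ j, j ≠ i → bm C j • x = 0 := fun j hj => h.2 j (by simpa using hj)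
      have hφ : φ (bm C i • x) ≠ 0 := hφ
      have hsum : ∑ j, p.2.1 j • bm C j • x = p.2.1 i • bm C i • x :=
        Finset.sum_eq_single i (fun j _ hj => by rw [hm j hj, smul_zero]) (by simp)
      have h1 := hq' (bm C i)
      rw [act] at h1
      simp at h1
      have h1 := h1.resolve_right hφ
      have h2 := hq' (e C (.mid i))
      rw [e_mul_self, H, h1, hsum, hb, zero_smul, smul_zero, add_zero, zero_add, smul_comm,
        ← mul_smul, e_mul_bm, if_pos rfl, map_smul, smul_eq_mul] at h2
      rw [H, h1, hsum, hb, (mul_eq_zero.1 h2).resolve_right hφ]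
      simp
    · have hφ : φ (bt C • x) ≠ 0 := hφ
      have h1 := hq' (bt C)
      rw [act] at h1
      simp at h1
      have h1 := h1.resolve_right hφ
      have h2 : ∀ j, p.2.1 j = 0 := fun j => by
        have h2 := hq' (mt C j)
        rw [act] at h2
        simp [h1] at h2
        exact h2.resolve_right hφ
      have h3 := hq' (e C .top)
      rw [act] at h3
      simp [h1, h2] at h3
      have h3 := h3.resolve_right hφ
      rw [H]
      simp [h1, h2, h3]
  · rintro ⟨g, hg⟩
    -- The image of `x` does not vanish on the path to the socle, so it generates `∇(k)` and the map
    -- is onto.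
    have hne : dualMap C φ k x (costdTop C k) ≠ 0 := by
      rwa [dualMap_apply, e_mul_costdTop]
    obtain ⟨a, ha⟩ := exists_smul_eq_of_mem_costdModule hg (hmem x) hne
    exact ⟨(a * e C .bot) • x, Subtype.ext ((map_smul (dualMap C φ k) _ x).trans ha.symm)⟩

end Module

end QHAlg

/-! ### Filtrations by successive generators. -/

section Filtration

variable {A : Type u} [Ring A] {V : Type}

/-- A chain of submodules of a module gives a filtration of its last member. -/
theorem hasFiltration_of_chain (X : V → Type u) [∀ i, AddCommGroup (X i)] [∀ i, Module A (X i)]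
    {M : Type w} [AddCommGroup M] [Module A M] {t : ℕ} (F : ℕ → Submodule A M)
    (label : Fin t → V) (h0 : F 0 = ⊥) (hF : Monotone F)
    (hX : ∀ s : Fin t, Nonempty
      ((F (s + 1) ⧸ (F s).submoduleOf (F (s + 1))) ≃ₗ[A] X (label s))) :
    HasFiltration A X (F t) (fun j => Nat.card {s : Fin t // label s = j}) := by
  refine ⟨t, fun s => (F s).submoduleOf (F t), label, ?_, ?_, ?_, ?_, fun _ => rfl⟩
  · simp [h0, Submodule.submoduleOf]
  · simp [Submodule.submoduleOf]
  · intro a b hab x hx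
    exact hF hab hx
  · intro s
    obtain ⟨E⟩ := hX s
    have hle : F (s + 1) ≤ F t := hF s.2
    refine ⟨(Submodule.Quotient.equiv _ ((F s).submoduleOf (F (s + 1)))
      (Submodule.submoduleOfEquivOfLe hle) ?_).trans E⟩
    ext x
    constructor
    · rintro ⟨y, hy, rfl⟩
      exact hy
    · intro hx
      exact ⟨(Submodule.submoduleOfEquivOfLe hle).symm x, hx, by simp⟩

/-- The chain of submodules generated by the initial segments of a sequence. -/
def genChain {M : Type w} [AddCommGroup M] [Module A M] {t : ℕ} (x : Fin t → M) (s : ℕ) :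
    Submodule A M :=
  Submodule.span A {y | ∃ r : Fin t, r.val < s ∧ x r = y}

variable {M : Type w} [AddCommGroup M] [Module A M] {t : ℕ} (x : Fin t → M)

variable (A) in
theorem genChain_zero : genChain (A := A) x 0 = ⊥ := by
  simp [genChain]

variable (A) in
theorem genChain_mono : Monotone (genChain (A := A) x) := fun _ _ hab =>
  Submodule.span_mono fun _ ⟨r, hr, hy⟩ => ⟨r, hr.trans_le hab, hy⟩

theorem mem_genChain {s : ℕ} (r : Fin t) (hr : r.val < s) : x r ∈ genChain (A := A) x s :=
  Submodule.subset_span ⟨r, hr, rfl⟩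

theorem genChain_succ (s : Fin t) :
    genChain (A := A) x (s + 1) = genChain x s ⊔ Submodule.span A {x s} := by
  rw [genChain, genChain, ← Submodule.span_union]
  congr 1
  ext y
  constructor
  · rintro ⟨r, hr, rfl⟩
    rcases Nat.lt_succ_iff_lt_or_eq.1 hr with h | h
    · exact Or.inl ⟨r, h, rfl⟩
    · exact Or.inr (by rw [Fin.ext h]; rfl)
  · rintro (⟨r, hr, rfl⟩ | rfl)
    · exact ⟨r, hr.trans (Nat.lt_succ_self _), rfl⟩
    · exact ⟨s, Nat.lt_succ_self _, rfl⟩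

theorem genChain_le {s : ℕ} {N : Submodule A M} (h : ∀ r : Fin t, r.val < s → x r ∈ N) :
    genChain x s ≤ N :=
  Submodule.span_le.2 <| by rintro _ ⟨r, hr, rfl⟩; exact h r hr

/-- The class of the next generator in a subquotient of a chain. -/
def chainGen (s : Fin t) : genChain (A := A) x (s + 1) ⧸
    (genChain (A := A) x s).submoduleOf (genChain (A := A) x (s + 1)) :=
  Submodule.Quotient.mk ⟨x s, mem_genChain x s (Nat.lt_succ_self _)⟩

theorem smul_chainGen_eq_zero_iff (s : Fin t) (a : A) :
    a • chainGen (A := A) x s = 0 ↔ a • x s ∈ genChain (A := A) x s := by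
  rw [chainGen, ← Submodule.Quotient.mk_smul, Submodule.Quotient.mk_eq_zero]
  rfl

theorem span_chainGen (s : Fin t) : Submodule.span A {chainGen (A := A) x s} = ⊤ := by
  rw [eq_top_iff]
  rintro q -
  obtain ⟨⟨y, hy⟩, rfl⟩ := Submodule.Quotient.mk_surjective _ q
  have hy' := hy
  rw [genChain_succ] at hy'
  obtain ⟨z, hz, c, hc, rfl⟩ := Submodule.mem_sup.1 hy'
  obtain ⟨a, rfl⟩ := Submodule.mem_span_singleton.1 hc
  refine Submodule.mem_span_singleton.2 ⟨a, ?_⟩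
  rw [chainGen, ← Submodule.Quotient.mk_smul, Submodule.Quotient.eq]
  change a • x s - (z + a • x s) ∈ genChain (A := A) x s
  rw [sub_add_cancel_right]
  exact Submodule.neg_mem _ hz

end Filtration

/-! ### Criteria for good filtrations, and their consequences for a module. -/

namespace QHAlg

variable {K : Type u} [Field K] {m : ℕ} {C : Matrix (Fin m) (Fin m) K} [NeZero m]

section Criteria

variable {M : Type w} [AddCommGroup M] [Module (QHAlg C) M] [Module K M]
  [IsScalarTower K (QHAlg C) M]

/-- A criterion for a chain of submodules to be a `Δ`-good filtration. -/
theorem hasFiltration_stdModule {t : ℕ} (x : Fin t → M) (label : Fin t → Vtx m)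
    (he : ∀ s : Fin t, e C (label s) • x s = x s)
    (hbot : ∀ s, label s = .bot → ∀ j, bm C j • x s ∈ genChain (A := QHAlg C) x s)
    (hmid : ∀ s i, label s = .mid i → mt C i • x s ∈ genChain (A := QHAlg C) x s)
    (hs : ∀ s : Fin t, stdSocle C (label s) • x s ∉ genChain (A := QHAlg C) x s) :
    HasFiltration (QHAlg C) (StdModule (e C)) (genChain (A := QHAlg C) x t)
      (fun j => Nat.card {s : Fin t // label s = j}) := by
  refine hasFiltration_of_chain _ _ label (genChain_zero _ x) (genChain_mono _ x) fun s => ?_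
  refine nonempty_equiv_stdModule (x := chainGen x s) ?_ ?_ ?_ (span_chainGen x s)
  · rw [chainGen, ← Submodule.Quotient.mk_smul]
    congr 1
    exact Subtype.ext (he s)
  · have h1 := hbot s
    have h2 := hmid s
    generalize label s = k at h1 h2
    rcases k with _ | i | _
    · exact fun j => (smul_chainGen_eq_zero_iff x s _).2 (h1 rfl j)
    · exact (smul_chainGen_eq_zero_iff x s _).2 (h2 i rfl)
    · trivial
  · exact fun h => hs s ((smul_chainGen_eq_zero_iff x s _).1 h)

/-- A criterion for a chain of submodules to be a `∇`-good filtration. -/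
theorem hasFiltration_costdModule {t : ℕ} (x : Fin t → M) (label : Fin t → Vtx m)
    (he : ∀ s : Fin t, e C .bot • x s = x s)
    (hbt : ∀ s, label s ≠ .top → bt C • x s ∈ genChain (A := QHAlg C) x s)
    (hbm : ∀ s j, ¬ Vtx.mid j ≤ label s → bm C j • x s ∈ genChain (A := QHAlg C) x s)
    (hl : ∀ (s : Fin t) j, loop C j • x s ∈ genChain (A := QHAlg C) x s)
    (hw : ∀ (s : Fin t) j, wm C j • x s ∈ genChain (A := QHAlg C) x s)
    (hs : ∀ s : Fin t, costdTop C (label s) • x s ∉ genChain (A := QHAlg C) x s) :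
    HasFiltration (QHAlg C) (fun k => costdModule K (e C) k) (genChain (A := QHAlg C) x t)
      (fun j => Nat.card {s : Fin t // label s = j}) := by
  refine hasFiltration_of_chain _ _ label (genChain_zero _ x) (genChain_mono _ x) fun s => ?_
  refine nonempty_equiv_costdModule (x := chainGen x s) ?_ ?_ ?_ ?_ ?_ (span_chainGen x s)
  · rw [chainGen, ← Submodule.Quotient.mk_smul]
    congr 1
    exact Subtype.ext (he s)
  · exact ⟨fun h => (smul_chainGen_eq_zero_iff x s _).2 (hbt s h),
      fun j hj => (smul_chainGen_eq_zero_iff x s _).2 (hbm s j hj)⟩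
  · exact fun j => (smul_chainGen_eq_zero_iff x s _).2 (hl s j)
  · exact fun j => (smul_chainGen_eq_zero_iff x s _).2 (hw s j)
  · exact fun h => hs s ((smul_chainGen_eq_zero_iff x s _).1 h)

end Criteria

section Consequences

variable {M : Type w} [AddCommGroup M] [Module (QHAlg C) M]

/-- A module with a `Δ`-good filtration has only copies of `S(1)` in its socle. -/
theorem e_bot_smul_of_hasFiltration {c : Vtx m → ℕ}
    (h : HasFiltration (QHAlg C) (StdModule (e C)) M c) (x : M) (h1 : ∀ j, mb C j • x = 0)
    (h3 : ∀ j, tm C j • x = 0) : e C .bot • x = x := by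
  obtain ⟨t, F, label, h0, ht, hmono, hiso, -⟩ := h
  have key : ∀ s : Fin (t + 1), ∀ x ∈ F s, (∀ j, mb C j • x = 0) → (∀ j, tm C j • x = 0) →
      e C .bot • x = x := by
    intro s
    induction s using Fin.induction with
    | zero =>
      intro x hx _ _
      rw [h0, Submodule.mem_bot] at hx
      rw [hx, smul_zero]
    | succ s ih =>
      intro x hx h1 h3
      obtain ⟨E⟩ := hiso s
      let q : F s.succ ⧸ (F s.castSucc).submoduleOf (F s.succ) := Submodule.Quotient.mk ⟨x, hx⟩
      have hq : ∀ a : QHAlg C, a • x = 0 → a • E q = 0 := fun a ha => by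
        have : a • q = 0 := by
          change Submodule.Quotient.mk (a • (⟨x, hx⟩ : F s.succ)) = _
          rw [Submodule.Quotient.mk_eq_zero]
          change a • x ∈ F s.castSucc
          rw [ha]
          exact Submodule.zero_mem _
        rw [← map_smul, this, map_zero]
      have h4 : e C .bot • q = q := E.injective <| by
        rw [map_smul]
        exact e_bot_smul_of_stdModule C _ _ (fun j => hq _ (h1 j)) (fun j => hq _ (h3 j))
      have h5 : e C .bot • x - x ∈ F s.castSucc := by
        have h6 : Submodule.Quotient.mk (e C .bot • ⟨x, hx⟩) = q := h4
        rw [Submodule.Quotient.eq] at h6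
        exact h6
      -- The defect `e_1 x - x` lies one step lower and is again killed by the arrows in question.
      -- By induction `e_1` fixes it, while `e_1` obviously kills it.
      have h7 := ih _ h5 (fun j => by rw [smul_sub, ← mul_smul, h1]; simp)
        (fun j => by rw [smul_sub, ← mul_smul, h3, tm_mul_e]; simp)
      rw [smul_sub, ← mul_smul, e_mul_self, sub_self] at h7
      exact sub_eq_zero.1 h7.symm
  exact key (Fin.last t) x (ht ▸ Submodule.mem_top) h1 h3

/-- A cyclic submodule of `A e_1` whose vertices are all `≤ k` maps to `∇(k)` through a functional.
The generators `ll`, a row of `C⁻¹` applied to the loops, and `e_1` provide an element with the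
required nonzero value. -/
theorem exists_mem_costdModule_ne_zero (hC : IsUnit C) (k : Vtx m) :
    ∃ g ∈ costdModule K (e C) k, g (costdTop C k) ≠ 0 := by
  have key : ∀ x : QHAlg C, e C .bot • x = x → CostdRel C x k → costdTop C k • x ≠ 0 →
      ∃ g ∈ costdModule K (e C) k, g (costdTop C k) ≠ 0 := by
    intro x hx h hs
    let Q := Submodule.span (QHAlg C) {x}
    let x' : Q := ⟨x, Submodule.mem_span_singleton_self x⟩
    have hs' : costdTop C k • x' ≠ 0 := fun h0 => hs (congrArg Subtype.val h0)
    obtain ⟨φ, hφ⟩ := exists_dual_ne_zero (K := K) (Q := Q) hs'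
    refine ⟨dualMap C φ k x', dualMap_mem φ (fun l hl q => ?_) x', ?_⟩
    · obtain ⟨q, hq⟩ := q
      obtain ⟨a, rfl⟩ := Submodule.mem_span_singleton.1 hq
      exact Subtype.ext (e_smul_eq_zero_of_costdRel hx h hl a)
    · rwa [dualMap_apply, e_mul_costdTop]
  have hw0 : ∀ j, wm C j ≠ 0 := fun j h => ll_ne_zero C <| by
    rw [← (by simp : mb C j * wm C j = ll C), h, mul_zero]
  rcases k with _ | i | _
  · exact key (ll C) (by simp) ⟨fun _ => by simp, fun j _ => by simp⟩
      (by simpa [costdTop] using ll_ne_zero C)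
  -- The row `i` of `C⁻¹` is chosen so that `C⁻¹ C = 1` makes every arrow `1 → k` with `k ≠ i`
  -- vanish on this element.
  · have hbm : ∀ k, bm C k * ∑ j, C⁻¹ i j • loop C j = (1 : Matrix (Fin m) (Fin m) K) i k • wm C k := by
      intro k
      rw [← Matrix.nonsing_inv_mul C ((Matrix.isUnit_iff_isUnit_det C).1 hC), Matrix.mul_apply,
        Finset.sum_smul, Finset.mul_sum]
      exact Finset.sum_congr rfl fun j _ => by simp [mul_smul]
    refine key (∑ j, C⁻¹ i j • loop C j) (by simp [Finset.mul_sum])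
      ⟨fun _ => by simp [Finset.mul_sum], fun j hj => ?_⟩ ?_
    · have hj : j ≠ i := by simpa using hj
      rw [smul_eq_mul, hbm, Matrix.one_apply_ne hj.symm, zero_smul]
    · rw [costdTop, smul_eq_mul, hbm, Matrix.one_apply_eq, one_smul]
      exact hw0 i
  · refine key (e C .bot) (by simp) ⟨fun h => absurd rfl h, fun j hj => absurd (by simp) hj⟩ ?_
    have : bt C ≠ 0 := fun h => hw0 0 (by rw [wm, h, mul_zero])
    simpa [costdTop] using this

/-- A module with a `∇`-good filtration is generated by its component at the vertex `1`. -/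
theorem span_e_bot_of_hasFiltration (hC : IsUnit C) {c : Vtx m → ℕ}
    (h : HasFiltration (QHAlg C) (fun k => costdModule K (e C) k) M c) :
    Submodule.span (QHAlg C) {x : M | e C .bot • x = x} = ⊤ := by
  obtain ⟨t, F, label, h0, ht, hmono, hiso, -⟩ := h
  have key : ∀ s : Fin (t + 1), F s ≤ Submodule.span (QHAlg C) {x : M | e C .bot • x = x} := by
    intro s
    induction s using Fin.induction with
    | zero => rw [h0]; exact bot_le
    | succ s ih =>
      intro x hx
      obtain ⟨E⟩ := hiso s
      let q : F s.succ ⧸ (F s.castSucc).submoduleOf (F s.succ) := Submodule.Quotient.mk ⟨x, hx⟩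
      obtain ⟨g, hg, hg0⟩ := exists_mem_costdModule_ne_zero hC (label s)
      obtain ⟨a, ha⟩ := exists_smul_eq_of_mem_costdModule (E q).2 hg hg0
      obtain ⟨⟨y, hy⟩, hy'⟩ := Submodule.Quotient.mk_surjective _ (E.symm ⟨g, hg⟩)
      have h1 : q = (a * e C .bot) • Submodule.Quotient.mk ⟨y, hy⟩ := E.injective <| by
        rw [hy', map_smul, E.apply_symm_apply]
        exact Subtype.ext ha
      have h2 : x - (a * e C .bot) • y ∈ F s.castSucc := by
        have h3 : q = Submodule.Quotient.mk ((a * e C .bot) • ⟨y, hy⟩) := h1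
        rw [Submodule.Quotient.eq] at h3
        exact h3
      have h4 : (a * e C .bot) • y ∈ Submodule.span (QHAlg C) {x : M | e C .bot • x = x} := by
        rw [mul_smul]
        refine Submodule.smul_mem _ a (Submodule.subset_span ?_)
        change e C .bot • e C .bot • y = _
        rw [← mul_smul, e_mul_self]
      simpa using Submodule.add_mem _ (ih h2) h4
  rw [eq_top_iff, ← ht]
  exact key _

end Consequences

end QHAlg

/-! ### The elements `t(i)` and their products. -/

namespace QHAlg

variable {K : Type u} [Field K] {m : ℕ}

section TiltLoop

variable (C : GL (Fin m) K)

/-- The element `∑_j d_{ij} (1 j 1)`, where `(d_{ij}) = C⁻¹`. -/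
noncomputable def tiltLoop (i : Fin m) : QHAlg C.val := ∑ j, C⁻¹.val i j • loop C.val j

theorem tiltGen_mid (hm : 0 < m) (i : Fin m) : tiltGen hm C (.mid i) = tiltLoop C i := rfl

theorem tiltGen_top (hm : 0 < m) : tiltGen hm C .top = e C.val .bot := rfl

theorem loop_eq_sum (j : Fin m) : loop C.val j = ∑ k, C.val j k • tiltLoop C k := by
  have h : ∀ l, ∑ k, C.val j k * C⁻¹.val k l = if j = l then 1 else 0 := fun l => by
    rw [← Matrix.mul_apply, Units.mul_inv, Matrix.one_apply]
  simp only [tiltLoop, Finset.smul_sum, smul_smul]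
  rw [Finset.sum_comm]
  simp only [← Finset.sum_smul, h, ite_smul, one_smul, zero_smul, Finset.sum_ite_eq,
    Finset.mem_univ, if_true]

@[simp] theorem e_mul_tiltLoop (v : Vtx m) (i : Fin m) :
    e C.val v * tiltLoop C i = if v = .bot then tiltLoop C i else 0 := by
  simp only [tiltLoop, Finset.mul_sum, mul_smul_comm, e_mul_loop]
  split_ifs <;> simp
@[simp] theorem tiltLoop_mul_e (v : Vtx m) (i : Fin m) :
    tiltLoop C i * e C.val v = if v = .bot then tiltLoop C i else 0 := by
  simp only [tiltLoop, Finset.sum_mul, smul_mul_assoc, loop_mul_e]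
  split_ifs <;> simp
@[simp] theorem mb_mul_tiltLoop (j i : Fin m) : mb C.val j * tiltLoop C i = 0 := by
  simp [tiltLoop, Finset.mul_sum]
@[simp] theorem mt_mul_tiltLoop (j i : Fin m) : mt C.val j * tiltLoop C i = 0 := by
  simp [tiltLoop, Finset.mul_sum]
@[simp] theorem tm_mul_tiltLoop (j i : Fin m) : tm C.val j * tiltLoop C i = 0 := by
  simp [tiltLoop, Finset.mul_sum]

theorem coord_tiltLoop (i : Fin m) : coord C.val (tiltLoop C i) = (0, 0, C⁻¹.val i, 0, 0, 0) := by
  simp [tiltLoop, Prod.ext_iff, Prod.fst_sum, Prod.snd_sum, ← Pi.single_smul,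
    Finset.univ_sum_single]

variable [NeZero m]

theorem tiltGen_bot (hm : 0 < m) : tiltGen hm C .bot = ll C.val := longLoop_eq _ _

-- From `C⁻¹ C = 1`: the `t(i)` form the basis of the loops dual to the arrows `1 → j`. Thus only
-- one arrow continues `t(i)`, which makes `A t(i)` uniserial.
@[simp] theorem bm_mul_tiltLoop (j i : Fin m) :
    bm C.val j * tiltLoop C i = if i = j then wm C.val j else 0 := by
  have h : ∑ k, C⁻¹.val i k * C.val k j = if i = j then 1 else 0 := by
    rw [← Matrix.mul_apply, Units.inv_mul, Matrix.one_apply]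
  simp only [tiltLoop, Finset.mul_sum, mul_smul_comm, bm_mul_loop, smul_smul, ← Finset.sum_smul, h]
  split_ifs <;> simp
@[simp] theorem bt_mul_tiltLoop (i : Fin m) : bt C.val * tiltLoop C i = 0 := by
  simp [tiltLoop, Finset.mul_sum]
@[simp] theorem loop_mul_tiltLoop (j i : Fin m) :
    loop C.val j * tiltLoop C i = if i = j then ll C.val else 0 := by
  rw [loop_eq, mul_assoc, bm_mul_tiltLoop]; split_ifs <;> simp
@[simp] theorem wm_mul_tiltLoop (j i : Fin m) : wm C.val j * tiltLoop C i = 0 := by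
  rw [wm, mul_assoc, bt_mul_tiltLoop, mul_zero]
@[simp] theorem ll_mul_tiltLoop (i : Fin m) : ll C.val * tiltLoop C i = 0 := by
  rw [ll, mul_assoc, bt_mul_tiltLoop, mul_zero]
@[simp] theorem tiltLoop_mul_ll (i : Fin m) : tiltLoop C i * ll C.val = 0 := by
  simp [tiltLoop, Finset.sum_mul]
-- Expanding only the left factor gives `∑_k d_{ik} (1 k 1) t(j)`, and `(1 k 1) t(j)` is `ll` for `k
-- = j` and zero otherwise.
@[simp] theorem tiltLoop_mul_tiltLoop (i j : Fin m) :
    tiltLoop C i * tiltLoop C j = C⁻¹.val i j • ll C.val := by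
  conv_lhs => rw [tiltLoop.eq_1 C i]
  simp [Finset.sum_mul]

theorem wm_ne_zero (j : Fin m) : wm C.val j ≠ 0 := fun h => ll_ne_zero C.val <| by
  rw [← (by simp : mb C.val j * wm C.val j = ll C.val), h, mul_zero]

theorem bt_ne_zero : bt C.val ≠ 0 := fun h => wm_ne_zero C 0 (by rw [wm, h, mul_zero])

end TiltLoop

/-! ### Left ideals cut out by coordinates, used to separate generators. -/

section CoordIdeal

variable {C : Matrix (Fin m) (Fin m) K}

/-- The left ideal of elements whose coordinates lie in a subrepresentation of `A e_1`. -/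
noncomputable def coordIdeal (W : Submodule K (Coord K m)) (hv : ∀ v, ∀ p ∈ W, rep C (e C v) p ∈ W)
    (h1 : ∀ j, ∀ p ∈ W, rep C (bm C j) p ∈ W) (h2 : ∀ j, ∀ p ∈ W, rep C (mb C j) p ∈ W)
    (h3 : ∀ j, ∀ p ∈ W, rep C (mt C j) p ∈ W) (h4 : ∀ j, ∀ p ∈ W, rep C (tm C j) p ∈ W) :
    Submodule (QHAlg C) (QHAlg C) :=
  { (W.comap (coord C)).toAddSubmonoid with
    smul_mem' := by
      have := mul_mem_of_gen C (W.comap (coord C))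
        (fun v x hx => by simpa [coord_mul] using hv v _ hx)
        (fun v x hx => by simpa [coord_mul] using h1 v _ hx)
        (fun v x hx => by simpa [coord_mul] using h2 v _ hx)
        (fun v x hx => by simpa [coord_mul] using h3 v _ hx)
        (fun v x hx => by simpa [coord_mul] using h4 v _ hx)
      exact fun a x hx => this a x hx }

theorem mem_coordIdeal {W : Submodule K (Coord K m)} {hv h1 h2 h3 h4} {a : QHAlg C} :
    a ∈ coordIdeal (C := C) W hv h1 h2 h3 h4 ↔ coord C a ∈ W := Iff.rfl

variable (C) in
/-- Elements without `e_1`-, `(1 i)`- and `(1 i 1)`-coordinates. -/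
noncomputable def avoidLoopIdeal (i : Fin m) : Submodule (QHAlg C) (QHAlg C) :=
  coordIdeal (C := C)
    { carrier := {p | p.1 = 0 ∧ p.2.1 i = 0 ∧ p.2.2.1 i = 0}
      zero_mem' := by simp
      add_mem' := fun {p q} hp hq => by simp_all
      smul_mem' := fun r p hp => by simp_all }
    (by
      rintro (_ | j | _) p ⟨h1, h2, h3⟩ <;>
        simp [rep_e_bot, rep_e_mid, rep_e_top, h1, h3, Pi.single_apply]
      rintro rfl; exact h2)
    (by rintro j p ⟨h1, h2, h3⟩; simp [rep_bm, h1])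
    (by rintro j p ⟨h1, h2, h3⟩; simp [rep_mb, Pi.single_apply]; rintro rfl; exact h2)
    (by rintro j p ⟨h1, h2, h3⟩; simp [rep_mt])
    (by rintro j p ⟨h1, h2, h3⟩; simp [rep_tm])

variable (C) in
/-- Elements without `e_1`-coordinate. -/
noncomputable def avoidOneIdeal : Submodule (QHAlg C) (QHAlg C) :=
  coordIdeal (C := C)
    { carrier := {p | p.1 = 0}
      zero_mem' := by simp
      add_mem' := fun {p q} hp hq => by simp_all
      smul_mem' := fun r p hp => by simp_all }
    (by rintro (_ | j | _) p h <;> simp_all [rep_e_bot, rep_e_mid, rep_e_top])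
    (by rintro j p h; simp [rep_bm])
    (by rintro j p h; simp [rep_mb])
    (by rintro j p h; simp [rep_mt])
    (by rintro j p h; simp [rep_tm])

variable (C) in
/-- Elements without `e_1`-, `(1 j)`- and `(1 j n)`-coordinates. -/
noncomputable def loopIdeal : Submodule (QHAlg C) (QHAlg C) :=
  coordIdeal (C := C)
    { carrier := {p | p.1 = 0 ∧ p.2.1 = 0 ∧ p.2.2.2.1 = 0}
      zero_mem' := by simp
      add_mem' := fun {p q} hp hq => by simp_all
      smul_mem' := fun r p hp => by simp_all }
    (by rintro (_ | j | _) p ⟨h1, h2, h3⟩ <;>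
      simp [rep_e_bot, rep_e_mid, rep_e_top, h1, h2, h3])
    (by rintro j p ⟨h1, h2, h3⟩; simp [rep_bm, h1])
    (by rintro j p ⟨h1, h2, h3⟩; simp [rep_mb])
    (by rintro j p ⟨h1, h2, h3⟩; simp [rep_mt, h2])
    (by rintro j p ⟨h1, h2, h3⟩; simp [rep_tm])

variable (C) in
/-- Elements of the span of the `(1 j 1)`, `(1 k n j)` and `(1 j n j 1)` that `(1 i)` annihilates
and that have no `(1 k n i)`-coordinate. -/
noncomputable def avoidTiltIdeal (i : Fin m) : Submodule (QHAlg C) (QHAlg C) :=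
  coordIdeal (C := C)
    { carrier := {p | (p.1 = 0 ∧ p.2.1 = 0 ∧ p.2.2.2.1 = 0) ∧ ∑ k, p.2.2.1 k * C k i = 0 ∧
        p.2.2.2.2.1 i = 0}
      zero_mem' := by simp
      add_mem' := fun {p q} hp hq => by simp_all [add_mul, Finset.sum_add_distrib]
      smul_mem' := fun r p hp => by simp_all [mul_assoc, ← Finset.mul_sum] }
    (by
      rintro (_ | j | _) p ⟨⟨h1, h2, h3⟩, h4, h5⟩ <;>
        simp [rep_e_bot, rep_e_mid, rep_e_top, h1, h2, h3, h4, Pi.single_apply]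
      rintro rfl; exact h5)
    (by rintro j p ⟨⟨h1, h2, h3⟩, h4, h5⟩; simp [rep_bm, h1, Pi.single_apply]; rintro rfl; exact h4)
    (by rintro j p ⟨⟨h1, h2, h3⟩, h4, h5⟩; simp [rep_mb, h2])
    (by rintro j p ⟨⟨h1, h2, h3⟩, h4, h5⟩; simp [rep_mt, h2])
    (by rintro j p ⟨⟨h1, h2, h3⟩, h4, h5⟩; simp [rep_tm, h3])

end CoordIdeal

/-! ### The order in which the vertices label the filtration steps of `T(n)`. -/

section Label

variable {m : ℕ}

/-- The vertices in the order `n, 2, …, n - 1, 1`. -/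
def downLabel (m : ℕ) (s : Fin (m + 2)) : Vtx m :=
  -- Position `0` is treated first, so the truncated subtraction is an honest one.
  if s.val = 0 then .top else if h : s.val - 1 < m then .mid ⟨s.val - 1, h⟩ else .bot

/-- The vertices in the order `1, 2, …, n - 1, n`. -/
def upLabel (m : ℕ) (s : Fin (m + 2)) : Vtx m := (downLabel m s).swap

/-- The position of a vertex in the order `n, 2, …, n - 1, 1`. -/
def downIndex : Vtx m → Fin (m + 2)
  | .top => ⟨0, by omega⟩
  | .mid i => ⟨i.val + 1, by omega⟩
  | .bot => ⟨m + 1, by omega⟩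

@[simp] theorem downLabel_downIndex (v : Vtx m) : downLabel m (downIndex v) = v := by
  rcases v with _ | i | _ <;> simp [downLabel, downIndex]

@[simp] theorem downIndex_downLabel (s : Fin (m + 2)) : downIndex (downLabel m s) = s := by
  unfold downLabel
  split_ifs with h h'
  · exact Fin.ext h.symm
  · exact Fin.ext (by simp [downIndex]; omega)
  · exact Fin.ext (by simp [downIndex]; omega)

theorem _root_.Vtx.swap_swap (v : Vtx m) : v.swap.swap = v := by cases v <;> rfl

@[simp] theorem upLabel_downIndex (v : Vtx m) : upLabel m (downIndex v.swap) = v := by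
  rw [upLabel, downLabel_downIndex, Vtx.swap_swap]

theorem card_downLabel (j : Vtx m) : Nat.card {s // downLabel m s = j} = 1 := by
  rw [Nat.card_eq_one_iff_unique]
  refine ⟨⟨fun a b => Subtype.ext ?_⟩, ⟨⟨downIndex j, downLabel_downIndex j⟩⟩⟩
  rw [← downIndex_downLabel a.1, ← downIndex_downLabel b.1, a.2, b.2]

theorem card_upLabel (j : Vtx m) : Nat.card {s // upLabel m s = j} = 1 := by
  rw [← card_downLabel j.swap]
  refine Nat.card_congr (Equiv.subtypeEquivRight fun s => ?_)
  rw [upLabel]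
  exact ⟨fun h => by rw [← h, Vtx.swap_swap], fun h => by rw [h, Vtx.swap_swap]⟩

end Label

end QHAlg

/-! ### Existence: the modules `A t(i)` are tilting modules. -/

namespace QHAlg

variable {K : Type u} [Field K] {m : ℕ}

section Chains

variable {C : Matrix (Fin m) (Fin m) K} (gen : Vtx m → QHAlg C)

theorem forall_downIndex {p : Fin (m + 2) → Prop} (h : ∀ v, p (downIndex v)) (s) : p s := by
  rw [← downIndex_downLabel s]; exact h _

theorem forall_downIndex_swap {p : Fin (m + 2) → Prop} (h : ∀ v : Vtx m, p (downIndex v.swap))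
    (s) : p s := forall_downIndex (fun v => by rw [← Vtx.swap_swap v]; exact h _) s

theorem mem_genChain_down {v : Vtx m} {s : ℕ} (h : (downIndex v).val < s) :
    gen v ∈ genChain (A := QHAlg C) (fun s => gen (downLabel m s)) s := by
  have := mem_genChain (A := QHAlg C) (fun s => gen (downLabel m s)) (downIndex v) h
  rwa [downLabel_downIndex] at this

theorem genChain_down_le {s : ℕ} {N : Submodule (QHAlg C) (QHAlg C)}
    (h : ∀ v : Vtx m, (downIndex v).val < s → gen v ∈ N) :
    genChain (fun s => gen (downLabel m s)) s ≤ N :=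
  genChain_le _ (forall_downIndex fun v hv => by rw [downLabel_downIndex]; exact h v hv)

theorem mem_genChain_up {v : Vtx m} {s : ℕ} (h : (downIndex v.swap).val < s) :
    gen v ∈ genChain (A := QHAlg C) (fun s => gen (upLabel m s)) s := by
  have := mem_genChain (A := QHAlg C) (fun s => gen (upLabel m s)) (downIndex v.swap) h
  rwa [upLabel_downIndex] at this

theorem genChain_up_le {s : ℕ} {N : Submodule (QHAlg C) (QHAlg C)}
    (h : ∀ v : Vtx m, (downIndex v.swap).val < s → gen v ∈ N) :
    genChain (fun s => gen (upLabel m s)) s ≤ N :=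
  genChain_le _ (forall_downIndex_swap fun v hv => by rw [upLabel_downIndex]; exact h v hv)

end Chains

section Multiplicity

variable {C : Matrix (Fin m) (Fin m) K} {S : Submodule (QHAlg C) (QHAlg C)} {k : Vtx m}

theorem jhMult_eq_zero_of_forall (h : ∀ x ∈ S, e C k * x = 0) : jhMult K (e C) k S = 0 := by
  have : LinearMap.range (Algebra.lsmul K K S (e C k)) = ⊥ := by
    rw [LinearMap.range_eq_bot]
    exact LinearMap.ext fun x => Subtype.ext (h x x.2)
  rw [jhMult, this, finrank_bot]

theorem jhMult_eq_one_of_forall {y : QHAlg C} (hy : y ∈ S) (hey : e C k * y = y) (h0 : y ≠ 0)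
    (h : ∀ x ∈ S, ∃ c : K, e C k * x = c • y) : jhMult K (e C) k S = 1 := by
  rw [jhMult]
  refine finrank_eq_one ⟨⟨y, hy⟩, ⟨⟨y, hy⟩, Subtype.ext hey⟩⟩ ?_ ?_
  · intro h
    exact h0 (congrArg (fun z => (z.1.1 : QHAlg C)) h)
  · rintro ⟨_, ⟨x, rfl⟩⟩
    obtain ⟨c, hc⟩ := h x x.2
    exact ⟨c, Subtype.ext (Subtype.ext hc.symm)⟩

end Multiplicity

section Generated

variable [NeZero m] {C : Matrix (Fin m) (Fin m) K}

theorem exists_ofCoord_mul {t x : QHAlg C} (ht : e C .bot * t = t)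
    (hx : x ∈ Submodule.span (QHAlg C) {t}) : ∃ p, x = ofCoord C p * t := by
  obtain ⟨a, rfl⟩ := Submodule.mem_span_singleton.1 hx
  obtain ⟨p, hp⟩ := exists_mul_e_bot C a
  exact ⟨p, by rw [← hp, mul_assoc, ht]; rfl⟩

/-- Two nonzero submodules both contain `ll`, so they cannot be complementary. -/
theorem isIndecomposableModule_span (hC : IsUnit C) {t : QHAlg C} (ht : t * e C .bot = t)
    (h0 : t ≠ 0) : IsIndecomposableModule (QHAlg C) (Submodule.span (QHAlg C) {t}) := by
  refine ⟨⟨⟨0, ⟨t, Submodule.mem_span_singleton_self t⟩, fun h => h0 (congrArg Subtype.val h).symm⟩⟩,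
    fun N N' h => ?_⟩
  by_contra! hne
  have key : ∀ N : Submodule (QHAlg C) (Submodule.span (QHAlg C) {t}), N ≠ ⊥ →
      ∃ y ∈ N, (y : QHAlg C) = ll C := by
    intro N hN
    obtain ⟨x, hx, hx0⟩ := Submodule.exists_mem_ne_zero_of_ne_bot hN
    have hxe : (x : QHAlg C) * e C .bot = x := by
      obtain ⟨a, ha⟩ := Submodule.mem_span_singleton.1 x.2
      rw [← ha, smul_mul_assoc, ht]
    obtain ⟨b, hb⟩ := exists_mul_eq_ll C hC hxe (fun h => hx0 (Subtype.ext h))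
    exact ⟨b • x, N.smul_mem b hx, hb⟩
  obtain ⟨y, hy, hyl⟩ := key N hne.1
  obtain ⟨z, hz, hzl⟩ := key N' hne.2
  have hyz : y = z := Subtype.ext (hyl.trans hzl.symm)
  have : y ∈ N ⊓ N' := ⟨hy, hyz ▸ hz⟩
  rw [h.inf_eq_bot, Submodule.mem_bot] at this
  exact ll_ne_zero C (by rw [← hyl, this]; rfl)

@[simp] theorem wm_mul_ll (j : Fin m) : wm C j * ll C = 0 := by
  rw [wm, mul_assoc, bt_mul_ll, mul_zero]

theorem ofCoord_mul_ll (p : Coord K m) : ofCoord C p * ll C = p.1 • ll C := by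
  simp [ofCoord_apply, add_mul, Finset.sum_mul]

theorem ofCoord_mul_tiltLoop (C : GL (Fin m) K) (p : Coord K m) (i : Fin m) :
    ofCoord C.val p * tiltLoop C i =
      p.1 • tiltLoop C i + p.2.1 i • wm C.val i + p.2.2.1 i • ll C.val := by
  simp [ofCoord_apply, add_mul, Finset.sum_mul]

end Generated

section Existence

variable [NeZero m] (C : GL (Fin m) K)

/-- Generators of the `Δ`-good filtration of `A e_1`. -/
noncomputable def stdChainGen : Vtx m → QHAlg C.val
  | .bot => e C.val .bot
  | .mid i => bm C.val i
  | .top => bt C.val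

theorem genChain_std_top :
    genChain (A := QHAlg C.val) (fun s => stdChainGen C (downLabel m s)) (m + 2) =
      Submodule.span (QHAlg C.val) {e C.val .bot} := by
  apply le_antisymm
  · refine genChain_down_le _ fun v _ => Submodule.mem_span_singleton.2 ⟨stdChainGen C v, ?_⟩
    rcases v with _ | i | _ <;> simp [stdChainGen]
  · rw [Submodule.span_singleton_le_iff_mem]
    exact mem_genChain_down (stdChainGen C) (v := .bot) (by simp [downIndex])

/-- The chain adds the generators `(1 j n)`, then the `(1 i)`, then `e_1`, with subquotients `Δ(n)`,
the `Δ(i)` and `Δ(1)`. That each socle path is new follows from a coordinate which all earlier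
generators, hence the left ideal they generate, lack. -/
theorem hasFiltration_std_top : HasFiltration (QHAlg C.val) (StdModule (e C.val))
    (Submodule.span (QHAlg C.val) {e C.val .bot}) (fun _ => 1) := by
  have h := hasFiltration_stdModule (C := C.val) (fun s => stdChainGen C (downLabel m s))
    (downLabel m) ?_ ?_ ?_ ?_
  · rw [← genChain_std_top]
    simpa only [card_downLabel] using h
  · refine forall_downIndex fun v => ?_
    rw [downLabel_downIndex]
    rcases v with _ | i | _ <;> simp [stdChainGen]
  · refine forall_downIndex fun v => ?_
    rw [downLabel_downIndex]
    rintro rfl j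
    have := mem_genChain_down (stdChainGen C) (v := .mid j) (s := downIndex (Vtx.bot (m := m)))
      (by simp [downIndex])
    simpa [stdChainGen] using this
  · refine forall_downIndex fun v => ?_
    rw [downLabel_downIndex]
    rintro i rfl
    have := mem_genChain_down (stdChainGen C) (v := .top) (s := downIndex (Vtx.mid i))
      (by simp [downIndex])
    simpa [stdChainGen] using this
  · refine forall_downIndex fun v => ?_
    rw [downLabel_downIndex]
    rcases v with _ | i | _
    · intro h
      have := genChain_down_le (stdChainGen C) (N := avoidOneIdeal C.val) ?_ h
      · have this : (coord C.val (e C.val .bot * e C.val .bot)).1 = 0 := this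
        simp at this
      · intro v hv
        change (coord C.val (stdChainGen C v)).1 = 0
        rcases v with _ | i | _ <;> simp [downIndex, stdChainGen] at hv ⊢
    · intro h
      have := genChain_down_le (stdChainGen C) (N := avoidLoopIdeal C.val i) ?_ h
      · have this := this.2.2
        simp [stdSocle, stdChainGen] at this
      · intro v hv
        rw [avoidLoopIdeal, mem_coordIdeal]
        change _ ∧ _
        rcases v with _ | j | _ <;> simp [downIndex, stdChainGen] at hv ⊢
        · omega
        · rw [Pi.single_eq_of_ne]
          exact hv.ne'
    · intro h
      have := genChain_down_le (stdChainGen C) (N := ⊥) (fun v hv => by simp [downIndex] at hv) h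
      simp [stdSocle, stdChainGen, ll_ne_zero] at this

/-- Generators of the `∇`-good filtration of `A e_1`. -/
noncomputable def costdChainGen : Vtx m → QHAlg C.val
  | .bot => ll C.val
  | .mid i => tiltLoop C i
  | .top => e C.val .bot

theorem genChain_costd_top :
    genChain (A := QHAlg C.val) (fun s => costdChainGen C (upLabel m s)) (m + 2) =
      Submodule.span (QHAlg C.val) {e C.val .bot} := by
  apply le_antisymm
  · refine genChain_up_le _ fun v _ => Submodule.mem_span_singleton.2 ⟨costdChainGen C v, ?_⟩
    rcases v with _ | i | _ <;> simp [costdChainGen]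
  · rw [Submodule.span_singleton_le_iff_mem]
    exact mem_genChain_up (costdChainGen C) (v := .top) (by simp [downIndex, Vtx.swap])

/-- The chain adds `ll`, then the `t(i)`, then `e_1`, with subquotients `∇(1)`, the `∇(i)` and
`∇(n)`. Using `t(i)` in place of `(1 i 1)` ensures that the only arrow `1 → j` out of the middle
generator is the one with `j = i`. -/
theorem hasFiltration_costd_top : HasFiltration (QHAlg C.val) (fun j => costdModule K (e C.val) j)
    (Submodule.span (QHAlg C.val) {e C.val .bot}) (fun _ => 1) := by
  have hw : ∀ (s : ℕ) (i : Fin m), i.val + 1 < s →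
      wm C.val i ∈ genChain (A := QHAlg C.val) (fun s => costdChainGen C (upLabel m s)) s := by
    intro s i hi
    have := Submodule.smul_mem _ (bm C.val i) (mem_genChain_up (costdChainGen C) (v := .mid i) hi)
    simpa [costdChainGen] using this
  have h := hasFiltration_costdModule (C := C.val) (fun s => costdChainGen C (upLabel m s))
    (upLabel m) ?_ ?_ ?_ ?_ ?_ ?_
  · rw [← genChain_costd_top]
    simpa only [card_upLabel] using h
  · refine forall_downIndex_swap fun v => ?_
    rw [upLabel_downIndex]
    rcases v with _ | i | _ <;> simp [costdChainGen]
  · refine forall_downIndex_swap fun v => ?_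
    rw [upLabel_downIndex]
    rcases v with _ | i | _ <;> simp [costdChainGen]
  · refine forall_downIndex_swap fun v j => ?_
    rw [upLabel_downIndex]
    rcases v with _ | i | _ <;> simp [costdChainGen]
    intro h
    rw [if_neg (Ne.symm h)]
    exact Submodule.zero_mem _
  · refine forall_downIndex_swap fun v j => ?_
    rw [upLabel_downIndex]
    rcases v with _ | i | _
    · simp [costdChainGen]
    · have := mem_genChain_up (costdChainGen C) (v := .bot)
        (s := downIndex (Vtx.mid i).swap) (by simp [downIndex, Vtx.swap])
      simp only [costdChainGen, smul_eq_mul, loop_mul_tiltLoop]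
      split_ifs
      · exact this
      · exact Submodule.zero_mem _
    · simp only [costdChainGen, smul_eq_mul, loop_mul_e, if_true]
      rw [loop_eq_sum]
      refine Submodule.sum_mem _ fun k _ => ?_
      rw [← algebraMap_smul (QHAlg C.val)]
      exact Submodule.smul_mem _ _ (mem_genChain_up (costdChainGen C) (v := .mid k)
        (by simp [downIndex, Vtx.swap]))
  · refine forall_downIndex_swap fun v j => ?_
    rw [upLabel_downIndex]
    rcases v with _ | i | _
    · simp [costdChainGen]
    · simp [costdChainGen]
    · simp only [costdChainGen, smul_eq_mul, wm_mul_e, if_true]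
      exact hw _ j (by simp [downIndex, Vtx.swap])
  · refine forall_downIndex_swap fun v => ?_
    rw [upLabel_downIndex]
    rcases v with _ | i | _
    · intro h
      have := genChain_up_le (costdChainGen C) (N := ⊥)
        (fun v hv => by simp [downIndex, Vtx.swap] at hv) h
      simp [costdTop, costdChainGen, ll_ne_zero] at this
    · intro h
      have := genChain_up_le (costdChainGen C) (N := avoidTiltIdeal C.val i) ?_ h
      · have this := this.2.2
        simp [costdTop, costdChainGen] at this
      · intro v hv
        rw [avoidTiltIdeal, mem_coordIdeal]
        change _ ∧ _
        rcases v with _ | j | _ <;> simp [downIndex, costdChainGen, Vtx.swap, coord_tiltLoop] at hv ⊢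
        -- An earlier `t(j)` has `j ≠ i`, and its loop coordinates are row `j` of `C⁻¹`; membership
        -- is the off-diagonal entry of `C⁻¹ C`.
        · have : (C⁻¹.val * C.val) j i = 0 := by
            rw [Units.inv_mul, Matrix.one_apply_ne (by rintro rfl; omega)]
          simpa [Matrix.mul_apply] using this
        · omega
    · intro h
      have := genChain_up_le (costdChainGen C) (N := loopIdeal C.val) ?_ h
      · have this := this.2.2
        simp [costdTop, costdChainGen] at this
      · intro v hv
        rw [loopIdeal, mem_coordIdeal]
        change _ ∧ _
        rcases v with _ | j | _ <;> simp [downIndex, costdChainGen, Vtx.swap, coord_tiltLoop] at hv ⊢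

theorem genChain_std_mid (i : Fin m) :
    genChain (A := QHAlg C.val) ![wm C.val i, tiltLoop C i] 2 =
      Submodule.span (QHAlg C.val) {tiltLoop C i} := by
  apply le_antisymm
  · refine genChain_le _ fun r _ => Submodule.mem_span_singleton.2 ?_
    fin_cases r
    · exact ⟨bm C.val i, by simp⟩
    · exact ⟨1, by simp⟩
  · rw [Submodule.span_singleton_le_iff_mem]
    exact mem_genChain (A := QHAlg C.val) ![wm C.val i, tiltLoop C i] 1 (by simp)

theorem card_pair {V : Type} {a b : V} (hab : a ≠ b) (j : V) (hj : j = a ∨ j = b) :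
    Nat.card {s : Fin 2 // ![a, b] s = j} = 1 := by
  rw [Nat.card_eq_one_iff_unique]
  rcases hj with rfl | rfl
  · refine ⟨⟨fun ⟨s, hs⟩ ⟨t, ht⟩ => Subtype.ext ?_⟩, ⟨⟨0, rfl⟩⟩⟩
    fin_cases s <;> fin_cases t <;> first
      | rfl
      | exact absurd hs hab.symm
      | exact absurd ht hab.symm
  · refine ⟨⟨fun ⟨s, hs⟩ ⟨t, ht⟩ => Subtype.ext ?_⟩, ⟨⟨1, rfl⟩⟩⟩
    fin_cases s <;> fin_cases t <;> first
      | rfl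
      | exact absurd hs hab
      | exact absurd ht hab

theorem card_pair_of_ne {V : Type} {a b : V} (j : V) (ha : a ≠ j) (hb : b ≠ j) :
    Nat.card {s : Fin 2 // ![a, b] s = j} = 0 := by
  have : IsEmpty {s : Fin 2 // ![a, b] s = j} := ⟨fun ⟨s, hs⟩ => by fin_cases s <;> simp_all⟩
  exact Nat.card_of_isEmpty

/-- The submodule `A (1 k n i)` is `Δ(i)`, and the class of `t(i)` modulo it spans `Δ(1)`. -/
theorem hasFiltration_std_mid (i : Fin m) : HasFiltration (QHAlg C.val) (StdModule (e C.val))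
    (Submodule.span (QHAlg C.val) {tiltLoop C i})
    (fun j => Nat.card {s : Fin 2 // ![Vtx.mid i, Vtx.bot] s = j}) := by
  rw [← genChain_std_mid]
  refine hasFiltration_stdModule (C := C.val) ![wm C.val i, tiltLoop C i]
    ![Vtx.mid i, Vtx.bot] ?_ ?_ ?_ ?_
  · intro s; fin_cases s <;> simp
  · intro s hs j
    fin_cases s
    · simp at hs
    · have := mem_genChain (A := QHAlg C.val) ![wm C.val i, tiltLoop C i] (s := 1) 0 (by simp)
      simp only [Fin.isValue, Matrix.cons_val_zero] at this
      simp only [Fin.mk_one, Fin.isValue, Matrix.cons_val_one, smul_eq_mul, bm_mul_tiltLoop,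
        Matrix.cons_val_fin_one]
      split_ifs with h
      · rwa [← h]
      · exact Submodule.zero_mem _
  · intro s j hs
    fin_cases s
    · simp
    · simp at hs
  · intro s
    fin_cases s
    · simp [genChain_zero, stdSocle, ll_ne_zero]
    · intro h
      have h1 := genChain_le (A := QHAlg C.val) ![wm C.val i, tiltLoop C i] (s := 1)
        (N := Submodule.span _ {wm C.val i}) (fun r hr => by
          fin_cases r
          · exact Submodule.mem_span_singleton_self _
          · simp at hr) h
      obtain ⟨c, hc⟩ := Submodule.mem_span_singleton.1 h1
      -- If `t(i)` lay in `A (1 k n i)`, it would factor through `(1 j n)` as an element of `A e_n`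
      -- times that path. The arrow `1 → i` kills all such products but not `t(i)`.
      obtain ⟨r, s, t, H⟩ := exists_mul_e_top C.val (c * tm C.val i)
      have h2 : tiltLoop C i = c * tm C.val i * e C.val .top * bt C.val := by
        rw [mul_assoc, e_mul_bt, if_pos rfl, mul_assoc, tm_mul_bt]
        simpa [stdSocle] using hc.symm
      apply wm_ne_zero C i
      rw [← (by simp : bm C.val i * tiltLoop C i = wm C.val i), h2, H]
      simp [add_mul, mul_add, Finset.sum_mul, Finset.mul_sum]

theorem genChain_costd_mid (i : Fin m) :
    genChain (A := QHAlg C.val) ![ll C.val, tiltLoop C i] 2 =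
      Submodule.span (QHAlg C.val) {tiltLoop C i} := by
  apply le_antisymm
  · refine genChain_le _ fun r _ => Submodule.mem_span_singleton.2 ?_
    fin_cases r
    · exact ⟨loop C.val i, by simp⟩
    · exact ⟨1, by simp⟩
  · rw [Submodule.span_singleton_le_iff_mem]
    exact mem_genChain (A := QHAlg C.val) ![ll C.val, tiltLoop C i] 1 (by simp)

/-- Here the line of `ll` is `∇(1)`, and the uniserial quotient with basis `t(i)`, `(1 k n i)` is
`∇(i)`. -/
theorem hasFiltration_costd_mid (i : Fin m) :
    HasFiltration (QHAlg C.val) (fun j => costdModule K (e C.val) j)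
      (Submodule.span (QHAlg C.val) {tiltLoop C i})
      (fun j => Nat.card {s : Fin 2 // ![Vtx.bot, Vtx.mid i] s = j}) := by
  rw [← genChain_costd_mid]
  refine hasFiltration_costdModule (C := C.val) ![ll C.val, tiltLoop C i]
    ![Vtx.bot, Vtx.mid i] ?_ ?_ ?_ ?_ ?_ ?_
  · intro s; fin_cases s <;> simp
  · intro s; fin_cases s <;> simp
  · intro s j; fin_cases s <;> simp
    intro h
    rw [if_neg (Ne.symm h)]
    exact Submodule.zero_mem _
  · intro s j; fin_cases s
    · simp
    · have := mem_genChain (A := QHAlg C.val) ![ll C.val, tiltLoop C i] (s := 1) 0 (by simp)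
      simp only [Fin.isValue, Matrix.cons_val_zero] at this
      simp only [Fin.mk_one, Fin.isValue, Matrix.cons_val_one, smul_eq_mul, loop_mul_tiltLoop,
        Matrix.cons_val_fin_one]
      split_ifs with h
      · exact this
      · exact Submodule.zero_mem _
  · intro s j; fin_cases s <;> simp
  · intro s
    fin_cases s
    · simp [genChain_zero, costdTop, ll_ne_zero]
    · intro h
      have h1 := genChain_le (A := QHAlg C.val) ![ll C.val, tiltLoop C i] (s := 1)
        (N := avoidTiltIdeal C.val i) (fun r hr => by
          fin_cases r
          · rw [avoidTiltIdeal, mem_coordIdeal]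
            change _ ∧ _
            simp
          · simp at hr) h
      have h2 := h1.2.2
      simp [costdTop] at h2

theorem genChain_bot :
    genChain (A := QHAlg C.val) ![ll C.val] 1 = Submodule.span (QHAlg C.val) {ll C.val} := by
  simp [genChain]

theorem card_single {V : Type} (a : V) : Nat.card {s : Fin 1 // ![a] s = a} = 1 := by
  rw [Nat.card_eq_one_iff_unique]
  exact ⟨⟨fun _ _ => Subtype.ext (Subsingleton.elim _ _)⟩, ⟨⟨0, rfl⟩⟩⟩

theorem card_single_of_ne {V : Type} {a j : V} (h : a ≠ j) :
    Nat.card {s : Fin 1 // ![a] s = j} = 0 := by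
  have : IsEmpty {s : Fin 1 // ![a] s = j} := ⟨fun ⟨s, hs⟩ => h (by simpa using hs)⟩
  exact Nat.card_of_isEmpty

theorem hasFiltration_std_bot : HasFiltration (QHAlg C.val) (StdModule (e C.val))
    (Submodule.span (QHAlg C.val) {ll C.val})
    (fun j => Nat.card {s : Fin 1 // ![Vtx.bot] s = j}) := by
  rw [← genChain_bot]
  refine hasFiltration_stdModule (C := C.val) ![ll C.val] ![Vtx.bot] ?_ ?_ ?_ ?_
  · intro s; simp
  · intro s hs j; simp
  · intro s i hs; simp at hs
  · intro s
    rw [Subsingleton.elim s 0]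
    simp [genChain_zero, stdSocle, ll_ne_zero]

theorem hasFiltration_costd_bot :
    HasFiltration (QHAlg C.val) (fun j => costdModule K (e C.val) j)
      (Submodule.span (QHAlg C.val) {ll C.val})
      (fun j => Nat.card {s : Fin 1 // ![Vtx.bot] s = j}) := by
  rw [← genChain_bot]
  refine hasFiltration_costdModule (C := C.val) ![ll C.val] ![Vtx.bot] ?_ ?_ ?_ ?_ ?_ ?_
  · intro s; simp
  · intro s; simp
  · intro s j; simp
  · intro s j; simp
  · intro s j; simp
  · intro s
    rw [Subsingleton.elim s 0]
    simp [genChain_zero, costdTop, ll_ne_zero]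

theorem isTiltingModule_top :
    IsTiltingModule K (e C.val) .top (Submodule.span (QHAlg C.val) {e C.val .bot}) where
  finite := inferInstance
  indecomposable := isIndecomposableModule_span C.isUnit (by simp) fun h =>
    ll_ne_zero C.val (by rw [← (by simp : ll C.val * e C.val .bot = ll C.val), h, mul_zero])
  std := ⟨_, hasFiltration_std_top C, rfl, fun j hj => absurd (by simp) hj⟩
  costd := ⟨_, hasFiltration_costd_top C, rfl, fun j hj => absurd (by simp) hj⟩
  mult_self := by
    refine jhMult_eq_one_of_forall (y := bt C.val)
      (Submodule.mem_span_singleton.2 ⟨bt C.val, by simp⟩) (by simp) (bt_ne_zero C) fun x hx => ?_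
    obtain ⟨p, rfl⟩ := exists_ofCoord_mul (by simp) hx
    exact ⟨p.2.2.2.1, by simp [ofCoord_apply, mul_add, add_mul, Finset.sum_mul, Finset.mul_sum]⟩
  mult_eq_zero := fun j hj => absurd (by simp) hj

theorem isTiltingModule_mid (i : Fin m) :
    IsTiltingModule K (e C.val) (.mid i) (Submodule.span (QHAlg C.val) {tiltLoop C i}) where
  finite := inferInstance
  indecomposable := isIndecomposableModule_span C.isUnit (by simp) fun h =>
    wm_ne_zero C i (by rw [← (by simp : bm C.val i * tiltLoop C i = wm C.val i), h, mul_zero])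
  std := by
    refine ⟨_, hasFiltration_std_mid C i, card_pair (by simp) _ (.inl rfl), fun j hj => ?_⟩
    exact card_pair_of_ne _ (by rintro rfl; exact hj le_rfl) (by rintro rfl; simp at hj)
  costd := by
    refine ⟨_, hasFiltration_costd_mid C i, card_pair (by simp) _ (.inr rfl), fun j hj => ?_⟩
    exact card_pair_of_ne _ (by rintro rfl; simp at hj) (by rintro rfl; exact hj le_rfl)
  mult_self := by
    refine jhMult_eq_one_of_forall (y := wm C.val i)
      (Submodule.mem_span_singleton.2 ⟨bm C.val i, by simp⟩) (by simp) (wm_ne_zero C i)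
      fun x hx => ?_
    obtain ⟨p, rfl⟩ := exists_ofCoord_mul (by simp) hx
    exact ⟨p.2.1 i, by simp [ofCoord_mul_tiltLoop, mul_add]⟩
  mult_eq_zero := fun j hj => by
    refine jhMult_eq_zero_of_forall fun x hx => ?_
    obtain ⟨p, rfl⟩ := exists_ofCoord_mul (by simp) hx
    have hj1 : j ≠ .bot := by rintro rfl; simp at hj
    have hj2 : j ≠ .mid i := by rintro rfl; exact hj le_rfl
    simp [ofCoord_mul_tiltLoop, mul_add, hj1, hj2]

theorem isTiltingModule_bot :
    IsTiltingModule K (e C.val) .bot (Submodule.span (QHAlg C.val) {ll C.val}) where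
  finite := inferInstance
  indecomposable := isIndecomposableModule_span C.isUnit (by simp) (ll_ne_zero _)
  std := by
    refine ⟨_, hasFiltration_std_bot C, card_single _, fun j hj => card_single_of_ne ?_⟩
    rintro rfl; simp at hj
  costd := by
    refine ⟨_, hasFiltration_costd_bot C, card_single _, fun j hj => card_single_of_ne ?_⟩
    rintro rfl; simp at hj
  mult_self := by
    refine jhMult_eq_one_of_forall (y := ll C.val) (Submodule.mem_span_singleton_self _)
      (by simp) (ll_ne_zero _) fun x hx => ?_
    obtain ⟨p, rfl⟩ := exists_ofCoord_mul (by simp) hx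
    exact ⟨p.1, by simp [ofCoord_mul_ll]⟩
  mult_eq_zero := fun j hj => by
    refine jhMult_eq_zero_of_forall fun x hx => ?_
    obtain ⟨p, rfl⟩ := exists_ofCoord_mul (by simp) hx
    have hj1 : j ≠ .bot := by rintro rfl; simp at hj
    simp [ofCoord_mul_ll, hj1]

theorem isTiltingModule_tiltGen (hm : 0 < m) (i : Vtx m) :
    IsTiltingModule K (e C.val) i (Submodule.span (QHAlg C.val) {tiltGen hm C i}) := by
  rcases i with _ | i | _
  · rw [tiltGen_bot]; exact isTiltingModule_bot C
  · exact isTiltingModule_mid C i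
  · exact isTiltingModule_top C

end Existence

end QHAlg

/-! ### Uniqueness of the tilting modules. -/

namespace QHAlg

variable {K : Type u} [Field K] {m : ℕ}

section

variable {C : Matrix (Fin m) (Fin m) K} {M : Type w} [AddCommGroup M]
  [Module (QHAlg C) M]

/-- Two cyclic modules whose generators have the same annihilator are the same quotient of `A`. -/
theorem nonempty_equiv_span {u : M} (hu : Submodule.span (QHAlg C) {u} = ⊤) {t : QHAlg C}
    (h : ∀ a : QHAlg C, a • u = 0 ↔ a * t = 0) :
    Nonempty (M ≃ₗ[QHAlg C] Submodule.span (QHAlg C) {t}) := by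
  let f := LinearMap.toSpanSingleton (QHAlg C) M u
  let g := LinearMap.toSpanSingleton (QHAlg C) (QHAlg C) t
  have hf : Function.Surjective f := by
    rw [← LinearMap.range_eq_top, ← hu, LinearMap.range_toSpanSingleton]
  have hker : LinearMap.ker f = LinearMap.ker g := by
    ext a
    exact h a
  have hg : LinearMap.range g = Submodule.span (QHAlg C) {t} :=
    LinearMap.range_toSpanSingleton t
  exact ⟨(f.quotKerEquivOfSurjective hf).symm.trans ((Submodule.quotEquivOfEq _ _ hker).trans
    (g.quotKerEquivRange.trans (LinearEquiv.ofEq _ _ hg)))⟩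

variable [Module K M] [IsScalarTower K (QHAlg C) M]

theorem e_smul_eq_zero_of_jhMult [Module.Finite K M] {k : Vtx m} (h : jhMult K (e C) k M = 0)
    (x : M) : e C k • x = 0 := by
  rw [jhMult, Submodule.finrank_eq_zero] at h
  have : Algebra.lsmul K K M (e C k) x ∈ LinearMap.range (Algebra.lsmul K K M (e C k)) := ⟨x, rfl⟩
  rwa [h, Submodule.mem_bot] at this

theorem exists_e_smul_ne_zero_of_jhMult {k : Vtx m} (h : jhMult K (e C) k M = 1) :
    ∃ x : M, e C k • x = x ∧ x ≠ 0 ∧ ∀ y, ∃ c : K, e C k • y = c • x := by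
  obtain ⟨⟨v, x, hx⟩, hv, hc⟩ := finrank_eq_one_iff'.1 h
  refine ⟨v, ?_, fun h0 => hv (Subtype.ext h0), fun y => ?_⟩
  · rw [← hx]
    change e C k • e C k • x = e C k • x
    rw [← mul_smul, e_mul_self]
  · obtain ⟨c, hc⟩ := hc ⟨_, y, rfl⟩
    exact ⟨c, (congrArg Subtype.val hc).symm⟩

omit [IsScalarTower K (QHAlg C) M] in
/-- A cyclic submodule on which a functional is nondegenerate splits off. -/
theorem span_eq_top_of_functional (hM : IsIndecomposableModule (QHAlg C) M) (f : M →ₗ[K] K)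
    {u : M} (hu : u ≠ 0)
    (h1 : ∀ a : QHAlg C, (∀ b : QHAlg C, f ((e C .bot * b) • a • u) = 0) → a • u = 0)
    (h2 : ∀ x : M, ∃ a : QHAlg C, ∀ b : QHAlg C, f ((e C .bot * b) • (x - a • u)) = 0) :
    Submodule.span (QHAlg C) {u} = ⊤ := by
  -- The complement is the largest submodule on whose `e_1`-part `f` vanishes. The hypothesis `h1`
  -- makes it meet `A u` trivially, and `h2` makes the sum everything.
  let N : Submodule (QHAlg C) M :=
    { carrier := {x | ∀ b : QHAlg C, f ((e C .bot * b) • x) = 0}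
      zero_mem' := fun b => by rw [smul_zero, map_zero]
      add_mem' := fun {x y} hx hy b => by rw [smul_add, map_add, hx, hy, add_zero]
      smul_mem' := fun c x hx b => by rw [← mul_smul, mul_assoc]; exact hx _ }
  have hcompl : IsCompl (Submodule.span (QHAlg C) {u}) N := by
    constructor
    · rw [Submodule.disjoint_def]
      intro x hx hxN
      obtain ⟨a, rfl⟩ := Submodule.mem_span_singleton.1 hx
      exact h1 a hxN
    · rw [codisjoint_iff, eq_top_iff]
      intro x _
      obtain ⟨a, ha⟩ := h2 x
      exact Submodule.mem_sup.2 ⟨a • u, Submodule.mem_span_singleton.2 ⟨a, rfl⟩, x - a • u, ha,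
        by abel⟩
  rcases hM.2 _ _ hcompl with h | h
  · exact absurd ((Submodule.span_singleton_eq_bot).1 h) hu
  · rw [h] at hcompl
    exact hcompl.sup_eq_top ▸ (sup_bot_eq _).symm

variable [NeZero m]

theorem ofCoord_smul {x : M} (hx : e C .bot • x = x) (p : Coord K m) :
    ofCoord C p • x = p.1 • x + ∑ j, p.2.1 j • bm C j • x + ∑ j, p.2.2.1 j • loop C j • x +
      p.2.2.2.1 • bt C • x + ∑ j, p.2.2.2.2.1 j • wm C j • x + p.2.2.2.2.2 • ll C • x := by
  rw [ofCoord_apply]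
  simp only [add_smul, Finset.sum_smul, smul_assoc, hx]

omit [Module K M] [IsScalarTower K (QHAlg C) M] in
theorem smul_eq_ofCoord_smul {x : M} (hx : e C .bot • x = x) (a : QHAlg C) :
    a • x = ofCoord C (coord C a) • x := by
  rw [ofCoord_coord, mul_smul, hx]

theorem smul_eq_of_uniserial {u : M} {i : Fin m} (hu : e C .bot • u = u)
    (hj : ∀ j, j ≠ i → bm C j • u = 0) (hbt : bt C • u = 0) (a : QHAlg C) :
    a • u = (coord C a).1 • u + (coord C a).2.1 i • bm C i • u +
      (coord C a).2.2.1 i • mb C i • bm C i • u := by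
  rw [smul_eq_ofCoord_smul hu, ofCoord_smul hu]
  have h1 : ∑ j, (coord C a).2.1 j • bm C j • u = (coord C a).2.1 i • bm C i • u :=
    Finset.sum_eq_single i (fun j _ h => by rw [hj j h, smul_zero]) (by simp)
  have h2 : ∑ j, (coord C a).2.2.1 j • loop C j • u = (coord C a).2.2.1 i • mb C i • bm C i • u := by
    simp only [loop_smul]
    exact Finset.sum_eq_single i (fun j _ h => by rw [hj j h, smul_zero, smul_zero]) (by simp)
  rw [h1, h2]
  simp only [wm_smul, ll_smul, hbt, smul_zero, Finset.sum_const_zero, add_zero]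

/-- The path elements `u`, `(1 i) u`, `(1 i 1) u` are independent, as successive multiplication
towards the last one shows. The resulting annihilator depends only on `i`, so it can be compared
with that of `t(i)`. -/
theorem smul_eq_zero_iff_of_uniserial {u : M} {i : Fin m} (hu : e C .bot • u = u)
    (hj : ∀ j, j ≠ i → bm C j • u = 0) (hbt : bt C • u = 0) (h0 : mb C i • bm C i • u ≠ 0)
    (hb : bm C i • mb C i • bm C i • u = 0) (a : QHAlg C) :
    a • u = 0 ↔ (coord C a).1 = 0 ∧ (coord C a).2.1 i = 0 ∧ (coord C a).2.2.1 i = 0 := by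
  rw [smul_eq_of_uniserial hu hj hbt]
  constructor
  · intro h
    have h1 : (coord C a).1 = 0 := by
      have := congrArg (fun x => mb C i • bm C i • x) h
      simp only [smul_add, smul_comm (bm C i) (_ : K), smul_comm (mb C i) (_ : K), hb, smul_zero,
        add_zero] at this
      rw [← mul_smul (bm C i) (bm C i), bm_mul_bm, zero_smul, smul_zero, smul_zero, add_zero] at this
      exact (smul_eq_zero.1 this).resolve_right h0
    have h2 : (coord C a).2.1 i = 0 := by
      have := congrArg (fun x => mb C i • x) h
      simp only [h1, zero_smul, zero_add, smul_add, smul_comm (mb C i) (_ : K), smul_zero] at this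
      rw [← mul_smul (mb C i) (mb C i), mb_mul_mb, zero_smul, smul_zero, add_zero] at this
      exact (smul_eq_zero.1 this).resolve_right h0
    rw [h1, h2, zero_smul, zero_smul, zero_add, zero_add] at h
    exact ⟨h1, h2, (smul_eq_zero.1 h).resolve_right h0⟩
  · rintro ⟨h1, h2, h3⟩
    rw [h1, h2, h3]
    simp

end

section Uniqueness

variable [NeZero m] {C : GL (Fin m) K} {M : Type w} [AddCommGroup M] [Module (QHAlg C.val) M]
  [Module K M] [IsScalarTower K (QHAlg C.val) M]

/-- The only composition factor is `S(1)`, with multiplicity one, so the module is simple and no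
filtration is needed. -/
theorem nonempty_equiv_bot (hM : IsTiltingModule K (e C.val) .bot M) :
    Nonempty (M ≃ₗ[QHAlg C.val] Submodule.span (QHAlg C.val) {ll C.val}) := by
  have := hM.finite
  have h0 : ∀ v, v ≠ .bot → ∀ x : M, e C.val v • x = 0 := fun v hv =>
    e_smul_eq_zero_of_jhMult (hM.mult_eq_zero v (by rcases v with _ | _ | _ <;> simp at hv ⊢))
  obtain ⟨u, hu, hu0, hspan⟩ := exists_e_smul_ne_zero_of_jhMult hM.mult_self
  have hbm : ∀ j (x : M), bm C.val j • x = 0 := fun j x => by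
    have := h0 (.mid j) (by simp) (bm C.val j • x)
    rwa [← mul_smul, e_mul_bm, if_pos rfl] at this
  have hbt : ∀ x : M, bt C.val • x = 0 := fun x => by
    rw [bt_smul 0, hbm, smul_zero]
  refine nonempty_equiv_span (u := u) ?_ fun a => ?_
  · rw [eq_top_iff]
    intro x _
    have h1 : e C.val .bot • x = x := by
      have h2 : (∑ v, e C.val v) • x = x := by rw [sum_e, one_smul]
      rw [Vtx.sum_eq, add_smul, add_smul, Finset.sum_smul] at h2
      simpa [h0] using h2
    obtain ⟨c, hc⟩ := hspan x
    rw [h1] at hc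
    refine Submodule.mem_span_singleton.2 ⟨algebraMap K _ c, ?_⟩
    rw [algebraMap_smul, hc]
  · have h1 : a • u = (coord C.val a).1 • u := by
      rw [smul_eq_ofCoord_smul hu, ofCoord_smul hu]
      simp [loop_smul, wm_smul, ll_smul, hbm, hbt]
    have h2 : a * ll C.val = (coord C.val a).1 • ll C.val := by
      rw [← ofCoord_mul_ll, ofCoord_coord, mul_assoc]
      simp
    rw [h1, h2, smul_eq_zero, smul_eq_zero]
    simp [hu0, ll_ne_zero]

/-- All vertices but `1` and `i` act as zero. The two filtrations produce a vector `u` with `(1 i 1)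
u ≠ 0`, so `A u` is a copy of `A t(i)`, and a functional splits it off. -/
theorem nonempty_equiv_mid {i : Fin m} (hM : IsTiltingModule K (e C.val) (.mid i) M) :
    Nonempty (M ≃ₗ[QHAlg C.val] Submodule.span (QHAlg C.val) {tiltLoop C i}) := by
  have := hM.finite
  obtain ⟨c, hstd, -⟩ := hM.std
  obtain ⟨d, hcostd, -⟩ := hM.costd
  have htop : ∀ x : M, e C.val .top • x = 0 :=
    e_smul_eq_zero_of_jhMult (hM.mult_eq_zero _ (by simp))
  have hmid : ∀ j, j ≠ i → ∀ x : M, e C.val (.mid j) • x = 0 := fun j hj =>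
    e_smul_eq_zero_of_jhMult (hM.mult_eq_zero _ (by simpa using hj))
  obtain ⟨z, hz, hz0, -⟩ := exists_e_smul_ne_zero_of_jhMult hM.mult_self
  have hbm : ∀ j, j ≠ i → ∀ x : M, bm C.val j • x = 0 := fun j hj x => by
    have := hmid j hj (bm C.val j • x)
    rwa [← mul_smul, e_mul_bm, if_pos rfl] at this
  have hmb : ∀ j, j ≠ i → ∀ x : M, mb C.val j • x = 0 := fun j hj x => by
    rw [← (by simp : mb C.val j * e C.val (.mid j) = mb C.val j), mul_smul, hmid j hj, smul_zero]
  have hmt : ∀ j (x : M), mt C.val j • x = 0 := fun j x => by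
    have := htop (mt C.val j • x)
    rwa [← mul_smul, e_mul_mt, if_pos rfl] at this
  have htm : ∀ j (x : M), tm C.val j • x = 0 := fun j x => by
    rw [← (by simp : tm C.val j * e C.val .top = tm C.val j), mul_smul, htop, smul_zero]
  have hbt : ∀ x : M, bt C.val • x = 0 := fun x => by rw [bt_smul 0, hmt]
  have htb : ∀ x : M, tb C.val • x = 0 := fun x => by
    rw [tb_eq C.val 0, mul_smul, htm, smul_zero]
  obtain ⟨u, hu, hu0⟩ : ∃ u : M, e C.val .bot • u = u ∧ bm C.val i • u ≠ 0 := by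
    by_contra! hcon
    -- If no such `u` existed, `e_i` would kill everything generated by `e_1 M`, which is all of `M`
    -- by the `∇`-good filtration, contrary to `z ≠ 0`.
    let W : Submodule (QHAlg C.val) M :=
      { carrier := {x | ∀ a : QHAlg C.val, e C.val (.mid i) • a • x = 0}
        zero_mem' := fun a => by rw [smul_zero, smul_zero]
        add_mem' := fun {x y} hx hy a => by rw [smul_add, smul_add, hx, hy, add_zero]
        smul_mem' := fun c x hx a => by rw [← mul_smul a]; exact hx _ }
    have hW : Submodule.span (QHAlg C.val) {x : M | e C.val .bot • x = x} ≤ W := by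
      refine Submodule.span_le.2 fun x hx a => ?_
      refine e_smul_eq_zero_of_costdRel (k := .bot) hx ⟨fun _ => hbt x, fun j _ => ?_⟩ (by simp) a
      by_cases hj : j = i
      · rw [hj]; exact hcon x hx
      · exact hbm j hj x
    rw [span_e_bot_of_hasFiltration C.isUnit hcostd] at hW
    have := hW (Submodule.mem_top (x := z)) 1
    rw [one_smul, hz] at this
    exact hz0 this
  -- Otherwise `(1 i) u` would span a copy of `S(i)` in the socle, which the `Δ`-good filtration
  -- forbids.
  have hw0 : mb C.val i • bm C.val i • u ≠ 0 := by
    intro h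
    have := e_bot_smul_of_hasFiltration hstd (bm C.val i • u) (fun j => ?_) (fun j => htm j _)
    · rw [← mul_smul, e_mul_bm, if_neg (by simp), zero_smul] at this
      exact hu0 this.symm
    · by_cases hj : j = i
      · rw [hj]; exact h
      · exact hmb j hj _
  have hbw : bm C.val i • mb C.val i • bm C.val i • u = 0 := by
    rw [← mul_smul, bm_mul_mb, smul_assoc, mul_smul, hmt, smul_zero, smul_zero]
  have hann := smul_eq_zero_iff_of_uniserial hu (fun j hj => hbm j hj u) (hbt u) hw0 hbw
  refine nonempty_equiv_span (u := u) ?_ fun a => (hann a).trans ?_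
  · obtain ⟨f, hf⟩ := exists_dual_ne_zero (K := K) hw0
    have hmbu : mb C.val i • u = 0 := by
      rw [← hu, ← mul_smul, mb_mul_e, if_neg (by simp), zero_smul]
    have hmbmb : ∀ x : M, mb C.val i • mb C.val i • x = 0 := fun x => by
      rw [← mul_smul, mb_mul_mb, zero_smul]
    have hbmbm : ∀ x : M, bm C.val i • bm C.val i • x = 0 := fun x => by
      rw [← mul_smul, bm_mul_bm, zero_smul]
    refine span_eq_top_of_functional hM.indecomposable f (u := u)
      (fun h => hu0 (by rw [h, smul_zero])) (fun a ha => ?_) (fun x => ?_)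
    · have h1 : a • u = _ := smul_eq_of_uniserial hu (fun j hj => hbm j hj u) (hbt u) a
      have hp1 : (coord C.val a).1 = 0 := by
        have := ha (mb C.val i * bm C.val i)
        rw [h1, ← mul_assoc, e_mul_mb, if_pos rfl, mul_smul] at this
        simp only [smul_add, smul_comm (bm C.val i) (_ : K), smul_comm (mb C.val i) (_ : K), hbw,
          hbmbm, smul_zero, add_zero, map_smul, smul_eq_mul] at this
        exact (mul_eq_zero.1 this).resolve_right hf
      have hp2 : (coord C.val a).2.1 i = 0 := by
        have := ha (mb C.val i)
        rw [h1, e_mul_mb, if_pos rfl] at this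
        simp only [smul_add, smul_comm (mb C.val i) (_ : K), hmbu,
          hmbmb, smul_zero, add_zero, zero_add, map_smul, smul_eq_mul] at this
        exact (mul_eq_zero.1 this).resolve_right hf
      have hp3 : (coord C.val a).2.2.1 i = 0 := by
        have := ha (e C.val .bot)
        rw [h1, hp1, hp2, e_mul_self, zero_smul, zero_smul, zero_add, zero_add,
          smul_comm, ← mul_smul (e C.val .bot), e_mul_mb, if_pos rfl, map_smul, smul_eq_mul] at this
        exact (mul_eq_zero.1 this).resolve_right hf
      rw [h1, hp1, hp2, hp3]
      simp
    · set w := mb C.val i • bm C.val i • u with hw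
      -- The scalars solve the triangular system saying that `x` and `α u + β (1 i) u + γ w` agree
      -- under `f` after acting by `(1 i 1)`, by `i → 1` and by `e_1`. These three actions exhaust
      -- what `e_1 A` does on `M`.
      let α := f (mb C.val i • bm C.val i • x) * (f w)⁻¹
      let β := f (mb C.val i • x) * (f w)⁻¹
      let γ := (f (e C.val .bot • x) - α * f u) * (f w)⁻¹
      refine ⟨α • 1 + β • bm C.val i + γ • (mb C.val i * bm C.val i), fun b => ?_⟩
      have hq : (α • 1 + β • bm C.val i + γ • (mb C.val i * bm C.val i)) • u =
          α • u + β • bm C.val i • u + γ • w := by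
        simp only [add_smul, smul_assoc, one_smul, mul_smul, hw]
      obtain ⟨p, hp⟩ := exists_e_bot_mul (C := C.val) b
      have hact : ∀ y : M, (e C.val .bot * b) • y = p.1 • e C.val .bot • y +
          p.2.1 i • mb C.val i • y + p.2.2.1 i • mb C.val i • bm C.val i • y := fun y => by
        rw [hp]
        simp only [revCoord, LinearMap.coe_mk, AddHom.coe_mk, add_smul, Finset.sum_smul, smul_assoc, tbm_smul, hmt, htb, ll_smul, loop_smul,
          smul_zero, Finset.sum_const_zero, add_zero]
        congr 1
        · congr 1
          exact Finset.sum_eq_single i (fun j _ hj => by rw [hmb j hj, smul_zero]) (by simp)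
        · exact Finset.sum_eq_single i (fun j _ hj => by rw [hmb j hj, smul_zero]) (by simp)
      have e1 : f (mb C.val i • bm C.val i • (x - (α • u + β • bm C.val i • u + γ • w))) = 0 := by
        simp only [smul_sub, smul_add, smul_comm (bm C.val i) (_ : K),
          smul_comm (mb C.val i) (_ : K), hbw, hbmbm, smul_zero, add_zero, map_sub, map_smul,
          smul_eq_mul, ← hw]
        rw [inv_mul_cancel_right₀ hf, sub_self]
      have e2 : f (mb C.val i • (x - (α • u + β • bm C.val i • u + γ • w))) = 0 := by
        simp only [smul_sub, smul_add, smul_comm (mb C.val i) (_ : K), hmbu, ← hw]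
        rw [hw, hmbmb, ← hw]
        simp only [smul_zero, add_zero, zero_add, map_sub, map_smul, smul_eq_mul]
        rw [inv_mul_cancel_right₀ hf, sub_self]
      have e3 : f (e C.val .bot • (x - (α • u + β • bm C.val i • u + γ • w))) = 0 := by
        have h1 : e C.val .bot • bm C.val i • u = 0 := by
          rw [← mul_smul, e_mul_bm, if_neg (by simp), zero_smul]
        have h2 : e C.val .bot • w = w := by
          rw [hw, ← mul_smul, e_mul_mb, if_pos rfl]
        simp only [smul_sub, smul_add, smul_comm (e C.val .bot) (_ : K), hu, h1, h2, smul_zero,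
          add_zero, map_sub, map_add, map_smul, smul_eq_mul]
        rw [inv_mul_cancel_right₀ hf]
        ring
      rw [hq, hact, map_add, map_add, f.map_smul, f.map_smul, f.map_smul, e1, e2, e3]
      simp
  · refine (smul_eq_zero_iff_of_uniserial (i := i) (u := tiltLoop C i) (by simp)
      (fun j hj => by simp [hj.symm]) (by simp) ?_ (by simp) a).symm
    simpa using ll_ne_zero C.val

/-- A vector `u ∈ e_1 M` with `ll u ≠ 0` generates a free copy of `A e_1`, since every nonzero
element of `A e_1` can be multiplied up to `ll`. The splitting is the injectivity of `A e_1`, made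
explicit by a perfect pairing between `e_1 A` and `A u`. -/
theorem nonempty_equiv_top (hM : IsTiltingModule K (e C.val) .top M) :
    Nonempty (M ≃ₗ[QHAlg C.val] Submodule.span (QHAlg C.val) {e C.val .bot}) := by
  have := hM.finite
  obtain ⟨c, hstd, -⟩ := hM.std
  obtain ⟨d, hcostd, -⟩ := hM.costd
  obtain ⟨z, hz, hz0, -⟩ := exists_e_smul_ne_zero_of_jhMult hM.mult_self
  obtain ⟨u, hu, hu0⟩ : ∃ u : M, e C.val .bot • u = u ∧ bt C.val • u ≠ 0 := by
    by_contra! hcon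
    let W : Submodule (QHAlg C.val) M :=
      { carrier := {x | ∀ a : QHAlg C.val, e C.val .top • a • x = 0}
        zero_mem' := fun a => by rw [smul_zero, smul_zero]
        add_mem' := fun {x y} hx hy a => by rw [smul_add, smul_add, hx, hy, add_zero]
        smul_mem' := fun c x hx a => by rw [← mul_smul a]; exact hx _ }
    have hW : Submodule.span (QHAlg C.val) {x : M | e C.val .bot • x = x} ≤ W := by
      refine Submodule.span_le.2 fun x (hx : e C.val .bot • x = x) a => ?_
      rw [smul_eq_ofCoord_smul hx, ← mul_smul]
      have : e C.val .top * ofCoord C.val (coord C.val a) = (coord C.val a).2.2.2.1 • bt C.val := by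
        simp [ofCoord_apply, mul_add, Finset.mul_sum]
      rw [this, smul_assoc, hcon x hx, smul_zero]
    rw [span_e_bot_of_hasFiltration C.isUnit hcostd] at hW
    have := hW (Submodule.mem_top (x := z)) 1
    rw [one_smul, hz] at this
    exact hz0 this
  -- If `ll u = 0`, the socle condition kills first the elements `(1 k n j) u` and then `(1 k n) u`,
  -- which was nonzero.
  have hll : ll C.val • u ≠ 0 := by
    intro h
    rw [ll_smul] at h
    have htm : ∀ j, tm C.val j • bt C.val • u = 0 := fun j => by
      have := e_bot_smul_of_hasFiltration hstd (tm C.val j • bt C.val • u) (fun k => ?_) (fun k => ?_)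
      · rw [← mul_smul, e_mul_tm, if_neg (by simp), zero_smul] at this
        exact this.symm
      · rw [← mul_smul, mb_mul_tm]
        split_ifs
        · exact h
        · exact zero_smul _ _
      · rw [← mul_smul, tm_mul_tm, zero_smul]
    have := e_bot_smul_of_hasFiltration hstd (bt C.val • u)
      (fun j => by rw [← mul_smul, mb_mul_bt, zero_smul]) htm
    rw [← mul_smul, e_mul_bt, if_neg (by simp), zero_smul] at this
    exact hu0 this.symm
  have hann : ∀ p : Coord K m, ofCoord C.val p • u = 0 → p = 0 := by
    intro p hp
    by_contra h0
    obtain ⟨b, hb⟩ := exists_mul_ofCoord_eq_ll C.val C.isUnit h0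
    exact hll (by rw [← hb, mul_smul, hp, smul_zero])
  refine nonempty_equiv_span (u := u) ?_ fun a => ?_
  · obtain ⟨f, hf⟩ := exists_dual_ne_zero (K := K) hll
    let Θ : M →ₗ[K] Module.Dual K (Coord K m) := LinearMap.mk₂ K (fun x p => f (revCoord C.val p • x))
      (fun x y p => by rw [smul_add, map_add]) (fun r x p => by rw [smul_comm, f.map_smul])
      (fun x p q => by rw [map_add, add_smul, map_add])
      (fun r x p => by rw [(revCoord C.val).map_smul, smul_assoc, f.map_smul])
    have hΘ : ∀ x p, Θ x p = f (revCoord C.val p • x) := fun x p => rfl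
    have hrev : ∀ b, ∃ p, e C.val .bot * b = revCoord C.val p := exists_e_bot_mul
    let Ψ : Coord K m →ₗ[K] Module.Dual K (Coord K m) :=
      Θ.comp ((LinearMap.toSpanSingleton (QHAlg C.val) M u).restrictScalars K ∘ₗ ofCoord C.val)
    have hΨ : ∀ p, Ψ p = Θ (ofCoord C.val p • u) := fun p => rfl
    -- The simple socle makes the pairing nondegenerate on one side; equality of dimensions then
    -- makes it perfect.
    have hinj : Function.Injective Ψ := by
      rw [injective_iff_map_eq_zero]
      intro p hp
      by_contra h0
      obtain ⟨b, hb⟩ := exists_mul_ofCoord_eq_ll C.val C.isUnit h0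
      obtain ⟨q, hq⟩ := hrev b
      have := LinearMap.congr_fun hp q
      rw [hΨ, hΘ, ← hq, ← mul_smul, mul_assoc, hb, e_mul_ll, if_pos rfl] at this
      exact hf this
    have hsurj : Function.Surjective Ψ :=
      (LinearMap.injective_iff_surjective_of_finrank_eq_finrank
        (Subspace.dual_finrank_eq (K := K) (V := Coord K m)).symm).1 hinj
    refine span_eq_top_of_functional hM.indecomposable f (u := u)
      (fun h => hu0 (by rw [h, smul_zero])) (fun a ha => ?_) (fun x => ?_)
    · rw [smul_eq_ofCoord_smul hu] at ha ⊢
      by_contra h0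
      obtain ⟨b, hb⟩ := exists_mul_ofCoord_eq_ll C.val C.isUnit (p := coord C.val a)
        (fun h => h0 (by rw [h, map_zero, zero_smul]))
      have := ha b
      rw [← mul_smul, mul_assoc, hb, e_mul_ll, if_pos rfl] at this
      exact hf this
    · obtain ⟨p, hp⟩ := hsurj (Θ x)
      refine ⟨ofCoord C.val p, fun b => ?_⟩
      obtain ⟨q, hq⟩ := hrev b
      rw [hq, ← hΘ, map_sub, ← hΨ, hp, sub_self, LinearMap.zero_apply]
  · rw [smul_eq_ofCoord_smul hu, ← ofCoord_coord]
    constructor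
    · intro h
      rw [hann _ h, map_zero]
    · intro h
      rw [h, zero_smul]

theorem nonempty_equiv_tiltGen (hm : 0 < m) {i : Vtx m} (hM : IsTiltingModule K (e C.val) i M) :
    Nonempty (M ≃ₗ[QHAlg C.val] Submodule.span (QHAlg C.val) {tiltGen hm C i}) := by
  rcases i with _ | i | _
  · rw [tiltGen_bot]; exact nonempty_equiv_bot hM
  · exact nonempty_equiv_mid hM
  · exact nonempty_equiv_top hM

end Uniqueness

end QHAlg

/-! ### Endomorphisms of a direct sum as matrices. -/

section Matrices

variable {A : Type u} [Ring A] {V : Type} [DecidableEq V] {T : V → Type w}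
  [∀ i, AddCommGroup (T i)] [∀ i, Module A (T i)]

/-- The endomorphism of a direct sum with a single nonzero matrix entry. -/
def summandMap {i k : V} (f : T i →ₗ[A] T k) : RingelDual A T :=
  DirectSum.lof A V T k ∘ₗ f ∘ₗ DirectSum.component A V T i

theorem summandProj_eq (i : V) : summandProj A T i = summandMap (LinearMap.id : T i →ₗ[A] T i) := rfl

theorem summandMap_mul {i j k : V} (g : T j →ₗ[A] T k) (f : T i →ₗ[A] T j) :
    summandMap g * summandMap f = summandMap (g ∘ₗ f) := by
  refine LinearMap.ext fun x => ?_
  simp [summandMap, DirectSum.component.lof_self]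

theorem summandMap_mul_ne {i j j' k : V} (h : j ≠ j') (g : T j' →ₗ[A] T k) (f : T i →ₗ[A] T j) :
    summandMap g * summandMap f = 0 := by
  refine LinearMap.ext fun x => ?_
  have : DirectSum.component A V T j' (DirectSum.lof A V T j
      (f (DirectSum.component A V T i x))) = 0 := by
    rw [DirectSum.component.of, dif_neg h]
  simp [summandMap, this]

theorem summandMap_add {i k : V} (f g : T i →ₗ[A] T k) :
    summandMap (f + g) = summandMap f + summandMap g := by
  refine LinearMap.ext fun x => ?_
  simp [summandMap]

theorem summandMap_zero {i k : V} : summandMap (0 : T i →ₗ[A] T k) = 0 := by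
  refine LinearMap.ext fun x => ?_
  simp [summandMap]

theorem summandMap_injective {i k : V} {f g : T i →ₗ[A] T k}
    (h : summandMap f = summandMap g) : f = g := by
  refine LinearMap.ext fun x => ?_
  have := congrArg (DirectSum.component A V T k)
    (LinearMap.congr_fun h (DirectSum.lof A V T i x))
  simpa [summandMap, DirectSum.component.lof_self] using this

theorem sum_summandProj [Fintype V] : ∑ i, summandProj A T i = 1 := by
  refine LinearMap.ext fun x => ?_
  rw [LinearMap.sum_apply]
  exact DirectSum.sum_univ_of x

theorem eq_sum_summandMap [Fintype V] (F : RingelDual A T) :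
    F = ∑ k, ∑ i, summandMap
      (DirectSum.component A V T k ∘ₗ F ∘ₗ DirectSum.lof A V T i) := by
  have h : ∀ k i, summandMap (DirectSum.component A V T k ∘ₗ F ∘ₗ DirectSum.lof A V T i) =
      summandProj A T k * F * summandProj A T i := fun k i => rfl
  simp only [h, ← Finset.mul_sum, ← Finset.sum_mul, sum_summandProj, one_mul, mul_one]

theorem summandMap_smul {K : Type*} [Field K] [Algebra K A] [∀ i, Module K (T i)]
    [∀ i, IsScalarTower K A (T i)] {i k : V} (c : K) (f : T i →ₗ[A] T k) :
    summandMap (c • f) = c • summandMap f := by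
  refine LinearMap.ext fun x => ?_
  change DirectSum.lof A V T k (c • _) = c • DirectSum.lof A V T k _
  rw [LinearMap.map_smul_of_tower]
  rfl

end Matrices

/-! ### The Ringel dual of `A_n(C)`. -/

namespace QHAlg

variable {K : Type u} [Field K] {m : ℕ} {C : GL (Fin m) K} {hm : 0 < m}

section Homs

variable {T : Vtx m → Type w} [∀ i, AddCommGroup (T i)] [∀ i, Module (QHAlg C.val) (T i)]
  (E : ∀ i, T i ≃ₗ[QHAlg C.val] Submodule.span (QHAlg C.val) {tiltGen hm C i})

/-- The embedding of `T(k)` into `A`. -/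
noncomputable def tiltEmb (k : Vtx m) : T k →ₗ[QHAlg C.val] QHAlg C.val :=
  (Submodule.span (QHAlg C.val) {tiltGen hm C k}).subtype ∘ₗ (E k).toLinearMap

theorem tiltEmb_injective (k : Vtx m) : Function.Injective (tiltEmb E k) :=
  Subtype.val_injective.comp (E k).injective

theorem tiltEmb_mem (k : Vtx m) (x : T k) :
    tiltEmb E k x ∈ Submodule.span (QHAlg C.val) {tiltGen hm C k} := (E k x).2

/-- The generator of `T(k)`. -/
noncomputable def tiltGenerator (k : Vtx m) : T k :=
  (E k).symm ⟨tiltGen hm C k, Submodule.mem_span_singleton_self _⟩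

theorem tiltEmb_tiltGenerator (k : Vtx m) : tiltEmb E k (tiltGenerator E k) = tiltGen hm C k := by
  simp [tiltEmb, tiltGenerator]

theorem exists_eq_smul_tiltGenerator (k : Vtx m) (x : T k) :
    ∃ a : QHAlg C.val, x = a • tiltGenerator E k := by
  obtain ⟨a, ha⟩ := Submodule.mem_span_singleton.1 (tiltEmb_mem E k x)
  exact ⟨a, tiltEmb_injective E k (by rw [map_smul, tiltEmb_tiltGenerator, ha])⟩

theorem tiltHom_ext {i k : Vtx m} {f g : T i →ₗ[QHAlg C.val] T k}
    (h : tiltEmb E k (f (tiltGenerator E i)) = tiltEmb E k (g (tiltGenerator E i))) : f = g := by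
  refine LinearMap.ext fun x => ?_
  obtain ⟨a, rfl⟩ := exists_eq_smul_tiltGenerator E i x
  rw [map_smul, map_smul, tiltEmb_injective E k h]

/-- Right multiplication by `y` as a map `T(i) → T(k)`. -/
noncomputable def mulHom {i k : Vtx m} (y : QHAlg C.val)
    (h : tiltGen hm C i * y ∈ Submodule.span (QHAlg C.val) {tiltGen hm C k}) :
    T i →ₗ[QHAlg C.val] T k :=
  (E k).symm.toLinearMap ∘ₗ
    ((LinearMap.toSpanSingleton (QHAlg C.val) (QHAlg C.val) y) ∘ₗ tiltEmb E i).codRestrict _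
      (fun x => by
        obtain ⟨a, ha⟩ := Submodule.mem_span_singleton.1 (tiltEmb_mem E i x)
        change tiltEmb E i x * y ∈ _
        rw [← ha, smul_mul_assoc]
        exact Submodule.smul_mem _ a h)

theorem tiltEmb_mulHom {i k : Vtx m} (y : QHAlg C.val)
    (h : tiltGen hm C i * y ∈ Submodule.span (QHAlg C.val) {tiltGen hm C k}) (x : T i) :
    tiltEmb E k (mulHom E y h x) = tiltEmb E i x * y := by
  simp [tiltEmb, mulHom]

variable [∀ i, Module K (T i)] [∀ i, IsScalarTower K (QHAlg C.val) (T i)] [NeZero m]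

variable (C) in
/-- An element right multiplication by which maps `∑_k d_{ik} (1 k 1)` to `(1 j n j 1)` for
`i = j` and to `0` for `i ≠ j`. -/
noncomputable def dualLoop (j : Fin m) : QHAlg C.val := ∑ k, C.val k j • tiltLoop C k

-- The coefficients of `dualLoop` form a column of `C`, so with `t(i) t(k) = d_{ik} ll` the product
-- is an entry of `C⁻¹ C`.
@[simp] theorem tiltLoop_mul_dualLoop (i j : Fin m) :
    tiltLoop C i * dualLoop C j = if i = j then ll C.val else 0 := by
  have h : ∑ k, C.val k j * C⁻¹.val i k = if i = j then 1 else 0 := by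
    rw [← Matrix.one_apply, ← Units.inv_mul C, Matrix.mul_apply]
    exact Finset.sum_congr rfl fun _ _ => mul_comm _ _
  simp only [dualLoop, Finset.mul_sum, mul_smul_comm, tiltLoop_mul_tiltLoop, smul_smul,
    ← Finset.sum_smul, h]
  split_ifs <;> simp

@[simp] theorem ll_mul_dualLoop (j : Fin m) : ll C.val * dualLoop C j = 0 := by
  simp [dualLoop, Finset.mul_sum]

variable (C) in
/-- The elements right multiplication by which gives the arrows of the Ringel dual. -/
noncomputable def arrowElt : ∀ {s t : Vtx m}, Vtx.Arrow s t → QHAlg C.val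
  -- As `1` and `n` are interchanged, the arrow `1 → j` becomes the map `T(n) → T(j)`, `e_1 ↦ t(j)`.
  -- The arrows `j → 1` and `n → j` become the inclusions `T(j) ⊂ T(n)` and `T(1) ⊂ T(j)`, and `j →
  -- n` becomes `t(j) ↦ ll`.
  | _, _, .botMid j => tiltLoop C j
  | _, _, .midBot _ => 1
  | _, _, .midTop j => dualLoop C j
  | _, _, .topMid _ => 1

variable (C hm) in
theorem tiltGen_mul_arrowElt {s t : Vtx m} (f : Vtx.Arrow s t) :
    tiltGen hm C s.swap * arrowElt C f ∈
      Submodule.span (QHAlg C.val) {tiltGen hm C t.swap} := by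
  have h := Submodule.mem_span_singleton_self (R := QHAlg C.val) (tiltGen hm C t.swap)
  cases f with
  | botMid j => exact Submodule.smul_mem _ (e C.val .bot) h
  | midBot j =>
    refine Submodule.mem_span_singleton.2 ⟨tiltLoop C j, ?_⟩
    simp [arrowElt, Vtx.swap, tiltGen_mid, tiltGen_top]
  | midTop j =>
    refine Submodule.mem_span_singleton.2 ⟨1, ?_⟩
    simp [arrowElt, Vtx.swap, tiltGen_mid, tiltGen_bot]
  | topMid j =>
    refine Submodule.mem_span_singleton.2 ⟨loop C.val j, ?_⟩
    simp [arrowElt, Vtx.swap, tiltGen_mid, tiltGen_bot]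

/-- The relations of `A_n(C⁻¹)` hold in the Ringel dual of `A_n(C)`. -/
noncomputable def ringelRealization :
    Realization C⁻¹.val (RingelDual (QHAlg C.val) T) where
  vertex v := summandProj (QHAlg C.val) T v.swap
  arrow f := summandMap (mulHom E (arrowElt C f) (tiltGen_mul_arrowElt C hm f))
  idem v := by rw [summandProj_eq, summandMap_mul]; rfl
  orth v v' h := by
    rw [summandProj_eq, summandProj_eq, summandMap_mul_ne]
    intro h'
    exact h (by rw [← Vtx.swap_swap v, ← h', Vtx.swap_swap])
  sum_one := by
    rw [← sum_summandProj (A := QHAlg C.val) (T := T), Vtx.sum_eq, Vtx.sum_eq]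
    simp only [Vtx.swap]
    abel
  target f := by rw [summandProj_eq, summandMap_mul]; rfl
  source f := by rw [summandProj_eq, summandMap_mul]; rfl
  botTop i j := by
    simp only [summandMap_mul]
    congr 1
    refine tiltHom_ext E ?_
    simp [tiltEmb_mulHom, tiltEmb_tiltGenerator, arrowElt, mul_assoc]
  topBot i j := by
    simp only [summandMap_mul]
    congr 1
    refine tiltHom_ext E ?_
    simp [tiltEmb_mulHom, tiltEmb_tiltGenerator, arrowElt]
  -- The composite `T(i) → T(n) → T(j)` sends `t(i)` to `t(i) t(j) = d_{ij} ll`, whereas `T(i) →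
  -- T(1) → T(j)` sends it to `ll`.
  mid i j := by
    simp only [summandMap_mul]
    rw [← summandMap_smul]
    congr 1
    refine tiltHom_ext E ?_
    rw [LinearMap.smul_apply, LinearMap.map_smul_of_tower, LinearMap.comp_apply,
      LinearMap.comp_apply, tiltEmb_mulHom, tiltEmb_mulHom, tiltEmb_mulHom, tiltEmb_mulHom,
      tiltEmb_tiltGenerator]
    simp [arrowElt, Vtx.swap, tiltGen_mid]
  topTop j := by
    rw [summandMap_mul, ← summandMap_zero]
    congr 1
    refine tiltHom_ext E ?_
    rw [LinearMap.comp_apply, tiltEmb_mulHom, tiltEmb_mulHom, tiltEmb_tiltGenerator,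
      LinearMap.zero_apply, map_zero]
    simp [arrowElt, Vtx.swap, tiltGen_bot]

/-- The map from `A_n(C⁻¹)` to the Ringel dual of `A_n(C)`. -/
noncomputable def ringelHom : QHAlg C⁻¹.val →ₐ[K] RingelDual (QHAlg C.val) T :=
  (ringelRealization E).lift

theorem ringelHom_e (v : Vtx m) :
    ringelHom E (e C⁻¹.val v) = summandProj (QHAlg C.val) T v.swap := Realization.lift_e _ v

theorem ringelHom_arr {s t : Vtx m} (f : Vtx.Arrow s t) : ringelHom E (arr C⁻¹.val f) =
    summandMap (mulHom E (arrowElt C f) (tiltGen_mul_arrowElt C hm f)) :=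
  Realization.lift_arr _ f

/-- Right multiplication by `y` is a map `T(i) → T(k)` in the image of `A_n(C⁻¹)`. -/
def IsRingelImage (i k : Vtx m) (y : QHAlg C.val) : Prop :=
  ∃ (a : QHAlg C⁻¹.val) (f : T i →ₗ[QHAlg C.val] T k), ringelHom E a = summandMap f ∧
    ∀ x, tiltEmb E k (f x) = tiltEmb E i x * y

variable {E}

theorem IsRingelImage.one (i : Vtx m) : IsRingelImage E i i 1 :=
  ⟨e _ i.swap, LinearMap.id, by rw [ringelHom_e, Vtx.swap_swap]; rfl, fun x => by simp⟩

theorem IsRingelImage.add {i k : Vtx m} {y z : QHAlg C.val} (hy : IsRingelImage E i k y)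
    (hz : IsRingelImage E i k z) : IsRingelImage E i k (y + z) := by
  obtain ⟨a, f, hf, hf'⟩ := hy
  obtain ⟨b, g, hg, hg'⟩ := hz
  exact ⟨a + b, f + g, by rw [map_add, hf, hg, summandMap_add], fun x => by
    rw [LinearMap.add_apply, map_add, hf', hg', mul_add]⟩

theorem IsRingelImage.smul {i k : Vtx m} {y : QHAlg C.val} (c : K) (hy : IsRingelImage E i k y) :
    IsRingelImage E i k (c • y) := by
  obtain ⟨a, f, hf, hf'⟩ := hy
  exact ⟨c • a, c • f, by rw [map_smul, hf, summandMap_smul], fun x => by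
    rw [LinearMap.smul_apply, LinearMap.map_smul_of_tower, hf', mul_smul_comm]⟩

theorem IsRingelImage.mul {i j k : Vtx m} {y z : QHAlg C.val} (hy : IsRingelImage E i j y)
    (hz : IsRingelImage E j k z) : IsRingelImage E i k (y * z) := by
  obtain ⟨a, f, hf, hf'⟩ := hy
  obtain ⟨b, g, hg, hg'⟩ := hz
  -- Right multiplications compose in the reverse order, so the product `y * z` comes from `b * a`.
  exact ⟨b * a, g ∘ₗ f, by rw [map_mul, hf, hg, summandMap_mul], fun x => by
    rw [LinearMap.comp_apply, hg', hf', mul_assoc]⟩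

theorem IsRingelImage.sum {i k : Vtx m} {ι : Type*} (s : Finset ι) {y : ι → QHAlg C.val}
    (hy : ∀ j, IsRingelImage E i k (y j)) : IsRingelImage E i k (∑ j ∈ s, y j) := by
  classical
  induction s using Finset.induction_on with
  | empty => exact ⟨0, 0, by rw [map_zero, summandMap_zero], fun x => by simp⟩
  | insert a s ha ih => rw [Finset.sum_insert ha]; exact (hy a).add ih

theorem IsRingelImage.arr {s t : Vtx m} (f : Vtx.Arrow s t) :
    IsRingelImage E s.swap t.swap (arrowElt C f) :=
  ⟨QHAlg.arr _ f, _, ringelHom_arr E f, fun x => tiltEmb_mulHom E _ _ x⟩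

theorem IsRingelImage.mem_range {i k : Vtx m} {y : QHAlg C.val} (hy : IsRingelImage E i k y)
    {f : T i →ₗ[QHAlg C.val] T k}
    (h : tiltEmb E k (f (tiltGenerator E i)) = tiltGen hm C i * y) :
    summandMap f ∈ (ringelHom E).range := by
  obtain ⟨a, g, hg, hg'⟩ := hy
  refine ⟨a, ?_⟩
  have : f = g := tiltHom_ext E (by rw [h, hg', tiltEmb_tiltGenerator])
  rw [this]
  exact hg

theorem isRingelImage_topMid (j : Fin m) : IsRingelImage E .top (.mid j) (tiltLoop C j) :=
  .arr (.botMid j)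
theorem isRingelImage_midTop (j : Fin m) : IsRingelImage E (.mid j) .top 1 := .arr (.midBot j)
theorem isRingelImage_midBot (j : Fin m) : IsRingelImage E (.mid j) .bot (dualLoop C j) :=
  .arr (.midTop j)
theorem isRingelImage_botMid (j : Fin m) : IsRingelImage E .bot (.mid j) 1 := .arr (.topMid j)

theorem isRingelImage_botTop : IsRingelImage E .bot .top 1 := by
  simpa using (isRingelImage_botMid (E := E) 0).mul (isRingelImage_midTop 0)

theorem isRingelImage_topBot : IsRingelImage E .top .bot (ll C.val) := by
  simpa using (isRingelImage_topMid (E := E) 0).mul (isRingelImage_midBot 0)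

theorem isRingelImage_topTop_ll : IsRingelImage E .top .top (ll C.val) := by
  simpa using (isRingelImage_topBot (E := E)).mul isRingelImage_botTop

theorem isRingelImage_topTop (j : Fin m) : IsRingelImage E .top .top (tiltLoop C j) := by
  simpa using (isRingelImage_topMid (E := E) j).mul (isRingelImage_midTop j)

theorem exists_eq_of_e_bot_mul {x : QHAlg C.val} (h1 : e C.val .bot * x = x)
    (h2 : x * e C.val .bot = x) : ∃ (r : K) (s : Fin m → K) (t : K),
    x = r • e C.val .bot + ∑ j, s j • tiltLoop C j + t • ll C.val := by
  refine ⟨(coord C.val x).1, fun k => ∑ j, (coord C.val x).2.2.1 j * C.val j k,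
    (coord C.val x).2.2.2.2.2, ?_⟩
  conv_lhs => rw [← h1, eq_ofCoord C.val h2, e_bot_mul_ofCoord]
  congr 2
  simp only [loop_eq_sum C, Finset.smul_sum, Finset.sum_smul, smul_smul]
  rw [Finset.sum_comm]

theorem exists_eq_of_mem_mid {x : QHAlg C.val} {k : Fin m}
    (hx : x ∈ Submodule.span (QHAlg C.val) {tiltLoop C k}) (h1 : e C.val .bot * x = x) :
    ∃ s t : K, x = s • tiltLoop C k + t • ll C.val := by
  obtain ⟨p, rfl⟩ := exists_ofCoord_mul (by simp) hx
  refine ⟨p.1, p.2.2.1 k, ?_⟩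
  rw [← h1, ofCoord_mul_tiltLoop]
  simp [mul_add]

theorem exists_eq_of_mem_bot {x : QHAlg C.val}
    (hx : x ∈ Submodule.span (QHAlg C.val) {ll C.val}) : ∃ t : K, x = t • ll C.val := by
  obtain ⟨p, rfl⟩ := exists_ofCoord_mul (by simp) hx
  exact ⟨p.1, ofCoord_mul_ll p⟩

theorem e_bot_mul_tiltGen (i : Vtx m) : e C.val .bot * tiltGen hm C i = tiltGen hm C i := by
  rcases i with _ | i | _
  · simp [tiltGen_bot]
  · simp [tiltGen_mid]
  · simp [tiltGen_top]

/-- Every map between the summands comes from `A_n(C⁻¹)`. -/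
theorem summandMap_mem_range {i k : Vtx m} (f : T i →ₗ[QHAlg C.val] T k) :
    summandMap f ∈ (ringelHom E).range := by
  obtain ⟨x, hx⟩ : ∃ x, x = tiltEmb E k (f (tiltGenerator E i)) := ⟨_, rfl⟩
  have hmem : x ∈ Submodule.span (QHAlg C.val) {tiltGen hm C k} := hx ▸ tiltEmb_mem E k _
  -- The image of the generator inherits every relation of `t(i)`. These relations limit its
  -- coordinates to those reached by the explicit maps below.
  have hann : ∀ a : QHAlg C.val, a * tiltGen hm C i = 0 → a * x = 0 := fun a ha => by
    have : a • tiltGenerator E i = 0 := tiltEmb_injective E i (by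
      rw [map_smul, tiltEmb_tiltGenerator, map_zero]; exact ha)
    rw [hx, ← smul_eq_mul, ← map_smul, ← map_smul, this, map_zero, map_zero]
  have h1 : e C.val .bot * x = x := by
    have := hann (e C.val .bot - 1) (by rw [sub_mul, e_bot_mul_tiltGen, one_mul, sub_self])
    rwa [sub_mul, one_mul, sub_eq_zero] at this
  suffices h : ∃ y, IsRingelImage E i k y ∧ x = tiltGen hm C i * y by
    obtain ⟨y, hy, hxy⟩ := h
    exact hy.mem_range (hx ▸ hxy)
  clear hx f
  rcases k with _ | k | _
  · rw [tiltGen_bot] at hmem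
    obtain ⟨t, rfl⟩ := exists_eq_of_mem_bot hmem
    rcases i with _ | i | _
    · exact ⟨t • 1, (IsRingelImage.one _).smul t, by simp [tiltGen_bot]⟩
    · exact ⟨t • dualLoop C i, (isRingelImage_midBot i).smul t, by simp [tiltGen_mid]⟩
    · exact ⟨t • ll C.val, isRingelImage_topBot.smul t, by simp [tiltGen_top]⟩
  · rw [tiltGen_mid] at hmem
    obtain ⟨s, t, rfl⟩ := exists_eq_of_mem_mid hmem h1
    rcases i with _ | i | _
    -- The arrow `1 → k` kills `ll` but not `t(k)`, so the image of `ll` has no `t(k)`-component.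
    · have hs : s • wm C.val k = 0 := by
        simpa [mul_add] using hann (bm C.val k) (by simp [tiltGen_bot])
      rw [(smul_eq_zero.1 hs).resolve_right (wm_ne_zero C k)]
      exact ⟨t • 1, (isRingelImage_botMid k).smul t, by simp [tiltGen_bot]⟩
    · have hll : IsRingelImage E (.mid i) (.mid k) (dualLoop C i) := by
        simpa using (isRingelImage_midBot (E := E) i).mul (isRingelImage_botMid k)
      by_cases hik : i = k
      · subst hik
        exact ⟨s • 1 + t • dualLoop C i, ((IsRingelImage.one _).smul s).add (hll.smul t), by
          simp [tiltGen_mid, mul_add]⟩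
      · have hs : s • wm C.val k = 0 := by
          simpa [mul_add] using hann (bm C.val k) (by simp [tiltGen_mid, hik])
        rw [(smul_eq_zero.1 hs).resolve_right (wm_ne_zero C k)]
        exact ⟨t • dualLoop C i, hll.smul t, by simp [tiltGen_mid]⟩
    · have hll : IsRingelImage E .top (.mid k) (ll C.val) := by
        simpa using (isRingelImage_topBot (E := E)).mul (isRingelImage_botMid k)
      exact ⟨s • tiltLoop C k + t • ll C.val,
        ((isRingelImage_topMid k).smul s).add (hll.smul t), by simp [tiltGen_top, mul_add]⟩
  · rw [tiltGen_top] at hmem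
    obtain ⟨a, ha⟩ := Submodule.mem_span_singleton.1 hmem
    obtain ⟨r, s, t, rfl⟩ := exists_eq_of_e_bot_mul h1 (by
      rw [← ha, smul_eq_mul, mul_assoc, e_mul_self])
    have hr : bt C.val * tiltGen hm C i = 0 → r = 0 := fun h => by
      have := hann _ h
      simp only [mul_add, mul_smul_comm, Finset.mul_sum, bt_mul_e, bt_mul_tiltLoop, bt_mul_ll,
        if_true, smul_zero, Finset.sum_const_zero, add_zero] at this
      exact (smul_eq_zero.1 this).resolve_right (bt_ne_zero C)
    have hs : ∀ k, r = 0 → bm C.val k * tiltGen hm C i = 0 → s k = 0 := fun k hr h => by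
      have := hann _ h
      simp [mul_add, Finset.mul_sum, hr] at this
      exact this.resolve_right (wm_ne_zero C k)
    rcases i with _ | i | _
    · have hr := hr (by simp [tiltGen_bot])
      have hs := fun k => hs k hr (by simp [tiltGen_bot])
      exact ⟨t • 1, isRingelImage_botTop.smul t, by simp [hr, hs, tiltGen_bot]⟩
    · have hr := hr (by simp [tiltGen_mid])
      have hs : ∀ k, k ≠ i → s k = 0 := fun k hk => hs k hr (by simp [tiltGen_mid, hk.symm])
      have hsum : ∑ j, s j • tiltLoop C j = s i • tiltLoop C i :=
        Finset.sum_eq_single i (fun j _ hj => by rw [hs j hj, zero_smul]) (by simp)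
      have hll : IsRingelImage E (.mid i) .top (dualLoop C i) := by
        simpa using (isRingelImage_midBot (E := E) i).mul isRingelImage_botTop
      exact ⟨s i • 1 + t • dualLoop C i, ((isRingelImage_midTop i).smul _).add (hll.smul t), by
        simp [hr, hsum, tiltGen_mid, mul_add]⟩
    · refine ⟨r • 1 + ∑ j, s j • tiltLoop C j + t • ll C.val, IsRingelImage.add (IsRingelImage.add
        ((IsRingelImage.one _).smul r) (IsRingelImage.sum _ fun j =>
          (isRingelImage_topTop j).smul _)) (isRingelImage_topTop_ll.smul t), ?_⟩
      simp [tiltGen_top, mul_add, Finset.mul_sum]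

theorem ringelHom_surjective : Function.Surjective (ringelHom E) := by
  rw [← AlgHom.range_eq_top, eq_top_iff]
  intro F _
  rw [eq_sum_summandMap F]
  exact Subalgebra.sum_mem _ fun k _ => Subalgebra.sum_mem _ fun i _ => summandMap_mem_range _

/-- By the simple socle and faithfulness for `C⁻¹` it suffices that the longest path survives. Its
image is the composite `T(n) → T(j) → T(1) → T(j) → T(n)` at the middle index `j = 0`, which sends
`e_1` to `ll`. -/
theorem ringelHom_injective : Function.Injective (ringelHom E) := by
  refine injective_of_map_ll_ne_zero _ (C⁻¹).isUnit _ fun h => ?_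
  have h1 : ringelHom E (ll C⁻¹.val) = summandMap
      ((mulHom E (arrowElt C (.midBot 0)) (tiltGen_mul_arrowElt C hm (.midBot 0)) ∘ₗ
        mulHom E (arrowElt C (.topMid 0)) (tiltGen_mul_arrowElt C hm (.topMid 0))) ∘ₗ
      (mulHom E (arrowElt C (.midTop 0)) (tiltGen_mul_arrowElt C hm (.midTop 0)) ∘ₗ
        mulHom E (arrowElt C (.botMid 0)) (tiltGen_mul_arrowElt C hm (.botMid 0)))) := by
    rw [ll, tb, bt, map_mul, map_mul, map_mul, mb, tm, mt, bm, ringelHom_arr, ringelHom_arr,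
      ringelHom_arr, ringelHom_arr, summandMap_mul, summandMap_mul, summandMap_mul]
  rw [h1, ← summandMap_zero] at h
  have h2 := congrArg (fun f => tiltEmb E _ (f (tiltGenerator E _))) (summandMap_injective h)
  simp only [LinearMap.comp_apply, tiltEmb_mulHom, tiltEmb_tiltGenerator, LinearMap.zero_apply,
    map_zero] at h2
  simp [arrowElt, Vtx.swap, tiltGen_top, ll_ne_zero] at h2

variable (E) in
/-- The Ringel dual of `A_n(C)` is `A_n(C⁻¹)`. -/
noncomputable def ringelEquiv : RingelDual (QHAlg C.val) T ≃ₐ[K] QHAlg C⁻¹.val :=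
  (AlgEquiv.ofBijective (ringelHom E) ⟨ringelHom_injective, ringelHom_surjective⟩).symm

theorem ringelEquiv_summandProj (i : Vtx m) :
    ringelEquiv E (summandProj (QHAlg C.val) T i) = e C⁻¹.val i.swap := by
  rw [ringelEquiv, AlgEquiv.symm_apply_eq]
  change _ = ringelHom E _
  rw [ringelHom_e, Vtx.swap_swap]

end Homs

end QHAlg

/-! ### The theorem. -/

theorem lemma1p2 {K : Type u} [Field K] (n : ℕ) (hn : 3 ≤ n) (C : GL (Fin (n - 2)) K) :
    (∀ i : Vtx (n - 2),
      IsTiltingModule K (QHAlg.e C.val) i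
        (Submodule.span (QHAlg C.val) {tiltGen (Nat.sub_pos_of_lt hn) C i}) ∧
      ∀ (M : Type w) [AddCommGroup M] [Module K M] [Module (QHAlg C.val) M]
        [IsScalarTower K (QHAlg C.val) M],
        IsTiltingModule K (QHAlg.e C.val) i M →
        Nonempty (M ≃ₗ[QHAlg C.val]
          Submodule.span (QHAlg C.val) {tiltGen (Nat.sub_pos_of_lt hn) C i})) ∧
    (∀ (T : Vtx (n - 2) → Type w) [∀ i, AddCommGroup (T i)] [∀ i, Module K (T i)]
        [∀ i, Module (QHAlg C.val) (T i)] [∀ i, IsScalarTower K (QHAlg C.val) (T i)],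
      (∀ i, IsTiltingModule K (QHAlg.e C.val) i (T i)) →
      (∃ φ : RingelDual (QHAlg C.val) T ≃ₐ[K] QHAlg C⁻¹.val,
        ∀ i, φ (summandProj (QHAlg C.val) T i) = QHAlg.e C⁻¹.val i.swap) ∧
      (∃ ψ : (RingelDual (QHAlg C.val) T)ᵐᵒᵖ ≃ₐ[K] QHAlg C⁻¹.valᵀ,
        ∀ i, ψ (MulOpposite.op (summandProj (QHAlg C.val) T i)) =
          QHAlg.e C⁻¹.valᵀ i.swap)) := by
  have : NeZero (n - 2) := ⟨(Nat.sub_pos_of_lt hn).ne'⟩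
  refine ⟨fun i => ⟨QHAlg.isTiltingModule_tiltGen C _ i, fun M _ _ _ _ hM =>
    QHAlg.nonempty_equiv_tiltGen _ hM⟩, fun T _ _ _ _ hT => ?_⟩
  -- By uniqueness any choice of tilting modules may be identified with the modules `A t(i)`.
  have E := fun i => (QHAlg.nonempty_equiv_tiltGen (Nat.sub_pos_of_lt hn) (hT i)).some
  have hrev : ∀ i j, C⁻¹.valᵀ j i = C⁻¹.val i j := fun _ _ => rfl
  refine ⟨⟨QHAlg.ringelEquiv E, QHAlg.ringelEquiv_summandProj⟩,
    ⟨(AlgEquiv.op (QHAlg.ringelEquiv E)).trans (QHAlg.revEquiv hrev).symm, fun i => ?_⟩⟩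
  rw [AlgEquiv.trans_apply, AlgEquiv.symm_apply_eq, QHAlg.revEquiv_e]
  exact congrArg MulOpposite.op (QHAlg.ringelEquiv_summandProj i)
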